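/- Let $M$ be a smooth $3$-dimensional manifold with a smooth pseudo-Riemannian metric $g$ of any signature, oriented by a smooth volume form $e_{abc}$ normalised by $e_{abc}e^{abc}=(-1)^q\,6$, where $q$ is the number of negative eigenvalues of $g$. Let $\nabla$ be the Levi-Civita connection, and let the Riemann and Ricci tensors be defined by $R_{abd}{}^{c}V^d=(\nabla_a\nabla_b-\nabla_b\nabla_a)V^c$ and $R_{ab}=R_{acb}{}^{c}$. Let $R$ be the Ricci scalar, and set $$\Phi_{ab}=R_{ab}-\tfrac13 R\,g_{ab},\quad P_{ab}=-\Phi_{ab}-\tfrac1{12}R\,g_{ab},\quad A_{abc}=\nabla_bP_{ca}-\nabla_cP_{ba},\quad (*A)_{ab}=\tfrac12 e_b{}^{cd}A_{acd}.$$ Suppose that $(M,g)$ solves the topological massive gravity equations, i.e. that for some real constants $m\neq0$ and $\Lambda$ $$\Phi_{ab}=\frac1m(*A)_{ab},\qquad R=6\Lambda .$$ Extend $g$ and $\nabla$ complex-linearly to $T^{\mathbb C}M=\mathbb C\otimes TM$. At a point $p$ choose a complex frame $(k,\ell,n)$ with $g_{ab}=2k_{(a}\ell_{b)}-2n_an_b$.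 The null directions at $p$ are spanned by the vectors $\xi(s,t)=s^2k+2st\,n+t^2\ell$, $[s:t]\in\mathbb{CP}^1$, and $\Phi_{ab}$ defines the quartic form $\tfrac12\Phi_{ab}\xi^a(s,t)\xi^b(s,t)$. Its root multiplicities give the Petrov type of $\Phi_{ab}$ at $p$: I is $\{1,1,1,1\}$, II is $\{2,1,1\}$, III is $\{3,1\}$, N is $\{4\}$, D is $\{2,2\}$, and O means that the form is zero. $\Phi_{ab}$ is algebraically special at $p$ if the quartic form has a multiple root (for type O every point of $\mathbb{CP}^1$ is one). A null structure on an open set $V\subseteq M$ is a smooth complex line subbundle $\mathcal N$ of $T^{\mathbb C}M|_V$ that is null for $g$. It is co-geodetic if $\mathcal N^\perp$ is totally geodetic, i.e. $g(\nabla_XY,Z)=0$ for all $X,Y\in\Gamma(\mathcal N^\perp)$ and $Z\in\Gamma(\mathcal N)$. Let $U\subseteq M$ be an open set on which the Petrov type of $\Phi_{ab}$ is constant. Then: 1. For every $p\in U$: $\Phi_{ab}$ is algebraically special at $p$ if and only if some open neighbourhood $V\subseteq U$ of $p$ admits a co-geodetic null structure. 2. If the constant Petrov type is neither D nor O, then $\Phi_{ab}$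 is algebraically special at every point of $U$ if and only if $U$ admits a co-geodetic null structure. -/

import Mathlib

open scoped Manifold ContDiff TensorProduct

noncomputable section

namespace TMG

/-- The model space `ℝ³`. -/
abbrev E3 : Type := EuclideanSpace ℝ (Fin 3)

section LocalCoordinates

/-! ### Tensor calculus in local coordinates

In this section `G : E3 → Matrix (Fin 3) (Fin 3) ℝ` is the matrix of components `g_ij` of a metric
in local coordinates. Every tensor is given by its components in these coordinates. -/

/-- The partial derivative `∂_i f`. -/
def pd {F : Type*} [NormedAddCommGroup F] [NormedSpace ℝ F] (i : Fin 3) (f : E3 → F) (x : E3) : F :=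
  fderiv ℝ f x (EuclideanSpace.single i (1 : ℝ))

/-- Christoffel symbols of the Levi-Civita connection,
`Γ^k_ij = ½ g^kl (∂_i g_jl + ∂_j g_il - ∂_l g_ij)`. -/
def christoffel (G : E3 → Matrix (Fin 3) (Fin 3) ℝ) (k i j : Fin 3) (x : E3) : ℝ :=
  1 / 2 * ∑ l, (G x)⁻¹ k l *
    (pd i (fun y => G y j l) x + pd j (fun y => G y i l) x - pd l (fun y => G y i j) x)

/-- The Riemann tensor `R_abd^c`, defined by `R_abd^c V^d = (∇_a ∇_b - ∇_b ∇_a) V^c`. -/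
def riemann (G : E3 → Matrix (Fin 3) (Fin 3) ℝ) (a b d c : Fin 3) (x : E3) : ℝ :=
  pd a (christoffel G c b d) x - pd b (christoffel G c a d) x
    + ∑ f, (christoffel G c a f x * christoffel G f b d x
            - christoffel G c b f x * christoffel G f a d x)

/-- The Ricci tensor, with the sign convention `R_ab = R_acb^c`. -/
def ricci (G : E3 → Matrix (Fin 3) (Fin 3) ℝ) (a b : Fin 3) (x : E3) : ℝ :=
  ∑ c, riemann G a c b c x

/-- The Ricci scalar `R = g^ab R_ab`. -/
def scalarCurv (G : E3 → Matrix (Fin 3) (Fin 3) ℝ) (x : E3) : ℝ :=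
  ∑ a, ∑ b, (G x)⁻¹ a b * ricci G a b x

/-- The tracefree Ricci tensor `Φ_ab = R_ab - ⅓ R g_ab`. -/
def tracefreeRicci (G : E3 → Matrix (Fin 3) (Fin 3) ℝ) (a b : Fin 3) (x : E3) : ℝ :=
  ricci G a b x - 1 / 3 * scalarCurv G x * G x a b

/-- The Schouten (Rho) tensor `P_ab = -Φ_ab - (1/12) R g_ab`. -/
def schouten (G : E3 → Matrix (Fin 3) (Fin 3) ℝ) (a b : Fin 3) (x : E3) : ℝ :=
  - tracefreeRicci G a b x - 1 / 12 * scalarCurv G x * G x a b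

/-- The covariant derivative `∇_b T_ca` of a tensor `T_ca`. -/
def covDeriv₂ (G : E3 → Matrix (Fin 3) (Fin 3) ℝ) (T : Fin 3 → Fin 3 → E3 → ℝ)
    (b c a : Fin 3) (x : E3) : ℝ :=
  pd b (T c a) x - ∑ d, (christoffel G d b c x * T d a x + christoffel G d b a x * T c d x)

/-- The Cotton tensor `A_abc = ∇_b P_ca - ∇_c P_ba`. -/
def cotton (G : E3 → Matrix (Fin 3) (Fin 3) ℝ) (a b c : Fin 3) (x : E3) : ℝ :=
  covDeriv₂ G (schouten G) b c a x - covDeriv₂ G (schouten G) c b a x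

/-- The Hodge dual of the Cotton tensor, `(*A)_ab = ½ e_b^cd A_acd`, where `vol b c d x` are the
components `e_bcd` of the volume form. -/
def cottonDual (G : E3 → Matrix (Fin 3) (Fin 3) ℝ) (vol : Fin 3 → Fin 3 → Fin 3 → E3 → ℝ)
    (a b : Fin 3) (x : E3) : ℝ :=
  1 / 2 * ∑ c, ∑ d, ∑ c', ∑ d',
    vol b c' d' x * (G x)⁻¹ c' c * (G x)⁻¹ d' d * cotton G a c d x

/-- The covariant derivative `∇_X Y` of complex vector fields (the connection is extended
complex-linearly). -/
def covDeriv (G : E3 → Matrix (Fin 3) (Fin 3) ℝ) (X Y : E3 → Fin 3 → ℂ) (x : E3) : Fin 3 → ℂ :=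
  fun k => ∑ i, X x i * pd i (fun y => Y y k) x
    + ∑ i, ∑ j, (christoffel G k i j x : ℂ) * X x i * Y x j

end LocalCoordinates

section Algebra

/-! ### Null vectors and the algebraic classification at a point -/

/-- The complex-bilinear extension to `ℂ³` of the real bilinear form with matrix `B`. -/
def complexBilin (B : Matrix (Fin 3) (Fin 3) ℝ) (u v : Fin 3 → ℂ) : ℂ :=
  ∑ i, ∑ j, (B i j : ℂ) * u i * v j

/-- `(k, ℓ, n)` is an adapted null frame: `g_ab = 2 k_(a ℓ_b) - 2 n_a n_b`. -/
structure IsAdaptedFrame (B : Matrix (Fin 3) (Fin 3) ℝ) (k l n : Fin 3 → ℂ) : Prop where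
  kk : complexBilin B k k = 0
  ll : complexBilin B l l = 0
  kl : complexBilin B k l = 1
  kn : complexBilin B k n = 0
  ln : complexBilin B l n = 0
  nn : complexBilin B n n = -1 / 2

/-- The null vector `s² k + 2 s t n + t² ℓ`. When `(s, t)` runs over homogeneous coordinates on
`ℂP¹`, these are all the complex null directions; `z = t / s` is the affine coordinate. -/
def nullVector (k l n : Fin 3 → ℂ) (s t : ℂ) : Fin 3 → ℂ :=
  s ^ 2 • k + (2 * s * t) • n + t ^ 2 • l

/-- The homogeneous quartic form `½ Φ_ab ξ^a ξ^b` in `(s, t)`, with `ξ = s² k + 2 s t n + t² ℓ`. -/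
def ricciQuartic (Φ : Matrix (Fin 3) (Fin 3) ℝ) (k l n : Fin 3 → ℂ) (s t : ℂ) : ℂ :=
  1 / 2 * complexBilin Φ (nullVector k l n s t) (nullVector k l n s t)

/-- The complex line `L` is a multiple principal null direction of `Φ`: it is the null direction
attached to a point `[s₀ : t₀]` of `ℂP¹` that is a multiple root of the quartic form of `Φ`, which
means that the quartic form is divisible by `(t₀ s - s₀ t)²`. -/
def IsMultiplePrincipal (B Φ : Matrix (Fin 3) (Fin 3) ℝ) (L : Submodule ℂ (Fin 3 → ℂ)) : Prop :=
  ∃ k l n : Fin 3 → ℂ, IsAdaptedFrame B k l n ∧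
    ∃ s₀ t₀ : ℂ, (s₀, t₀) ≠ (0, 0) ∧ L = Submodule.span ℂ {nullVector k l n s₀ t₀} ∧
      ∃ c₀ c₁ c₂ : ℂ, ∀ s t : ℂ, ricciQuartic Φ k l n s t =
        (t₀ * s - s₀ * t) ^ 2 * (c₀ * s ^ 2 + c₁ * s * t + c₂ * t ^ 2)

/-- The (complex) Petrov types. -/
inductive PetrovType : Type
  | I
  | II
  | III
  | N
  | D
  | O

/-- The linear form `a₁ s + a₂ t` on `ℂ²`. -/
def linForm (a : ℂ × ℂ) (s t : ℂ) : ℂ := a.1 * s + a.2 * t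

/-- The linear forms with coefficients `a` and `b` are not proportional. -/
def NotProp (a b : ℂ × ℂ) : Prop := a.1 * b.2 - a.2 * b.1 ≠ 0

/-- A quartic form is of a given Petrov type, according to the multiplicities of its roots:
I is {1,1,1,1}, II is {2,1,1}, III is {3,1}, N is {4}, D is {2,2}, O is the zero form. -/
def QuarticHasType (q : ℂ → ℂ → ℂ) : PetrovType → Prop
  | .I => ∃ a b c d : ℂ × ℂ, NotProp a b ∧ NotProp a c ∧ NotProp a d ∧ NotProp b c ∧
      NotProp b d ∧ NotProp c d ∧
      ∀ s t, q s t = linForm a s t * linForm b s t * linForm c s t * linForm d s t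
  | .II => ∃ a b c : ℂ × ℂ, NotProp a b ∧ NotProp a c ∧ NotProp b c ∧
      ∀ s t, q s t = linForm a s t ^ 2 * linForm b s t * linForm c s t
  | .III => ∃ a b : ℂ × ℂ, NotProp a b ∧ ∀ s t, q s t = linForm a s t ^ 3 * linForm b s t
  | .N => ∃ a : ℂ × ℂ, a ≠ (0, 0) ∧ ∀ s t, q s t = linForm a s t ^ 4
  | .D => ∃ a b : ℂ × ℂ, NotProp a b ∧ ∀ s t, q s t = linForm a s t ^ 2 * linForm b s t ^ 2
  | .O => ∀ s t, q s t = 0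

/-- `Φ` is of Petrov type `τ`. Adapted frames always exist, and the type of the quartic form does
not depend on the adapted frame. -/
def HasPetrovType (B Φ : Matrix (Fin 3) (Fin 3) ℝ) (τ : PetrovType) : Prop :=
  ∀ k l n : Fin 3 → ℂ, IsAdaptedFrame B k l n → QuarticHasType (ricciQuartic Φ k l n) τ

end Algebra

section Manifold

/-! ### Oriented pseudo-Riemannian three-manifolds -/

/-- A smooth pseudo-Riemannian metric (of any signature) on a three-manifold. -/
structure PseudoRiemannianMetric (M : Type*) [TopologicalSpace M] [ChartedSpace E3 M]
    [IsManifold (𝓡 3) ∞ M] where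
  inner (p : M) : TangentSpace (𝓡 3) p →L[ℝ] TangentSpace (𝓡 3) p →L[ℝ] ℝ
  symm (p : M) (v w : TangentSpace (𝓡 3) p) : inner p v w = inner p w v
  nondegenerate (p : M) (v : TangentSpace (𝓡 3) p) : (∀ w, inner p v w = 0) → v = 0
  contMDiff : ContMDiff (𝓡 3) ((𝓡 3).prod 𝓘(ℝ, E3 →L[ℝ] E3 →L[ℝ] ℝ)) ∞
    (fun p : M => Bundle.TotalSpace.mk' (E3 →L[ℝ] E3 →L[ℝ] ℝ)
      (E := fun p : M => TangentSpace (𝓡 3) p →L[ℝ] TangentSpace (𝓡 3) p →L[ℝ] ℝ) p (inner p))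

variable {M : Type*} [TopologicalSpace M] [ChartedSpace E3 M]

/-- The coordinate vector field `∂/∂x^i` of the chart `e`, at the point with coordinates `x`. -/
def coordVec (e : OpenPartialHomeomorph M E3) (i : Fin 3) (x : E3) :
    TangentSpace (𝓡 3) (e.symm x) :=
  mfderiv (𝓡 3) (𝓡 3) e.symm x (EuclideanSpace.single i (1 : ℝ) : E3)

variable [IsManifold (𝓡 3) ∞ M]

/-- An orientation of a pseudo-Riemannian three-manifold, given by a smooth volume form `e_abc`
normalised by `e_abc e^abc = (-1)^q 6`, with `q` the number of negative eigenvalues of the metric.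
Equivalently, `e(v₁, v₂, v₃)² = |det g(v_i, v_j)|`. -/
structure OrientingVolumeForm (g : PseudoRiemannianMetric M) where
  form (p : M) : AlternatingMap ℝ (TangentSpace (𝓡 3) p) ℝ (Fin 3)
  normalised (p : M) (v : Fin 3 → TangentSpace (𝓡 3) p) :
    form p v ^ 2 = |(Matrix.of fun i j => g.inner p (v i) (v j)).det|
  smooth (e : OpenPartialHomeomorph M E3) (he : e ∈ atlas E3 M) (i j k : Fin 3) :
    ContDiffOn ℝ ∞
      (fun x => form (e.symm x) ![coordVec e i x, coordVec e j x, coordVec e k x]) e.target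

/-- The components `g_ij` of the metric in the chart `e`. -/
def PseudoRiemannianMetric.comp (g : PseudoRiemannianMetric M) (e : OpenPartialHomeomorph M E3)
    (x : E3) : Matrix (Fin 3) (Fin 3) ℝ :=
  Matrix.of fun i j => g.inner (e.symm x) (coordVec e i x) (coordVec e j x)

/-- The components `e_ijk` of the volume form in the chart `e`. -/
def OrientingVolumeForm.comp {g : PseudoRiemannianMetric M} (vol : OrientingVolumeForm g)
    (e : OpenPartialHomeomorph M E3) (i j k : Fin 3) (x : E3) : ℝ :=
  vol.form (e.symm x) ![coordVec e i x, coordVec e j x, coordVec e k x]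

/-- The matrix of components `Φ_ij` of the tracefree Ricci tensor in the chart `e`. -/
def tracefreeRicciComp (g : PseudoRiemannianMetric M) (e : OpenPartialHomeomorph M E3)
    (x : E3) : Matrix (Fin 3) (Fin 3) ℝ :=
  Matrix.of fun i j => tracefreeRicci (g.comp e) i j x

/-- The topological massive gravity equations `Φ_ab = (1/m) (*A)_ab`, `R = 6 Λ`. -/
def SolvesTMG (g : PseudoRiemannianMetric M) (vol : OrientingVolumeForm g) (m Λ : ℝ) : Prop :=
  ∀ e ∈ atlas E3 M, ∀ x ∈ e.target,
    (∀ a b, tracefreeRicci (g.comp e) a b x = 1 / m * cottonDual (g.comp e) (vol.comp e) a b x) ∧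
    scalarCurv (g.comp e) x = 6 * Λ

/-- The Petrov type of the tracefree Ricci tensor at the point `p` is `τ`. -/
def HasPetrovTypeAt (g : PseudoRiemannianMetric M) (p : M) (τ : PetrovType) : Prop :=
  ∀ e ∈ atlas E3 M, p ∈ e.source →
    HasPetrovType (g.comp e (e p)) (tracefreeRicciComp g e (e p)) τ

/-- The real-linear map sending a tangent vector at `p` to its components in the chart `e`,
viewed as complex numbers. -/
def realCoords (e : OpenPartialHomeomorph M E3) (p : M) :
    TangentSpace (𝓡 3) p →ₗ[ℝ] (Fin 3 → ℂ) where
  toFun v i := (((EuclideanSpace.proj i : E3 →L[ℝ] ℝ) (mfderiv (𝓡 3) (𝓡 3) e p v) : ℝ) : ℂ)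
  map_add' v w := by
    funext i
    rw [map_add]
    exact (congrArg Complex.ofReal (map_add (EuclideanSpace.proj i : E3 →L[ℝ] ℝ) _ _)).trans
      (Complex.ofReal_add _ _)
  map_smul' c v := by
    funext i
    rw [map_smul]
    exact (congrArg Complex.ofReal (map_smul (EuclideanSpace.proj i : E3 →L[ℝ] ℝ) _ _)).trans
      (Complex.ofReal_mul _ _)

/-- The complex-linear map sending a complexified tangent vector at `p`, an element of
`ℂ ⊗ T_p M`, to its components in the chart `e`. -/
def complexCoords (e : OpenPartialHomeomorph M E3) (p : M) :
    ℂ ⊗[ℝ] TangentSpace (𝓡 3) p →ₗ[ℂ] (Fin 3 → ℂ) :=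
  LinearMap.liftBaseChange ℂ (realCoords e p)

/-- The complex line `L ⊆ ℂ ⊗ T_p M` is a multiple principal null direction of the tracefree Ricci
tensor at `p`. -/
def IsMultiplePrincipalAt (g : PseudoRiemannianMetric M) (p : M)
    (L : Submodule ℂ (ℂ ⊗[ℝ] TangentSpace (𝓡 3) p)) : Prop :=
  ∀ e ∈ atlas E3 M, p ∈ e.source →
    IsMultiplePrincipal (g.comp e (e p)) (tracefreeRicciComp g e (e p))
      (L.map (complexCoords e p))

/-- The tracefree Ricci tensor is algebraically special at `p`: it has a multiple principal null
direction there. -/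
def AlgSpecialAt (g : PseudoRiemannianMetric M) (p : M) : Prop :=
  ∃ L : Submodule ℂ (ℂ ⊗[ℝ] TangentSpace (𝓡 3) p), IsMultiplePrincipalAt g p L

/-- The expression in the chart `e` of a field `N` of complex subspaces of the complexified tangent
spaces. -/
def lineInChart (N : ∀ p : M, Submodule ℂ (ℂ ⊗[ℝ] TangentSpace (𝓡 3) p))
    (e : OpenPartialHomeomorph M E3) (x : E3) : Submodule ℂ (Fin 3 → ℂ) :=
  (N (e.symm x)).map (complexCoords e (e.symm x))

/-- `N` is a null structure on the open set `V`: a smooth line subbundle of the complexified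
tangent bundle over `V` that is null for the complexified metric. -/
def IsNullStructureOn (g : PseudoRiemannianMetric M) (V : Set M)
    (N : ∀ p : M, Submodule ℂ (ℂ ⊗[ℝ] TangentSpace (𝓡 3) p)) : Prop :=
  ∀ e ∈ atlas E3 M, ∀ x ∈ e.target ∩ e.symm ⁻¹' V,
    ∃ W : Set E3, IsOpen W ∧ x ∈ W ∧ W ⊆ e.target ∩ e.symm ⁻¹' V ∧
      ∃ K : E3 → Fin 3 → ℂ, ContDiffOn ℝ ∞ K W ∧ ∀ y ∈ W,
        K y ≠ 0 ∧ lineInChart N e y = Submodule.span ℂ {K y} ∧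
        complexBilin (g.comp e y) (K y) (K y) = 0

/-- `v` belongs to the orthogonal complement `L^⊥` for the complexified metric. -/
def MemPerp (B : Matrix (Fin 3) (Fin 3) ℝ) (L : Submodule ℂ (Fin 3 → ℂ)) (v : Fin 3 → ℂ) : Prop :=
  ∀ k ∈ L, complexBilin B v k = 0

/-- The orthogonal complement of `N` is totally geodetic on `V`: `g(∇_X Y, Z) = 0` for all
(local, smooth) sections `X, Y` of `N^⊥` and `Z` of `N`. -/
def PerpTotallyGeodeticOn (g : PseudoRiemannianMetric M) (V : Set M)
    (N : ∀ p : M, Submodule ℂ (ℂ ⊗[ℝ] TangentSpace (𝓡 3) p)) : Prop :=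
  ∀ e ∈ atlas E3 M, ∀ W : Set E3, IsOpen W → W ⊆ e.target ∩ e.symm ⁻¹' V →
    ∀ X Y Z : E3 → Fin 3 → ℂ, ContDiffOn ℝ ∞ X W → ContDiffOn ℝ ∞ Y W → ContDiffOn ℝ ∞ Z W →
      (∀ y ∈ W, MemPerp (g.comp e y) (lineInChart N e y) (X y) ∧
        MemPerp (g.comp e y) (lineInChart N e y) (Y y) ∧ Z y ∈ lineInChart N e y) →
      ∀ y ∈ W, complexBilin (g.comp e y) (covDeriv (g.comp e) X Y y) (Z y) = 0

/-- The open set `V` admits a co-geodetic null structure. -/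
def AdmitsCoGeodeticNullStructure (g : PseudoRiemannianMetric M) (V : Set M) : Prop :=
  ∃ N : ∀ p : M, Submodule ℂ (ℂ ⊗[ℝ] TangentSpace (𝓡 3) p),
    IsNullStructureOn g V N ∧ PerpTotallyGeodeticOn g V N

end Manifold

end TMG

end

/-! In an adapted frame with `k` along a null line, put `σ(v) = g(∇_v k, n)`, `T = ∇Φ` and `ε = e(k,
ℓ, n)`. The line is co-geodetic exactly when `σ(k) = σ(n) = 0`. It is a double root of the quartic
exactly when `Φ(k, k) = Φ(k, n) = 0`, that is, when `k` is a null eigenvector of `Φ`. Since `R` is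
constant, the metric part of the Schouten tensor is parallel, and the field equations express `m Φ`
through antisymmetrised components of `T`, with `ε` constant and `ε⁴ = 1/4` (`LocalTMG.phi_frame`).

A double root is co-geodetic when `Φ ≠ 0` (`LocalTMG.coGeodetic_of_special`): with `Φ(k, k)` and
`Φ(k, n)` identically zero, the relevant components of `T` are purely algebraic, and the field
equations give `σ(k) q = σ(n) q = 0`. Here `q` is the first of `Φ(n, n)`, `Φ(n, ℓ)`, `Φ(ℓ, ℓ)` that
does not vanish; constancy of the Petrov type ensures that the earlier ones vanish on an open set.

A co-geodetic line is a double root (`LocalTMG.special_of_coGeodetic`): the curvature `R(k, n)`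
preserves the direction of `k`, which gives `Φ(k, k) = 0`. For `φ = Φ(k, n)` the field equations
give the derivatives along `k` and `n` as multiples of `φ`. Their commutator, compared with two
expressions of `φ` as a curvature component, is `5 φ² = 0`. No assumption on the Petrov type enters.

A smooth double root has to be produced from constancy of the type
(`LocalMetric.exists_smooth_nullEigen`). In types II, III and N a polynomial in the endomorphism
`Φ♯`, with smooth coefficients, has rank one with image the double root, so it yields a smooth
generator; it also shows that the double root is unique, so the local lines fit together. In type D
the corresponding matrix has image a non-null line, and the two double roots are the null directions
orthogonal to it; a local square root selects one of them.

In type O the metric has constant curvature. The system `∇_u V = Λ f u`, `∂_u f = g(u, V)` is then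
flat, and a plane of solutions that is totally null for the invariant pairing `g(V, V') - Λ f f'`
gives the co-geodetic field `f₂ V₁ - f₁ V₂` (`LocalMetric.exists_coGeodetic_of_einstein`).

All of this happens in one chart. Chart transitions are isometries and preserve the connection, so a
field in one chart defines a null structure on the manifold (`isLocallyCoGeodetic_of_chart`). -/

open scoped Manifold ContDiff TensorProduct

noncomputable section

namespace TMG

/-! ### Adapted frames, null directions and the quartic form at a point -/

section PointwiseAlgebra

variable {B Φ : Matrix (Fin 3) (Fin 3) ℝ} {k l n u v w : Fin 3 → ℂ}

theorem complexBilin_add_left (B : Matrix (Fin 3) (Fin 3) ℝ) (u v w : Fin 3 → ℂ) :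
    complexBilin B (u + v) w = complexBilin B u w + complexBilin B v w := by
  simp only [complexBilin, Fin.sum_univ_three, Pi.add_apply]; ring

theorem complexBilin_add_right (B : Matrix (Fin 3) (Fin 3) ℝ) (u v w : Fin 3 → ℂ) :
    complexBilin B u (v + w) = complexBilin B u v + complexBilin B u w := by
  simp only [complexBilin, Fin.sum_univ_three, Pi.add_apply]; ring

theorem complexBilin_sub_left (B : Matrix (Fin 3) (Fin 3) ℝ) (u v w : Fin 3 → ℂ) :
    complexBilin B (u - v) w = complexBilin B u w - complexBilin B v w := by
  simp only [complexBilin, Fin.sum_univ_three, Pi.sub_apply]; ring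

theorem complexBilin_sub_right (B : Matrix (Fin 3) (Fin 3) ℝ) (u v w : Fin 3 → ℂ) :
    complexBilin B u (v - w) = complexBilin B u v - complexBilin B u w := by
  simp only [complexBilin, Fin.sum_univ_three, Pi.sub_apply]; ring

theorem complexBilin_smul_left (B : Matrix (Fin 3) (Fin 3) ℝ) (c : ℂ) (u v : Fin 3 → ℂ) :
    complexBilin B (c • u) v = c * complexBilin B u v := by
  simp only [complexBilin, Fin.sum_univ_three, Pi.smul_apply, smul_eq_mul]; ring

theorem complexBilin_smul_right (B : Matrix (Fin 3) (Fin 3) ℝ) (c : ℂ) (u v : Fin 3 → ℂ) :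
    complexBilin B u (c • v) = c * complexBilin B u v := by
  simp only [complexBilin, Fin.sum_univ_three, Pi.smul_apply, smul_eq_mul]; ring

theorem complexBilin_neg_left (B : Matrix (Fin 3) (Fin 3) ℝ) (u v : Fin 3 → ℂ) :
    complexBilin B (-u) v = -complexBilin B u v := by
  simp only [complexBilin, Fin.sum_univ_three, Pi.neg_apply]; ring

theorem complexBilin_zero_left (B : Matrix (Fin 3) (Fin 3) ℝ) (u : Fin 3 → ℂ) :
    complexBilin B 0 u = 0 := by
  simp [complexBilin]

theorem complexBilin_zero_right (B : Matrix (Fin 3) (Fin 3) ℝ) (u : Fin 3 → ℂ) :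
    complexBilin B u 0 = 0 := by
  simp [complexBilin]

theorem complexBilin_comm (hB : ∀ i j, B i j = B j i) (u v : Fin 3 → ℂ) :
    complexBilin B u v = complexBilin B v u := by
  simp only [complexBilin, Fin.sum_univ_three, hB 1 0, hB 2 0, hB 2 1]; ring

theorem complexBilin_eq_dotProduct (B : Matrix (Fin 3) (Fin 3) ℝ) (u v : Fin 3 → ℂ) :
    complexBilin B u v = u ⬝ᵥ (B.map Complex.ofReal).mulVec v := by
  simp only [complexBilin, Fin.sum_univ_three, dotProduct, Matrix.mulVec, Matrix.map_apply]; ring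

theorem det_map_ofReal (B : Matrix (Fin 3) (Fin 3) ℝ) :
    (B.map Complex.ofReal).det = (B.det : ℂ) := by
  simp [Matrix.det_fin_three]

/-- Vectors with equal products against everything agree. -/
theorem eq_of_complexBilin_eq (hdet : B.det ≠ 0)
    (h : ∀ w, complexBilin B w u = complexBilin B w v) : u = v := by
  have h1 : (B.map Complex.ofReal).mulVec u = (B.map Complex.ofReal).mulVec v := by
    refine dotProduct_eq _ _ fun w => ?_
    have := h w
    rw [complexBilin_eq_dotProduct, complexBilin_eq_dotProduct] at this
    rwa [dotProduct_comm, dotProduct_comm _ w]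
  have h2 : IsUnit (B.map Complex.ofReal) := by
    rw [Matrix.isUnit_iff_isUnit_det, det_map_ofReal]
    exact isUnit_iff_ne_zero.mpr (by exact_mod_cast hdet)
  exact Matrix.mulVec_injective_of_isUnit h2 h1

namespace IsAdaptedFrame

/-- The matrix `k ℓᵀ + ℓ kᵀ - 2 n nᵀ` built from an adapted frame inverts the metric. -/
theorem mul_eq_one (hB : ∀ i j, B i j = B j i) (h : IsAdaptedFrame B k l n) :
    (Matrix.of fun i j => k i * l j + l i * k j - 2 * n i * n j) * B.map Complex.ofReal = 1 := by
  have hlk := (complexBilin_comm hB l k).trans h.kl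
  have hnk := (complexBilin_comm hB n k).trans h.kn
  have hnl := (complexBilin_comm hB n l).trans h.ln
  -- The dual basis of `(k, l, n)` is obtained by lowering `(l, k, -2n)`. A one-sided inverse of a
  -- square matrix is two-sided, so the factors may be moved cyclically.
  have key : (Matrix.of ![l, k, (-2 : ℂ) • n] * B.map Complex.ofReal) *
      (Matrix.of ![k, l, n]).transpose = 1 := by
    have e := h.kk; have e1 := h.ll; have e2 := h.kl; have e3 := h.kn; have e4 := h.ln
    have e5 := h.nn
    simp only [complexBilin, Fin.sum_univ_three] at e e1 e2 e3 e4 e5 hlk hnk hnl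
    ext i j
    simp only [Matrix.mul_apply, Fin.sum_univ_three, Matrix.of_apply, Matrix.transpose_apply,
      Matrix.map_apply, Matrix.one_apply]
    fin_cases i <;> fin_cases j <;>
      simp only [Fin.zero_eta, Fin.mk_one, Fin.reduceFinMk, Matrix.cons_val, Pi.smul_apply,
        smul_eq_mul, Fin.isValue, if_true, Fin.reduceEq, if_false]
    · linear_combination hlk
    · linear_combination e1
    · linear_combination e4
    · linear_combination e
    · linear_combination e2
    · linear_combination e3
    · linear_combination (-2) * hnk
    · linear_combination (-2) * hnl
    · linear_combination (-2) * e5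
  rw [mul_eq_one_comm, ← Matrix.mul_assoc] at key
  rw [← key]
  congr 1
  ext i j
  simp only [Matrix.mul_apply, Fin.sum_univ_three, Matrix.of_apply, Matrix.transpose_apply,
    Matrix.cons_val, Pi.smul_apply, smul_eq_mul, Fin.isValue]
  ring

theorem det_ne_zero (hB : ∀ i j, B i j = B j i) (h : IsAdaptedFrame B k l n) : B.det ≠ 0 := by
  have := congrArg Matrix.det (h.mul_eq_one hB)
  rw [Matrix.det_mul, det_map_ofReal, Matrix.det_one] at this
  intro h0
  simp [h0] at this

theorem inv_apply (hB : ∀ i j, B i j = B j i) (h : IsAdaptedFrame B k l n) (i j : Fin 3) :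
    ((B⁻¹ i j : ℝ) : ℂ) = k i * l j + l i * k j - 2 * n i * n j := by
  have h1 : (B⁻¹).map Complex.ofReal * B.map Complex.ofReal = 1 := by
    have := Matrix.nonsing_inv_mul B (isUnit_iff_ne_zero.mpr (h.det_ne_zero hB))
    have h2 := congrArg (fun A : Matrix (Fin 3) (Fin 3) ℝ => A.map Complex.ofRealHom) this
    rw [Matrix.map_mul, Matrix.map_one _ (map_zero _) (map_one _)] at h2
    exact h2
  have h3 := left_inv_eq_right_inv h1 (mul_eq_one_comm.mp (h.mul_eq_one hB))
  exact congrFun (congrFun h3 i) j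

theorem expand (hB : ∀ i j, B i j = B j i) (h : IsAdaptedFrame B k l n) (v : Fin 3 → ℂ) :
    v = complexBilin B v l • k + complexBilin B v k • l - (2 * complexBilin B v n) • n := by
  have h1 := congrArg (fun A => A.mulVec v) (h.mul_eq_one hB)
  simp only [Matrix.one_mulVec] at h1
  funext i
  rw [complexBilin_comm hB v l, complexBilin_comm hB v k, complexBilin_comm hB v n]
  conv_lhs => rw [← h1]
  simp only [complexBilin, Matrix.mulVec, dotProduct, Matrix.mul_apply, Fin.sum_univ_three,
    Matrix.of_apply, Matrix.map_apply, Pi.add_apply, Pi.sub_apply, Pi.smul_apply, smul_eq_mul]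
  ring

theorem k_ne_zero (h : IsAdaptedFrame B k l n) : k ≠ 0 := by
  rintro rfl
  have := h.kl
  simp [complexBilin_zero_left] at this

/-- The trace of an endomorphism in an adapted frame. -/
theorem trace_eq (hB : ∀ i j, B i j = B j i) (h : IsAdaptedFrame B k l n)
    (A : Fin 3 → Fin 3 → ℂ) :
    ∑ c, A c c = complexBilin B (fun c => ∑ d, A d c * k d) l
      + complexBilin B (fun c => ∑ d, A d c * l d) k
      - 2 * complexBilin B (fun c => ∑ d, A d c * n d) n := by
  have e : ∀ i j, (∑ c, (k i * l c + l i * k c - 2 * n i * n c) * (B c j : ℂ)) =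
      if i = j then 1 else 0 := fun i j => by
    have := congrFun (congrFun (h.mul_eq_one hB) i) j
    simpa [Matrix.mul_apply, Matrix.one_apply] using this
  have h1 : ∑ c, A c c = ∑ i, ∑ j, A i j * (if i = j then 1 else 0) := by
    simp
  rw [h1]
  simp only [← e, complexBilin, Fin.sum_univ_three, hB 1 0, hB 2 0, hB 2 1]
  ring

/-- A change of adapted frame induced by an element of `SL(2, ℂ)`. -/
theorem rotate (hB : ∀ i j, B i j = B j i) (h : IsAdaptedFrame B k l n) {s₀ t₀ s₁ t₁ : ℂ}
    (hdet : s₀ * t₁ - t₀ * s₁ = 1) :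
    IsAdaptedFrame B (nullVector k l n s₀ t₀) (nullVector k l n s₁ t₁)
      ((s₀ * s₁) • k + (s₀ * t₁ + t₀ * s₁) • n + (t₀ * t₁) • l) := by
  have hlk := (complexBilin_comm hB l k).trans h.kl
  have hnk := (complexBilin_comm hB n k).trans h.kn
  have hnl := (complexBilin_comm hB n l).trans h.ln
  constructor <;>
  simp only [nullVector, complexBilin_add_left, complexBilin_add_right, complexBilin_smul_left,
    complexBilin_smul_right, h.kk, h.ll, h.kl, h.kn, h.ln, h.nn, hlk, hnk, hnl]
  · ring
  · ring
  · linear_combination (s₀ * t₁ - t₀ * s₁ + 1) * hdet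
  · ring
  · ring
  · linear_combination (-1/2) * (s₀ * t₁ - t₀ * s₁ + 1) * hdet

end IsAdaptedFrame

/-- The null vector is the symmetric square of the spinor `(s, t)`, so the frame change of
`IsAdaptedFrame.rotate` acts linearly on the homogeneous coordinates. -/
theorem nullVector_rotate (k l n : Fin 3 → ℂ) (s₀ t₀ s₁ t₁ s t : ℂ) :
    nullVector (nullVector k l n s₀ t₀) (nullVector k l n s₁ t₁)
      ((s₀ * s₁) • k + (s₀ * t₁ + t₀ * s₁) • n + (t₀ * t₁) • l) s t =
    nullVector k l n (s * s₀ + t * s₁) (s * t₀ + t * t₁) := by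
  funext i
  simp only [nullVector, Pi.add_apply, Pi.smul_apply, smul_eq_mul]
  ring

/-- For tracefree `Φ` the middle coefficient is `3 Φ(n, n)`, so the five coefficients carry all of
`Φ`. -/
theorem ricciQuartic_eq (hΦ : ∀ i j, Φ i j = Φ j i) (k l n : Fin 3 → ℂ) (s t : ℂ) :
    ricciQuartic Φ k l n s t = 1 / 2 * complexBilin Φ k k * s ^ 4 +
      2 * complexBilin Φ k n * (s ^ 3 * t) +
      (2 * complexBilin Φ n n + complexBilin Φ k l) * (s ^ 2 * t ^ 2) +
      2 * complexBilin Φ n l * (s * t ^ 3) + 1 / 2 * complexBilin Φ l l * t ^ 4 := by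
  simp only [ricciQuartic, nullVector, complexBilin_add_left, complexBilin_add_right,
    complexBilin_smul_left, complexBilin_smul_right, complexBilin_comm hΦ n k,
    complexBilin_comm hΦ l k, complexBilin_comm hΦ l n]
  ring

/-- Equality of quartic forms is equality of coefficients. -/
theorem quartic_coeff_eq {a₀ a₁ a₂ a₃ a₄ b₀ b₁ b₂ b₃ b₄ : ℂ}
    (h : ∀ s t : ℂ, a₀ * s ^ 4 + a₁ * (s ^ 3 * t) + a₂ * (s ^ 2 * t ^ 2) + a₃ * (s * t ^ 3) +
        a₄ * t ^ 4 =
      b₀ * s ^ 4 + b₁ * (s ^ 3 * t) + b₂ * (s ^ 2 * t ^ 2) + b₃ * (s * t ^ 3) + b₄ * t ^ 4) :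
    a₀ = b₀ ∧ a₁ = b₁ ∧ a₂ = b₂ ∧ a₃ = b₃ ∧ a₄ = b₄ := by
  -- Five points of the projective line determine a binary quartic; the combinations below invert
  -- the linear system.
  have h1 := h 1 0
  have h2 := h 0 1
  have h3 := h 1 1
  have h4 := h 1 (-1)
  have h5 := h 1 2
  norm_num at h1 h2 h3 h4 h5
  refine ⟨h1, ?_, ?_, ?_, h2⟩
  · linear_combination (-1/2) * h1 + 2 * h2 + h3 - (1/3) * h4 - (1/6) * h5
  · linear_combination - h1 - h2 + (1/2) * h3 + (1/2) * h4
  · linear_combination (1/2) * h1 - 2 * h2 - (1/2) * h3 - (1/6) * h4 + (1/6) * h5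

/-- A null vector that is an eigenvector of `Φ` relative to `B`. -/
def IsNullEigen (B Φ : Matrix (Fin 3) (Fin 3) ℝ) (k : Fin 3 → ℂ) : Prop :=
  k ≠ 0 ∧ complexBilin B k k = 0 ∧ ∃ μ : ℂ, ∀ w, complexBilin Φ k w = μ * complexBilin B k w

theorem IsNullEigen.smul (h : IsNullEigen B Φ k) {c : ℂ} (hc : c ≠ 0) :
    IsNullEigen B Φ (c • k) := by
  obtain ⟨h1, h2, μ, h3⟩ := h
  refine ⟨smul_ne_zero hc h1, by simp [complexBilin_smul_left, complexBilin_smul_right, h2], μ, fun w => ?_⟩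
  rw [complexBilin_smul_left, complexBilin_smul_left, h3]; ring

/-- The form `Φ(k, ·)` vanishes on `k^⊥ = span(k, n)`, hence is a multiple of `g(k, ·)`; the factor
is its value on `l`. -/
theorem IsAdaptedFrame.isNullEigen (hB : ∀ i j, B i j = B j i)
    (h : IsAdaptedFrame B k l n) (h0 : complexBilin Φ k k = 0) (h1 : complexBilin Φ k n = 0) :
    IsNullEigen B Φ k := by
  refine ⟨h.k_ne_zero, h.kk, complexBilin Φ k l, fun w => ?_⟩
  conv_lhs => rw [h.expand hB w]
  rw [complexBilin_sub_right, complexBilin_add_right, complexBilin_smul_right,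
    complexBilin_smul_right, complexBilin_smul_right, h0, h1, complexBilin_comm hB k w]
  ring

/-- The null direction of a double root of the quartic form is the first vector of an adapted
frame. -/
theorem exists_frame_of_root (hB : ∀ i j, B i j = B j i) (h : IsAdaptedFrame B k l n) {s₀ t₀ : ℂ}
    (h0 : (s₀, t₀) ≠ (0, 0)) : ∃ s₁ t₁ l' n', s₀ * t₁ - t₀ * s₁ = 1 ∧
      IsAdaptedFrame B (nullVector k l n s₀ t₀) l' n' ∧
      ∀ s t, ricciQuartic Φ (nullVector k l n s₀ t₀) l' n' s t =
        ricciQuartic Φ k l n (s * s₀ + t * s₁) (s * t₀ + t * t₁) := by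
  -- Any nonzero spinor can be completed to a unimodular basis.
  obtain ⟨s₁, t₁, hd⟩ : ∃ s₁ t₁ : ℂ, s₀ * t₁ - t₀ * s₁ = 1 := by
    by_cases hs : s₀ = 0
    · have ht : t₀ ≠ 0 := fun ht => h0 (by rw [hs, ht])
      exact ⟨-t₀⁻¹, 0, by field_simp; ring⟩
    · exact ⟨0, s₀⁻¹, by field_simp; ring⟩
  refine ⟨s₁, t₁, _, _, hd, h.rotate hB hd, fun s t => ?_⟩
  rw [ricciQuartic, nullVector_rotate, ricciQuartic]

/-- A unimodular rotation moves the root to `[1 : 0]`, where the squared factor becomes `t²`; the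
coefficients of `s⁴` and `s³t` then give the two vanishing components. -/
theorem IsMultiplePrincipal.exists_isNullEigen (hB : ∀ i j, B i j = B j i)
    (hΦ : ∀ i j, Φ i j = Φ j i) {L : Submodule ℂ (Fin 3 → ℂ)} (h : IsMultiplePrincipal B Φ L) :
    ∃ k l n, IsAdaptedFrame B k l n ∧ complexBilin Φ k k = 0 ∧ complexBilin Φ k n = 0 ∧
      L = Submodule.span ℂ {k} := by
  obtain ⟨k, l, n, hf, s₀, t₀, h0, rfl, c₀, c₁, c₂, hq⟩ := h
  obtain ⟨s₁, t₁, l', n', hd, hf', hq'⟩ := exists_frame_of_root (Φ := Φ) hB hf h0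
  have h1 := quartic_coeff_eq (b₀ := 0) (b₁ := 0)
    (b₂ := c₀ * s₀ ^ 2 + c₁ * s₀ * t₀ + c₂ * t₀ ^ 2)
    (b₃ := c₀ * 2 * s₀ * s₁ + c₁ * (s₀ * t₁ + t₀ * s₁) + c₂ * 2 * t₀ * t₁)
    (b₄ := c₀ * s₁ ^ 2 + c₁ * s₁ * t₁ + c₂ * t₁ ^ 2)
    (fun s t => (ricciQuartic_eq hΦ (nullVector k l n s₀ t₀) l' n' s t).symm.trans
    ((hq' s t).trans ((hq _ _).trans (by
      linear_combination (s₀ * t₁ - t₀ * s₁ + 1) * t ^ 2 *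
        (c₀ * (s * s₀ + t * s₁) ^ 2 + c₁ * (s * s₀ + t * s₁) * (s * t₀ + t * t₁) +
          c₂ * (s * t₀ + t * t₁) ^ 2) * hd))))
  exact ⟨_, l', n', hf', by linear_combination 2 * h1.1, by linear_combination (1/2) * h1.2.1, rfl⟩

theorem IsAdaptedFrame.isMultiplePrincipal (h : IsAdaptedFrame B k l n)
    (hΦ : ∀ i j, Φ i j = Φ j i) (h0 : complexBilin Φ k k = 0) (h1 : complexBilin Φ k n = 0) :
    IsMultiplePrincipal B Φ (Submodule.span ℂ {k}) := by
  refine ⟨k, l, n, h, 1, 0, by simp, by simp [nullVector],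
    2 * complexBilin Φ n n + complexBilin Φ k l, 2 * complexBilin Φ n l,
    1 / 2 * complexBilin Φ l l, fun s t => ?_⟩
  rw [ricciQuartic_eq hΦ, h0, h1]
  ring

end PointwiseAlgebra

/-! ### Partial and directional derivatives with complex values -/

section PartialDerivatives

variable {F : Type*} [NormedAddCommGroup F] [NormedSpace ℝ F] {Ω : Set E3} {x : E3}

theorem _root_.ContDiffOn.differentiableAt_of_isOpen {f : E3 → F} (hf : ContDiffOn ℝ ∞ f Ω)
    (hΩ : IsOpen Ω) (hx : x ∈ Ω) : DifferentiableAt ℝ f x :=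
  (hf.contDiffAt (hΩ.mem_nhds hx)).differentiableAt (by simp)

theorem _root_.ContDiffOn.pd {f : E3 → F} (hf : ContDiffOn ℝ ∞ f Ω) (hΩ : IsOpen Ω) (i : Fin 3) :
    ContDiffOn ℝ ∞ (pd i f) Ω :=
  (hf.fderiv_of_isOpen hΩ (by simp)).clm_apply contDiffOn_const

theorem pd_congr {f g : E3 → F} (hΩ : IsOpen Ω) (h : ∀ y ∈ Ω, f y = g y) (hx : x ∈ Ω)
    (i : Fin 3) : pd i f x = pd i g x := by
  have : f =ᶠ[nhds x] g := Filter.eventuallyEq_of_mem (hΩ.mem_nhds hx) h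
  rw [pd, pd, this.fderiv_eq]

theorem pd_const (c : F) (i : Fin 3) : pd i (fun _ : E3 => c) x = 0 := by
  simp [pd]

theorem pd_add {f g : E3 → F} (hf : DifferentiableAt ℝ f x) (hg : DifferentiableAt ℝ g x)
    (i : Fin 3) : pd i (fun y => f y + g y) x = pd i f x + pd i g x := by
  simp [pd, fderiv_fun_add hf hg]

theorem pd_sub {f g : E3 → F} (hf : DifferentiableAt ℝ f x) (hg : DifferentiableAt ℝ g x)
    (i : Fin 3) : pd i (fun y => f y - g y) x = pd i f x - pd i g x := by
  simp [pd, fderiv_fun_sub hf hg]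

theorem pd_neg {f : E3 → F} (i : Fin 3) : pd i (fun y => -f y) x = -pd i f x := by
  simp [pd, fderiv_fun_neg]

theorem pd_sum {ι : Type*} {s : Finset ι} {f : ι → E3 → F}
    (hf : ∀ j ∈ s, DifferentiableAt ℝ (f j) x) (i : Fin 3) :
    pd i (fun y => ∑ j ∈ s, f j y) x = ∑ j ∈ s, pd i (f j) x := by
  simp [pd, fderiv_fun_sum hf]

theorem pd_mul {A : Type*} [NormedCommRing A] [NormedAlgebra ℝ A] {f g : E3 → A}
    (hf : DifferentiableAt ℝ f x) (hg : DifferentiableAt ℝ g x)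
    (i : Fin 3) : pd i (fun y => f y * g y) x = pd i f x * g x + f x * pd i g x := by
  simp [pd, fderiv_fun_mul hf hg]; ring

theorem pd_ofReal {f : E3 → ℝ} (hf : DifferentiableAt ℝ f x) (i : Fin 3) :
    pd i (fun y => (f y : ℂ)) x = ((pd i f x : ℝ) : ℂ) := by
  have := (Complex.ofRealCLM.hasFDerivAt (x := f x)).comp x hf.hasFDerivAt
  have h2 : HasFDerivAt (fun y => (f y : ℂ)) (Complex.ofRealCLM.comp (fderiv ℝ f x)) x := this
  rw [pd, h2.fderiv]; rfl

theorem pd_comm {f : E3 → F} (hf : ContDiffOn ℝ ∞ f Ω) (hΩ : IsOpen Ω) (hx : x ∈ Ω)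
    (i j : Fin 3) : pd i (pd j f) x = pd j (pd i f) x := by
  have hf' := hf.contDiffAt (hΩ.mem_nhds hx)
  have hd : DifferentiableAt ℝ (fderiv ℝ f) x :=
    ((hf.fderiv_of_isOpen (m := ∞) hΩ (by simp)).contDiffAt (hΩ.mem_nhds hx)).differentiableAt
      (by simp)
  have key : ∀ i j, pd i (pd j f) x = fderiv ℝ (fderiv ℝ f) x (EuclideanSpace.single i (1 : ℝ))
      (EuclideanSpace.single j (1 : ℝ)) := fun i j => by
    have : HasFDerivAt (pd j f) _ x :=
      hd.hasFDerivAt.clm_apply (hasFDerivAt_const (EuclideanSpace.single j (1 : ℝ)) x)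
    rw [pd, this.fderiv]; simp
  rw [key, key]
  exact (hf'.isSymmSndFDerivAt (by rw [minSmoothness_of_isRCLikeNormedField]; exact ENat.LEInfty.out)) _ _

theorem _root_.ContDiffOn.ofReal {f : E3 → ℝ} (hf : ContDiffOn ℝ ∞ f Ω) :
    ContDiffOn ℝ ∞ (fun y => (f y : ℂ)) Ω :=
  Complex.ofRealCLM.contDiff.comp_contDiffOn hf

theorem fderiv_apply_eq_sum_pd (f : E3 → F) (x h : E3) : fderiv ℝ f x h = ∑ i, h i • pd i f x := by
  have : h = ∑ i, h i • EuclideanSpace.single i (1 : ℝ) := by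
    ext j
    fin_cases j <;> simp [Fin.sum_univ_three]
  conv_lhs => rw [this]
  simp [pd]

/-- The derivative of `f` along a complex vector `v`. -/
def dirDeriv (v : Fin 3 → ℂ) (f : E3 → ℂ) (x : E3) : ℂ := ∑ i, v i * pd i f x

theorem dirDeriv_congr {v : Fin 3 → ℂ} {f g : E3 → ℂ} (hΩ : IsOpen Ω) (h : ∀ y ∈ Ω, f y = g y)
    (hx : x ∈ Ω) : dirDeriv v f x = dirDeriv v g x := by
  simp only [dirDeriv, pd_congr hΩ h hx]

theorem dirDeriv_const (v : Fin 3 → ℂ) (c : ℂ) : dirDeriv v (fun _ => c) x = 0 := by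
  simp [dirDeriv, pd_const]

theorem dirDeriv_eq_zero {v : Fin 3 → ℂ} {f : E3 → ℂ} {c : ℂ} (hΩ : IsOpen Ω)
    (h : ∀ y ∈ Ω, f y = c) (hx : x ∈ Ω) : dirDeriv v f x = 0 :=
  (dirDeriv_congr hΩ h hx).trans (dirDeriv_const v c)

theorem dirDeriv_smul_left (c : ℂ) (v : Fin 3 → ℂ) (f : E3 → ℂ) :
    dirDeriv (c • v) f x = c * dirDeriv v f x := by
  simp [dirDeriv, Finset.mul_sum, mul_assoc]

theorem dirDeriv_add {v : Fin 3 → ℂ} {f g : E3 → ℂ} (hf : DifferentiableAt ℝ f x)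
    (hg : DifferentiableAt ℝ g x) :
    dirDeriv v (fun y => f y + g y) x = dirDeriv v f x + dirDeriv v g x := by
  simp [dirDeriv, pd_add hf hg, mul_add, Finset.sum_add_distrib]

theorem dirDeriv_sub {v : Fin 3 → ℂ} {f g : E3 → ℂ} (hf : DifferentiableAt ℝ f x)
    (hg : DifferentiableAt ℝ g x) :
    dirDeriv v (fun y => f y - g y) x = dirDeriv v f x - dirDeriv v g x := by
  simp [dirDeriv, pd_sub hf hg, mul_sub, Finset.sum_sub_distrib]

theorem dirDeriv_mul {v : Fin 3 → ℂ} {f g : E3 → ℂ} (hf : DifferentiableAt ℝ f x)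
    (hg : DifferentiableAt ℝ g x) :
    dirDeriv v (fun y => f y * g y) x = dirDeriv v f x * g x + f x * dirDeriv v g x := by
  simp only [dirDeriv, pd_mul hf hg, Fin.sum_univ_three]; ring

end PartialDerivatives

/-- A smooth pseudo-Riemannian metric on an open subset of `ℝ³`, given by its components. -/
structure LocalMetric (Ω : Set E3) (G : E3 → Matrix (Fin 3) (Fin 3) ℝ) : Prop where
  isOpen : IsOpen Ω
  smooth : ∀ i j, ContDiffOn ℝ ∞ (fun x => G x i j) Ω
  symm : ∀ x ∈ Ω, ∀ i j, G x i j = G x j i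
  det_ne_zero : ∀ x ∈ Ω, (G x).det ≠ 0

/-! ### Levi-Civita calculus on open subsets of ℝ³ -/

section LocalCalculus

variable {Ω : Set E3} {G : E3 → Matrix (Fin 3) (Fin 3) ℝ} {x : E3}

theorem LocalMetric.mono (hG : LocalMetric Ω G) {W : Set E3} (hW : IsOpen W) (h : W ⊆ Ω) :
    LocalMetric W G :=
  ⟨hW, fun i j => (hG.smooth i j).mono h, fun x hx => hG.symm x (h hx),
    fun x hx => hG.det_ne_zero x (h hx)⟩

theorem LocalMetric.contDiffOn_det (hG : LocalMetric Ω G) :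
    ContDiffOn ℝ ∞ (fun x => (G x).det) Ω := by
  have h := hG.smooth
  simp only [Matrix.det_fin_three]
  fun_prop

theorem LocalMetric.contDiffOn_inv (hG : LocalMetric Ω G) (i j : Fin 3) :
    ContDiffOn ℝ ∞ (fun x => (G x)⁻¹ i j) Ω := by
  have h : ∀ y, (G y)⁻¹ i j = ((G y).det)⁻¹ * (G y).adjugate i j := fun y => by
    rw [Matrix.inv_def, Ring.inverse_eq_inv', Matrix.smul_apply, smul_eq_mul]
  simp only [h]
  refine (hG.contDiffOn_det.inv hG.det_ne_zero).mul ?_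
  have h := hG.smooth
  fin_cases i <;> fin_cases j <;> simp [Matrix.adjugate_fin_three] <;> fun_prop

theorem LocalMetric.contDiffOn_christoffel (hG : LocalMetric Ω G) (k i j : Fin 3) :
    ContDiffOn ℝ ∞ (christoffel G k i j) Ω := by
  refine contDiffOn_const.mul (ContDiffOn.sum fun l _ => (hG.contDiffOn_inv k l).mul ?_)
  exact (((hG.smooth j l).pd hG.isOpen i).add ((hG.smooth i l).pd hG.isOpen j)).sub
    ((hG.smooth i j).pd hG.isOpen l)

theorem LocalMetric.pd_symm (hG : LocalMetric Ω G) (hx : x ∈ Ω) (l i j : Fin 3) :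
    pd l (fun y => G y i j) x = pd l (fun y => G y j i) x :=
  pd_congr hG.isOpen (fun y hy => hG.symm y hy i j) hx l

theorem LocalMetric.christoffel_symm (hG : LocalMetric Ω G) (hx : x ∈ Ω) (k i j : Fin 3) :
    christoffel G k i j x = christoffel G k j i x := by
  simp only [christoffel, hG.pd_symm hx _ i j]
  congr 1
  refine Finset.sum_congr rfl fun l _ => ?_
  ring

theorem LocalMetric.lower_christoffel (hG : LocalMetric Ω G) (hx : x ∈ Ω) (e i j : Fin 3) :
    ∑ d, G x e d * christoffel G d i j x =
      1 / 2 * (pd i (fun y => G y j e) x + pd j (fun y => G y i e) x - pd e (fun y => G y i j) x) := by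
  have h1 := Matrix.mul_nonsing_inv (G x) (isUnit_iff_ne_zero.mpr (hG.det_ne_zero x hx))
  have h2 : ∀ l, ∑ d, G x e d * (G x)⁻¹ d l = if e = l then 1 else 0 := fun l => by
    have := congrFun (congrFun h1 e) l
    simpa [Matrix.mul_apply, Matrix.one_apply] using this
  calc ∑ d, G x e d * christoffel G d i j x
      = 1 / 2 * ∑ l, (∑ d, G x e d * (G x)⁻¹ d l) *
        (pd i (fun y => G y j l) x + pd j (fun y => G y i l) x - pd l (fun y => G y i j) x) := by
        simp only [christoffel, Fin.sum_univ_three]; ring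
    _ = _ := by simp [h2]

/-- Metric compatibility: after lowering an index, the two Christoffel terms add up to the partial
derivative of the metric. -/
theorem LocalMetric.covDeriv₂_metric (hG : LocalMetric Ω G) (hx : x ∈ Ω) (b c a : Fin 3) :
    covDeriv₂ G (fun i j y => G y i j) b c a x = 0 := by
  have h1 := hG.lower_christoffel hx a b c
  have h2 := hG.lower_christoffel hx c b a
  have h3 : ∑ d, (christoffel G d b c x * G x d a + christoffel G d b a x * G x c d) =
      ∑ d, G x a d * christoffel G d b c x + ∑ d, G x c d * christoffel G d b a x := by
    rw [← Finset.sum_add_distrib]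
    refine Finset.sum_congr rfl fun d _ => ?_
    rw [hG.symm x hx d a]; ring
  rw [covDeriv₂, h3, h1, h2, hG.pd_symm hx b a c, hG.pd_symm hx c b a, hG.pd_symm hx a b c]
  rw [hG.pd_symm hx c a b]; ring

/-- The covariant derivative of the vector field `Y` along the vector `v`. -/
def covD (G : E3 → Matrix (Fin 3) (Fin 3) ℝ) (v : Fin 3 → ℂ) (Y : E3 → Fin 3 → ℂ) (x : E3) :
    Fin 3 → ℂ :=
  covDeriv G (fun _ => v) Y x

/-- The covariant derivative of the vector field `Y` along the `i`-th coordinate field. -/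
def covCoord (G : E3 → Matrix (Fin 3) (Fin 3) ℝ) (i : Fin 3) (Y : E3 → Fin 3 → ℂ) (x : E3) :
    Fin 3 → ℂ :=
  fun c => pd i (fun y => Y y c) x + ∑ d, (christoffel G c i d x : ℂ) * Y x d

theorem covD_eq_sum (v : Fin 3 → ℂ) (Y : E3 → Fin 3 → ℂ) (x : E3) :
    covD G v Y x = ∑ i, v i • covCoord G i Y x := by
  funext c
  simp only [covD, covDeriv, covCoord, Finset.sum_apply, Pi.smul_apply, smul_eq_mul,
    Fin.sum_univ_three]
  ring

theorem covDeriv_eq_covD (X Y : E3 → Fin 3 → ℂ) (x : E3) :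
    covDeriv G X Y x = covD G (X x) Y x := rfl

theorem covD_sub_left (u v : Fin 3 → ℂ) (Y : E3 → Fin 3 → ℂ) :
    covD G (u - v) Y x = covD G u Y x - covD G v Y x := by
  simp only [covD_eq_sum, Pi.sub_apply, sub_smul, Finset.sum_sub_distrib]

theorem covD_smul_left (c : ℂ) (v : Fin 3 → ℂ) (Y : E3 → Fin 3 → ℂ) :
    covD G (c • v) Y x = c • covD G v Y x := by
  simp only [covD_eq_sum, Pi.smul_apply, smul_eq_mul, mul_smul, Finset.smul_sum]

theorem covCoord_congr {Y Z : E3 → Fin 3 → ℂ} {W : Set E3} (hW : IsOpen W)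
    (h : ∀ y ∈ W, Y y = Z y) (hx : x ∈ W) (i : Fin 3) : covCoord G i Y x = covCoord G i Z x := by
  funext c
  simp only [covCoord, h x hx]
  rw [pd_congr hW (fun y hy => congrFun (h y hy) c) hx]

theorem covD_congr {v : Fin 3 → ℂ} {Y Z : E3 → Fin 3 → ℂ} {W : Set E3} (hW : IsOpen W)
    (h : ∀ y ∈ W, Y y = Z y) (hx : x ∈ W) : covD G v Y x = covD G v Z x := by
  simp only [covD_eq_sum, covCoord_congr hW h hx]

theorem covCoord_sum_smul {f : Fin 3 → E3 → ℂ} {Y : Fin 3 → E3 → Fin 3 → ℂ}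
    (hf : ∀ j, DifferentiableAt ℝ (f j) x) (hY : ∀ j, DifferentiableAt ℝ (Y j) x) (i : Fin 3) :
    covCoord G i (fun y => ∑ j, f j y • Y j y) x =
      ∑ j, (pd i (f j) x • Y j x + f j x • covCoord G i (Y j) x) := by
  funext c
  have h1 : ∀ j, DifferentiableAt ℝ (fun y => Y j y c) x := fun j => by
    have := hY j; fun_prop
  have h2 : pd i (fun y => ∑ j, f j y * Y j y c) x =
      ∑ j, (pd i (f j) x * Y j x c + f j x * pd i (fun y => Y j y c) x) := by
    rw [pd_sum (f := fun j y => f j y * Y j y c) (fun j _ => (hf j).mul (h1 j))]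
    exact Finset.sum_congr rfl fun j _ => pd_mul (hf j) (h1 j) i
  simp only [covCoord, Finset.sum_apply, Pi.add_apply, Pi.smul_apply, smul_eq_mul, h2]
  simp only [Fin.sum_univ_three]
  ring

theorem covD_smul {v : Fin 3 → ℂ} {f : E3 → ℂ} {Y : E3 → Fin 3 → ℂ}
    (hf : DifferentiableAt ℝ f x) (hY : DifferentiableAt ℝ Y x) :
    covD G v (fun y => f y • Y y) x = dirDeriv v f x • Y x + f x • covD G v Y x := by
  have h1 : ∀ c, DifferentiableAt ℝ (fun y => Y y c) x := fun c => by fun_prop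
  funext c
  simp only [covD_eq_sum, covCoord, dirDeriv, Pi.add_apply, Pi.smul_apply, smul_eq_mul,
    pd_mul hf (h1 _), Finset.sum_apply, Fin.sum_univ_three]
  ring

theorem covD_add {v : Fin 3 → ℂ} {Y Z : E3 → Fin 3 → ℂ}
    (hY : DifferentiableAt ℝ Y x) (hZ : DifferentiableAt ℝ Z x) :
    covD G v (fun y => Y y + Z y) x = covD G v Y x + covD G v Z x := by
  have h1 : ∀ c, DifferentiableAt ℝ (fun y => Y y c) x := fun c => by fun_prop
  have h2 : ∀ c, DifferentiableAt ℝ (fun y => Z y c) x := fun c => by fun_prop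
  funext c
  simp only [covD_eq_sum, covCoord, Pi.add_apply, Pi.smul_apply, smul_eq_mul,
    pd_add (h1 _) (h2 _), Finset.sum_apply, Fin.sum_univ_three]
  ring

theorem LocalMetric.contDiffOn_covCoord (hG : LocalMetric Ω G) {Y : E3 → Fin 3 → ℂ}
    (hY : ContDiffOn ℝ ∞ Y Ω) (i : Fin 3) : ContDiffOn ℝ ∞ (covCoord G i Y) Ω := by
  rw [contDiffOn_pi] at hY ⊢
  exact fun c => ((hY c).pd hG.isOpen i).add
    (ContDiffOn.sum fun d _ => (hG.contDiffOn_christoffel c i d).ofReal.mul (hY d))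

theorem LocalMetric.contDiffOn_covD (hG : LocalMetric Ω G) {X Y : E3 → Fin 3 → ℂ}
    (hX : ContDiffOn ℝ ∞ X Ω) (hY : ContDiffOn ℝ ∞ Y Ω) :
    ContDiffOn ℝ ∞ (fun y => covD G (X y) Y y) Ω := by
  simp only [covD_eq_sum]
  exact ContDiffOn.sum fun i _ => ((contDiffOn_pi.mp hX) i).smul (hG.contDiffOn_covCoord hY i)

theorem contDiffOn_complexBilin {S : E3 → Matrix (Fin 3) (Fin 3) ℝ}
    (hS : ∀ i j, ContDiffOn ℝ ∞ (fun y => S y i j) Ω) {Y Z : E3 → Fin 3 → ℂ}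
    (hY : ContDiffOn ℝ ∞ Y Ω) (hZ : ContDiffOn ℝ ∞ Z Ω) :
    ContDiffOn ℝ ∞ (fun y => complexBilin (S y) (Y y) (Z y)) Ω :=
  ContDiffOn.sum fun i _ => ContDiffOn.sum fun j _ =>
    ((hS i j).ofReal.mul ((contDiffOn_pi.mp hY) i)).mul ((contDiffOn_pi.mp hZ) j)

/-- The trilinear form of the covariant derivative of a covariant 2-tensor. -/
def covTensor (G : E3 → Matrix (Fin 3) (Fin 3) ℝ) (S : E3 → Matrix (Fin 3) (Fin 3) ℝ) (x : E3)
    (u v w : Fin 3 → ℂ) : ℂ :=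
  ∑ b, ∑ c, ∑ a, (covDeriv₂ G (fun i j y => S y i j) b c a x : ℂ) * u b * v c * w a

/-- The Leibniz rule. For the metric the tensor term vanishes; for `Φ` the rule computes `∇Φ` in a
moving frame from the derivatives of the frame components. -/
theorem dirDeriv_complexBilin {S : E3 → Matrix (Fin 3) (Fin 3) ℝ}
    (hS : ∀ i j, DifferentiableAt ℝ (fun y => S y i j) x) {Y Z : E3 → Fin 3 → ℂ}
    (hY : DifferentiableAt ℝ Y x) (hZ : DifferentiableAt ℝ Z x) (v : Fin 3 → ℂ) :
    dirDeriv v (fun y => complexBilin (S y) (Y y) (Z y)) x =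
      covTensor G S x v (Y x) (Z x) + complexBilin (S x) (covD G v Y x) (Z x) +
        complexBilin (S x) (Y x) (covD G v Z x) := by
  have h1 : ∀ c, DifferentiableAt ℝ (fun y => Y y c) x := fun c => by fun_prop
  have h2 : ∀ c, DifferentiableAt ℝ (fun y => Z y c) x := fun c => by fun_prop
  have h3 : ∀ i j, DifferentiableAt ℝ (fun y => (S y i j : ℂ)) x := fun i j =>
    Complex.ofRealCLM.differentiableAt.comp x (hS i j)
  have h4 : ∀ i, pd i (fun y => complexBilin (S y) (Y y) (Z y)) x = ∑ c, ∑ a,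
      (((pd i (fun y => S y c a) x : ℝ) : ℂ) * Y x c * Z x a +
        (S x c a : ℂ) * pd i (fun y => Y y c) x * Z x a +
        (S x c a : ℂ) * Y x c * pd i (fun y => Z y a) x) := fun i => by
    simp only [complexBilin]
    rw [pd_sum (f := fun c y => ∑ a, (S y c a : ℂ) * Y y c * Z y a) (fun c _ =>
      DifferentiableAt.fun_sum fun a _ => ((h3 c a).mul (h1 c)).mul (h2 a))]
    refine Finset.sum_congr rfl fun c _ => ?_
    rw [pd_sum (f := fun a y => (S y c a : ℂ) * Y y c * Z y a) (fun a _ =>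
      ((h3 c a).mul (h1 c)).mul (h2 a))]
    refine Finset.sum_congr rfl fun a _ => ?_
    rw [pd_mul ((h3 c a).fun_mul (h1 c)) (h2 a), pd_mul (h3 c a) (h1 c), pd_ofReal (hS c a)]
    ring
  simp only [dirDeriv, h4, covTensor, covDeriv₂, covD_eq_sum]
  simp only [complexBilin, covCoord, Finset.sum_apply, Pi.smul_apply, smul_eq_mul,
    Fin.sum_univ_three]
  push_cast
  ring

theorem LocalMetric.dirDeriv_metric (hG : LocalMetric Ω G) (hx : x ∈ Ω) {Y Z : E3 → Fin 3 → ℂ}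
    (hY : DifferentiableAt ℝ Y x) (hZ : DifferentiableAt ℝ Z x) (v : Fin 3 → ℂ) :
    dirDeriv v (fun y => complexBilin (G y) (Y y) (Z y)) x =
      complexBilin (G x) (covD G v Y x) (Z x) + complexBilin (G x) (Y x) (covD G v Z x) := by
  rw [dirDeriv_complexBilin (G := G)
    (fun i j => (hG.smooth i j).differentiableAt_of_isOpen hG.isOpen hx) hY hZ]
  have : covTensor G G x v (Y x) (Z x) = 0 := by
    simp [covTensor, hG.covDeriv₂_metric hx]
  rw [this, zero_add]

/-- The Riemann tensor as a trilinear map, `R(u, v) w`. -/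
def curv (G : E3 → Matrix (Fin 3) (Fin 3) ℝ) (x : E3) (u v w : Fin 3 → ℂ) : Fin 3 → ℂ :=
  fun c => ∑ a, ∑ b, ∑ d, (riemann G a b d c x : ℂ) * u a * v b * w d

/-- Second derivatives of `Z` cancel by symmetry and first derivatives cancel in pairs. No bracket
term appears, as coordinate fields commute. -/
theorem LocalMetric.covCoord_comm (hG : LocalMetric Ω G) (hx : x ∈ Ω) {Z : E3 → Fin 3 → ℂ}
    (hZ : ContDiffOn ℝ ∞ Z Ω) (i j c : Fin 3) :
    covCoord G i (covCoord G j Z) x c - covCoord G j (covCoord G i Z) x c =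
      ∑ d, (riemann G i j d c x : ℂ) * Z x d := by
  have hZ' := contDiffOn_pi.mp hZ
  have hd : ∀ d, DifferentiableAt ℝ (fun y => Z y d) x := fun d =>
    (hZ' d).differentiableAt_of_isOpen hG.isOpen hx
  have hΓ : ∀ a b d, DifferentiableAt ℝ (christoffel G a b d) x := fun a b d =>
    (hG.contDiffOn_christoffel a b d).differentiableAt_of_isOpen hG.isOpen hx
  have hΓ' : ∀ a b d, DifferentiableAt ℝ (fun y => (christoffel G a b d y : ℂ)) x := fun a b d =>
    Complex.ofRealCLM.differentiableAt.comp x (hΓ a b d)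
  have h1 : ∀ i j, pd i (fun y => covCoord G j Z y c) x = pd i (pd j fun y => Z y c) x +
      ∑ d, (((pd i (christoffel G c j d) x : ℝ) : ℂ) * Z x d +
        (christoffel G c j d x : ℂ) * pd i (fun y => Z y d) x) := fun i j => by
    simp only [covCoord]
    rw [pd_add (f := pd j fun y => Z y c)
      (((hZ' c).pd hG.isOpen j).differentiableAt_of_isOpen hG.isOpen hx)
      (DifferentiableAt.fun_sum fun d _ => (hΓ' c j d).fun_mul (hd d)),
      pd_sum (f := fun d y => (christoffel G c j d y : ℂ) * Z y d)
        (fun d _ => (hΓ' c j d).mul (hd d))]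
    congr 1
    refine Finset.sum_congr rfl fun d _ => ?_
    rw [pd_mul (hΓ' c j d) (hd d), pd_ofReal (hΓ c j d)]
  have h2 := pd_comm (hZ' c) hG.isOpen hx i j
  rw [covCoord, covCoord, h1, h1, h2]
  simp only [covCoord, riemann, Fin.sum_univ_three]
  push_cast
  ring

/-- The Ricci identity. -/
theorem LocalMetric.ricci_identity (hG : LocalMetric Ω G) (hx : x ∈ Ω) {X Y Z : E3 → Fin 3 → ℂ}
    (hX : ContDiffOn ℝ ∞ X Ω) (hY : ContDiffOn ℝ ∞ Y Ω) (hZ : ContDiffOn ℝ ∞ Z Ω) :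
    curv G x (X x) (Y x) (Z x) = covD G (X x) (fun y => covD G (Y y) Z y) x -
      covD G (Y x) (fun y => covD G (X y) Z y) x -
      covD G (covD G (X x) Y x - covD G (Y x) X x) Z x := by
  have hd : ∀ {V : E3 → Fin 3 → ℂ}, ContDiffOn ℝ ∞ V Ω → ∀ j, DifferentiableAt ℝ (fun y => V y j) x :=
    fun hV j => ((contDiffOn_pi.mp hV) j).differentiableAt_of_isOpen hG.isOpen hx
  have hc : ∀ j, DifferentiableAt ℝ (covCoord G j Z) x := fun j =>
    (hG.contDiffOn_covCoord hZ j).differentiableAt_of_isOpen hG.isOpen hx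
  have h1 : ∀ {V : E3 → Fin 3 → ℂ}, ContDiffOn ℝ ∞ V Ω → ∀ u : Fin 3 → ℂ,
      covD G u (fun y => covD G (V y) Z y) x = ∑ i, u i • ∑ j, (pd i (fun y => V y j) x •
        covCoord G j Z x + V x j • covCoord G i (covCoord G j Z) x) := fun {V} hV u => by
    simp only [covD_eq_sum (G := G) (V _) Z]
    rw [covD_eq_sum]
    refine Finset.sum_congr rfl fun i _ => ?_
    rw [covCoord_sum_smul (f := fun j y => V y j) (hd hV) hc]
  rw [h1 hY, h1 hX]
  -- By symmetry of the Christoffel symbols this difference is the Lie bracket `[X, Y]`.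
  have h2 : ∀ j, (covD G (X x) Y x - covD G (Y x) X x) j =
      ∑ i, (X x i * pd i (fun y => Y y j) x - Y x i * pd i (fun y => X y j) x) := fun j => by
    simp only [covD_eq_sum, covCoord, Pi.sub_apply, Finset.sum_apply, Pi.smul_apply, smul_eq_mul]
    simp only [Fin.sum_univ_three, hG.christoffel_symm hx j 1 0, hG.christoffel_symm hx j 2 0,
      hG.christoffel_symm hx j 2 1]
    ring
  rw [covD_eq_sum (G := G) (_ - _) Z]
  funext c
  have h3 := fun i j => hG.covCoord_comm hx hZ i j c
  simp only [h2, curv, Pi.sub_apply, Finset.sum_apply, Pi.smul_apply, Pi.add_apply, smul_eq_mul]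
  have h4 : (∑ a, ∑ b, ∑ d, (riemann G a b d c x : ℂ) * X x a * Y x b * Z x d) =
      ∑ a, ∑ b, X x a * Y x b * (∑ d, (riemann G a b d c x : ℂ) * Z x d) := by
    refine Finset.sum_congr rfl fun a _ => Finset.sum_congr rfl fun b _ => ?_
    rw [Finset.mul_sum]
    refine Finset.sum_congr rfl fun d _ => ?_
    ring
  rw [h4]
  simp only [← h3, Fin.sum_univ_three]
  ring

end LocalCalculus

/-! ### Symmetries of the curvature and of the Ricci tensor -/

section Curvature

variable {Ω : Set E3} {G : E3 → Matrix (Fin 3) (Fin 3) ℝ} {x : E3}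

/-- The connection is torsion-free. -/
theorem LocalMetric.dirDeriv_comm (hG : LocalMetric Ω G) (hx : x ∈ Ω) {X Y : E3 → Fin 3 → ℂ}
    {f : E3 → ℂ} (hX : ContDiffOn ℝ ∞ X Ω) (hY : ContDiffOn ℝ ∞ Y Ω) (hf : ContDiffOn ℝ ∞ f Ω) :
    dirDeriv (X x) (fun y => dirDeriv (Y y) f y) x -
      dirDeriv (Y x) (fun y => dirDeriv (X y) f y) x =
      dirDeriv (covD G (X x) Y x - covD G (Y x) X x) f x := by
  have hd : ∀ {V : E3 → Fin 3 → ℂ}, ContDiffOn ℝ ∞ V Ω →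
      ∀ j, DifferentiableAt ℝ (fun y => V y j) x :=
    fun hV j => ((contDiffOn_pi.mp hV) j).differentiableAt_of_isOpen hG.isOpen hx
  have hc : ∀ j, DifferentiableAt ℝ (pd j f) x := fun j =>
    (hf.pd hG.isOpen j).differentiableAt_of_isOpen hG.isOpen hx
  have h1 : ∀ {V : E3 → Fin 3 → ℂ}, ContDiffOn ℝ ∞ V Ω → ∀ u : Fin 3 → ℂ,
      dirDeriv u (fun y => dirDeriv (V y) f y) x = ∑ i, u i * ∑ j, (pd i (fun y => V y j) x *
        pd j f x + V x j * pd i (pd j f) x) := fun {V} hV u => by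
    simp only [dirDeriv]
    refine Finset.sum_congr rfl fun i _ => ?_
    rw [pd_sum (f := fun j y => V y j * pd j f y) (fun j _ => (hd hV j).mul (hc j))]
    congr 1
    exact Finset.sum_congr rfl fun j _ => pd_mul (hd hV j) (hc j) i
  have h2 : ∀ j, (covD G (X x) Y x - covD G (Y x) X x) j =
      ∑ i, (X x i * pd i (fun y => Y y j) x - Y x i * pd i (fun y => X y j) x) := fun j => by
    simp only [covD_eq_sum, covCoord, Pi.sub_apply, Finset.sum_apply, Pi.smul_apply, smul_eq_mul]
    simp only [Fin.sum_univ_three, hG.christoffel_symm hx j 1 0, hG.christoffel_symm hx j 2 0,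
      hG.christoffel_symm hx j 2 1]
    ring
  rw [h1 hY, h1 hX, dirDeriv]
  simp only [h2]
  simp only [Fin.sum_univ_three, pd_comm hf hG.isOpen hx 1 0, pd_comm hf hG.isOpen hx 2 0,
    pd_comm hf hG.isOpen hx 2 1]
  ring

theorem LocalMetric.covD_const_comm (hG : LocalMetric Ω G) (hx : x ∈ Ω) (u v : Fin 3 → ℂ) :
    covD G u (fun _ => v) x - covD G v (fun _ => u) x = 0 := by
  funext c
  simp only [covD_eq_sum, covCoord, Pi.sub_apply, Finset.sum_apply, Pi.smul_apply, smul_eq_mul,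
    pd_const]
  simp only [Fin.sum_univ_three, hG.christoffel_symm hx c 1 0, hG.christoffel_symm hx c 2 0,
      hG.christoffel_symm hx c 2 1, Pi.zero_apply]
  ring

/-- The Riemann tensor is antisymmetric in its last two arguments. -/
theorem LocalMetric.curv_antisymm (hG : LocalMetric Ω G) (hx : x ∈ Ω) (u v z w : Fin 3 → ℂ) :
    complexBilin (G x) (curv G x u v z) w + complexBilin (G x) z (curv G x u v w) = 0 := by
  have hc : ∀ u : Fin 3 → ℂ, ContDiffOn ℝ ∞ (fun _ : E3 => u) Ω := fun u => contDiffOn_const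
  have hcd : ∀ u z : Fin 3 → ℂ, ContDiffOn ℝ ∞ (covD G u (fun _ => z)) Ω := fun u z =>
    hG.contDiffOn_covD (hc u) (hc z)
  have hd : ∀ {V : E3 → Fin 3 → ℂ}, ContDiffOn ℝ ∞ V Ω → DifferentiableAt ℝ V x :=
    fun hV => hV.differentiableAt_of_isOpen hG.isOpen hx
  -- Differentiate `g(z, w)` twice, all four fields having constant components. On antisymmetrising
  -- in `u, v` the mixed products cancel, and the left side vanishes because constant fields
  -- commute.
  have h1 : ∀ u v : Fin 3 → ℂ,
      dirDeriv u (fun y => dirDeriv v (fun y => complexBilin (G y) z w) y) x =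
      complexBilin (G x) (covD G u (covD G v fun _ => z) x) w +
      complexBilin (G x) (covD G v (fun _ => z) x) (covD G u (fun _ => w) x) +
      (complexBilin (G x) (covD G u (fun _ => z) x) (covD G v (fun _ => w) x) +
      complexBilin (G x) z (covD G u (covD G v fun _ => w) x)) := fun u v => by
    rw [dirDeriv_congr hG.isOpen (fun y hy => hG.dirDeriv_metric hy
      ((hc z).differentiableAt_of_isOpen hG.isOpen hy)
      ((hc w).differentiableAt_of_isOpen hG.isOpen hy) v) hx, dirDeriv_add,
      hG.dirDeriv_metric hx (hd (hcd v z)) (hd (hc w)),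
      hG.dirDeriv_metric hx (hd (hc z)) (hd (hcd v w))]
    · exact (contDiffOn_complexBilin hG.smooth (hcd v z) (hc w)).differentiableAt_of_isOpen
        hG.isOpen hx
    · exact (contDiffOn_complexBilin hG.smooth (hc z) (hcd v w)).differentiableAt_of_isOpen
        hG.isOpen hx
  have h2 := hG.dirDeriv_comm hx (hc u) (hc v) (contDiffOn_complexBilin hG.smooth (hc z) (hc w))
  have h3 := fun z => hG.ricci_identity hx (hc u) (hc v) (hc z)
  simp only [hG.covD_const_comm hx, h1] at h2 h3
  have h0 : covD G 0 (fun _ : E3 => z) x = 0 ∧ covD G 0 (fun _ : E3 => w) x = 0 := by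
    constructor <;> simp [covD_eq_sum]
  have h00 : dirDeriv 0 (fun y => complexBilin (G y) z w) x = 0 := by simp [dirDeriv]
  rw [h3 z, h3 w, h0.1, h0.2]
  rw [h00] at h2
  simp only [complexBilin_sub_left, complexBilin_sub_right, sub_zero]
  linear_combination h2

theorem curv_antisymm_left (u v w : Fin 3 → ℂ) : curv G x u v w = -curv G x v u w := by
  funext c
  simp only [curv, riemann, Fin.sum_univ_three, Pi.neg_apply]
  push_cast
  ring

theorem curv_self (u w : Fin 3 → ℂ) : curv G x u u w = 0 := by
  have h := curv_antisymm_left (G := G) (x := x) u u w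
  have h2 : (2 : ℂ) • curv G x u u w = 0 := by
    rw [two_smul]; nth_rewrite 2 [h]; simp
  exact (smul_eq_zero.mp h2).resolve_left two_ne_zero

theorem LocalMetric.contDiffOn_riemann (hG : LocalMetric Ω G) (a b d c : Fin 3) :
    ContDiffOn ℝ ∞ (riemann G a b d c) Ω := by
  have h := hG.contDiffOn_christoffel
  exact (((h c b d).pd hG.isOpen a).sub ((h c a d).pd hG.isOpen b)).add (ContDiffOn.sum fun f _ =>
    ((h c a f).mul (h f b d)).sub ((h c b f).mul (h f a d)))

theorem LocalMetric.contDiffOn_ricci (hG : LocalMetric Ω G) (a b : Fin 3) :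
    ContDiffOn ℝ ∞ (ricci G a b) Ω :=
  ContDiffOn.sum fun _ _ => hG.contDiffOn_riemann _ _ _ _

theorem LocalMetric.contDiffOn_scalarCurv (hG : LocalMetric Ω G) :
    ContDiffOn ℝ ∞ (scalarCurv G) Ω :=
  ContDiffOn.sum fun a _ => ContDiffOn.sum fun b _ =>
    (hG.contDiffOn_inv a b).mul (hG.contDiffOn_ricci a b)

theorem LocalMetric.contDiffOn_tracefreeRicci (hG : LocalMetric Ω G) (a b : Fin 3) :
    ContDiffOn ℝ ∞ (tracefreeRicci G a b) Ω :=
  (hG.contDiffOn_ricci a b).sub ((contDiffOn_const.mul hG.contDiffOn_scalarCurv).mul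
    (hG.smooth a b))

/-- The first Bianchi identity. -/
theorem LocalMetric.bianchi (hG : LocalMetric Ω G) (hx : x ∈ Ω) (a b d c : Fin 3) :
    riemann G a b d c x + riemann G b d a c x + riemann G d a b c x = 0 := by
  have h1 : ∀ a b d : Fin 3, pd a (christoffel G c b d) x = pd a (christoffel G c d b) x :=
    fun a b d => pd_congr hG.isOpen (fun y hy => hG.christoffel_symm hy c b d) hx a
  have h2 := hG.christoffel_symm hx
  simp only [riemann, h1 a d b, h1 b d a, h1 d b a, Fin.sum_univ_three]
  rw [h2 0 d b, h2 1 d b, h2 2 d b, h2 0 d a, h2 1 d a, h2 2 d a, h2 0 b a, h2 1 b a, h2 2 b a]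
  ring

theorem LocalMetric.inv_symm (hG : LocalMetric Ω G) (hx : x ∈ Ω) (i j : Fin 3) :
    (G x)⁻¹ i j = (G x)⁻¹ j i := by
  have h : (G x).transpose = G x := by
    ext i j; exact hG.symm x hx j i
  have := Matrix.transpose_nonsing_inv (G x)
  rw [h] at this
  exact congrFun (congrFun this j) i

/-- With lowered indices the last pair is antisymmetric, so its contraction with the symmetric
inverse metric vanishes. In the traced Bianchi identity this is the term that would obstruct the
symmetry of the Ricci tensor. -/
theorem LocalMetric.riemann_trace (hG : LocalMetric Ω G) (hx : x ∈ Ω) (a b : Fin 3) :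
    ∑ c, riemann G a b c c x = 0 := by
  have h1 : ∀ c d, ∑ e, G x c e * riemann G a b d e x + ∑ e, G x d e * riemann G a b c e x = 0 := by
    intro c d
    have h := hG.curv_antisymm hx (Pi.single a 1) (Pi.single b 1) (Pi.single d 1) (Pi.single c 1)
    have hs : ∀ d, curv G x (Pi.single a 1) (Pi.single b 1) (Pi.single d 1) =
        fun e => (riemann G a b d e x : ℂ) := fun d => by
      funext e; simp [curv, Pi.single_apply]
    rw [hs, hs] at h
    simp only [complexBilin, Pi.single_apply, mul_ite, mul_one, mul_zero, Finset.sum_ite_eq',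
      Finset.mem_univ, if_true, ite_mul, zero_mul] at h
    simp only [Finset.sum_ite_irrel, Finset.sum_const_zero, Finset.sum_ite_eq', Finset.mem_univ,
      if_true, hG.symm x hx _ c] at h
    exact_mod_cast h
  have h2 := Matrix.nonsing_inv_mul (G x) (isUnit_iff_ne_zero.mpr (hG.det_ne_zero x hx))
  have h3 : ∀ d e, ∑ c, (G x)⁻¹ d c * G x c e = if d = e then 1 else 0 := fun d e => by
    have := congrFun (congrFun h2 d) e
    simpa [Matrix.mul_apply, Matrix.one_apply] using this
  have h4 : ∑ d, riemann G a b d d x =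
      ∑ c, ∑ d, (G x)⁻¹ d c * ∑ e, G x c e * riemann G a b d e x := by
    calc ∑ d, riemann G a b d d x
        = ∑ d, ∑ e, (∑ c, (G x)⁻¹ d c * G x c e) * riemann G a b d e x := by simp [h3]
      _ = _ := by simp only [Fin.sum_univ_three]; ring
  have h5 : ∑ c, ∑ d, (G x)⁻¹ d c * ∑ e, G x c e * riemann G a b d e x =
      -∑ c, ∑ d, (G x)⁻¹ d c * ∑ e, G x c e * riemann G a b d e x := by
    conv_lhs => rw [Finset.sum_comm]
    rw [← Finset.sum_neg_distrib]
    refine Finset.sum_congr rfl fun c _ => ?_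
    rw [← Finset.sum_neg_distrib]
    refine Finset.sum_congr rfl fun d _ => ?_
    rw [hG.inv_symm hx c d]
    linear_combination (G x)⁻¹ d c * h1 d c
  rw [h4]
  linarith

theorem LocalMetric.ricci_symm (hG : LocalMetric Ω G) (hx : x ∈ Ω) (a b : Fin 3) :
    ricci G a b x = ricci G b a x := by
  have h1 := hG.riemann_trace hx a b
  have h2 : ∑ c, (riemann G a b c c x + riemann G b c a c x + riemann G c a b c x) = 0 :=
    Finset.sum_eq_zero fun c _ => hG.bianchi hx a b c c
  have h3 : ∀ c, riemann G c a b c x = -riemann G a c b c x := fun c => by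
    simp only [riemann, Fin.sum_univ_three]; ring
  rw [Finset.sum_add_distrib, Finset.sum_add_distrib, h1] at h2
  simp only [h3, Finset.sum_neg_distrib] at h2
  simp only [ricci]
  linarith

theorem LocalMetric.tracefreeRicci_symm (hG : LocalMetric Ω G) (hx : x ∈ Ω) (a b : Fin 3) :
    tracefreeRicci G a b x = tracefreeRicci G b a x := by
  rw [tracefreeRicci, tracefreeRicci, hG.ricci_symm hx a b, hG.symm x hx a b]

/-- The matrix of the Ricci tensor. -/
def ricciMatrix (G : E3 → Matrix (Fin 3) (Fin 3) ℝ) (x : E3) : Matrix (Fin 3) (Fin 3) ℝ :=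
  Matrix.of fun i j => ricci G i j x

/-- The matrix of the tracefree Ricci tensor. -/
def phi (G : E3 → Matrix (Fin 3) (Fin 3) ℝ) (x : E3) : Matrix (Fin 3) (Fin 3) ℝ :=
  Matrix.of fun i j => tracefreeRicci G i j x

theorem complexBilin_phi (u v : Fin 3 → ℂ) : complexBilin (phi G x) u v =
    complexBilin (ricciMatrix G x) u v - (1 / 3 * scalarCurv G x : ℝ) * complexBilin (G x) u v := by
  simp only [complexBilin, phi, ricciMatrix, tracefreeRicci, Matrix.of_apply, Fin.sum_univ_three]
  push_cast
  ring

theorem LocalMetric.ricci_frame (hG : LocalMetric Ω G) (hx : x ∈ Ω) {k l n : Fin 3 → ℂ}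
    (h : IsAdaptedFrame (G x) k l n) (u v : Fin 3 → ℂ) :
    complexBilin (ricciMatrix G x) u v = complexBilin (G x) (curv G x u k v) l +
      complexBilin (G x) (curv G x u l v) k - 2 * complexBilin (G x) (curv G x u n v) n := by
  have h1 := h.trace_eq (hG.symm x hx)
    (fun d c => ∑ a, ∑ b, (riemann G a d b c x : ℂ) * u a * v b)
  have h2 : ∀ w : Fin 3 → ℂ, (fun c => ∑ d, (∑ a, ∑ b, (riemann G a d b c x : ℂ) * u a * v b) *
      w d) = curv G x u w v := fun w => by
    funext c
    simp only [curv, Fin.sum_univ_three]; ring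
  simp only [h2] at h1
  rw [← h1]
  simp only [complexBilin, ricciMatrix, ricci, Matrix.of_apply, Fin.sum_univ_three]
  push_cast
  ring

/-- The inverse metric is `k l + l k - 2 n n`, so the vanishing trace of `Φ` reads `2 Φ(k, l) - 2
Φ(n, n) = 0`. -/
theorem LocalMetric.phi_trace (hG : LocalMetric Ω G) (hx : x ∈ Ω) {k l n : Fin 3 → ℂ}
    (h : IsAdaptedFrame (G x) k l n) :
    complexBilin (phi G x) k l = complexBilin (phi G x) n n := by
  have h0 := hG.symm x hx
  have h1 : ∑ a, ∑ b, (G x)⁻¹ a b * tracefreeRicci G a b x = 0 := by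
    have h2 := Matrix.nonsing_inv_mul (G x) (isUnit_iff_ne_zero.mpr (hG.det_ne_zero x hx))
    have h3 := congrArg Matrix.trace h2
    simp only [Matrix.trace, Matrix.diag, Matrix.mul_apply, Matrix.one_apply_eq, Fin.sum_univ_three,
      h0 1 0, h0 2 0, h0 2 1] at h3
    simp only [tracefreeRicci, scalarCurv, Fin.sum_univ_three, h0 1 0, h0 2 0, h0 2 1]
    linear_combination (-(1 / 3) * ((G x)⁻¹ 0 0 * ricci G 0 0 x + (G x)⁻¹ 0 1 * ricci G 0 1 x +
      (G x)⁻¹ 0 2 * ricci G 0 2 x + ((G x)⁻¹ 1 0 * ricci G 1 0 x + (G x)⁻¹ 1 1 * ricci G 1 1 x +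
      (G x)⁻¹ 1 2 * ricci G 1 2 x) + ((G x)⁻¹ 2 0 * ricci G 2 0 x + (G x)⁻¹ 2 1 * ricci G 2 1 x +
      (G x)⁻¹ 2 2 * ricci G 2 2 x))) * h3
  have h4 : ∑ a, ∑ b, (((G x)⁻¹ a b : ℝ) : ℂ) * (tracefreeRicci G a b x : ℂ) = 0 := by
    exact_mod_cast congrArg Complex.ofReal h1
  simp only [h.inv_apply h0] at h4
  have hs := hG.tracefreeRicci_symm hx
  simp only [complexBilin, phi, Matrix.of_apply, Fin.sum_univ_three, hs 1 0, hs 2 0, hs 2 1] at h4 ⊢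
  linear_combination h4 / 2

end Curvature

/-- A smooth adapted null frame on `W`. -/
structure FrameField (W : Set E3) (G : E3 → Matrix (Fin 3) (Fin 3) ℝ) (k l n : E3 → Fin 3 → ℂ) :
    Prop where
  smooth_k : ContDiffOn ℝ ∞ k W
  smooth_l : ContDiffOn ℝ ∞ l W
  smooth_n : ContDiffOn ℝ ∞ n W
  adapted : ∀ x ∈ W, IsAdaptedFrame (G x) (k x) (l x) (n x)

/-- A smooth volume form for a metric on an open subset of `ℝ³`, given by its components. -/
structure LocalVolume (Ω : Set E3) (G : E3 → Matrix (Fin 3) (Fin 3) ℝ)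
    (vol : Fin 3 → Fin 3 → Fin 3 → E3 → ℝ) : Prop where
  smooth : ContDiffOn ℝ ∞ (vol 0 1 2) Ω
  swap_left : ∀ x ∈ Ω, ∀ i j k, vol i j k x = -vol j i k x
  swap_right : ∀ x ∈ Ω, ∀ i j k, vol i j k x = -vol i k j x
  sq : ∀ x ∈ Ω, vol 0 1 2 x ^ 2 = |(G x).det|

/-- The topological massive gravity equations on an open subset of `ℝ³`. -/
structure LocalTMG (Ω : Set E3) (G : E3 → Matrix (Fin 3) (Fin 3) ℝ)
    (vol : Fin 3 → Fin 3 → Fin 3 → E3 → ℝ) (m Λ : ℝ) : Prop where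
  metric : LocalMetric Ω G
  volume : LocalVolume Ω G vol
  mass_ne_zero : m ≠ 0
  eqn : ∀ x ∈ Ω, ∀ a b, tracefreeRicci G a b x = 1 / m * cottonDual G vol a b x
  scalar : ∀ x ∈ Ω, scalarCurv G x = 6 * Λ

/-! ### Smooth adapted frames -/

section Frames

variable {Ω W : Set E3} {G : E3 → Matrix (Fin 3) (Fin 3) ℝ} {x x₀ : E3}
  {k l n : E3 → Fin 3 → ℂ}

theorem LocalTMG.mono {vol : Fin 3 → Fin 3 → Fin 3 → E3 → ℝ} {m Λ : ℝ}
    (h : LocalTMG Ω G vol m Λ) (hW : IsOpen W) (hs : W ⊆ Ω) : LocalTMG W G vol m Λ :=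
  ⟨h.metric.mono hW hs, ⟨h.volume.smooth.mono hs, fun x hx => h.volume.swap_left x (hs hx),
    fun x hx => h.volume.swap_right x (hs hx), fun x hx => h.volume.sq x (hs hx)⟩, h.mass_ne_zero,
    fun x hx => h.eqn x (hs hx), fun x hx => h.scalar x (hs hx)⟩

/-- A nonvanishing smooth complex function has local smooth square roots. -/
theorem exists_smooth_sqrt {f : E3 → ℂ} (hΩ : IsOpen Ω) (hf : ContDiffOn ℝ ∞ f Ω) (hx : x₀ ∈ Ω)
    {c : ℂ} (hc : c ^ 2 = f x₀) (h0 : f x₀ ≠ 0) :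
    ∃ W, IsOpen W ∧ x₀ ∈ W ∧ W ⊆ Ω ∧ ∃ h : E3 → ℂ, ContDiffOn ℝ ∞ h W ∧
      (∀ y ∈ W, h y ^ 2 = f y) ∧ h x₀ = c := by
  -- The quotient is `1` at `x₀`, inside the domain of the principal logarithm. Half of its
  -- logarithm gives a root, and `c` fixes the sign.
  have hcont : ContinuousOn (fun y => f y / f x₀) Ω := (hf.div_const _).continuousOn
  refine ⟨Ω ∩ (fun y => f y / f x₀) ⁻¹' Complex.slitPlane,
    hcont.isOpen_inter_preimage hΩ Complex.isOpen_slitPlane,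
    ⟨hx, by simp [h0]⟩, Set.inter_subset_left,
    fun y => c * Complex.exp (1 / 2 * Complex.log (f y / f x₀)), ?_, ?_, by simp [h0]⟩
  · intro y hy
    have h1 : ContDiffAt ℝ ∞ (fun y => f y / f x₀) y :=
      (hf.div_const _).contDiffAt (hΩ.mem_nhds hy.1)
    have h2 : ContDiffAt ℝ ∞ Complex.log (f y / f x₀) :=
      (Complex.contDiffAt_log (n := ∞) hy.2).restrict_scalars ℝ
    have h3 : ContDiffAt ℝ ∞ (fun y => Complex.log (f y / f x₀)) y :=
      ContDiffAt.comp (g := Complex.log) (f := fun y => f y / f x₀) y h2 h1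
    exact (contDiffAt_const.mul (contDiffAt_const.mul h3).cexp).contDiffWithinAt
  · intro y hy
    have h1 : f y / f x₀ ≠ 0 := Complex.slitPlane_ne_zero hy.2
    have h2 : Complex.exp (1 / 2 * Complex.log (f y / f x₀)) ^ 2 = f y / f x₀ := by
      rw [← Complex.exp_nat_mul]
      push_cast
      rw [← mul_assoc]
      norm_num
      exact Complex.exp_log h1
    rw [mul_pow, h2, hc]
    field_simp

theorem isOpen_ne_zero {f : E3 → ℂ} (hΩ : IsOpen Ω) (hf : ContDiffOn ℝ ∞ f Ω) :
    IsOpen (Ω ∩ {y | f y ≠ 0}) :=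
  hf.continuousOn.isOpen_inter_preimage hΩ isOpen_ne

theorem exists_complexBilin_ne_zero {B : Matrix (Fin 3) (Fin 3) ℝ} (hdet : B.det ≠ 0)
    (hB : ∀ i j, B i j = B j i) {u : Fin 3 → ℂ} (hu : u ≠ 0) : ∃ v, complexBilin B u v ≠ 0 := by
  by_contra! h
  refine hu (eq_of_complexBilin_eq hdet fun w => ?_)
  rw [complexBilin_comm hB, h, complexBilin_zero_right]

/-- A smooth null vector field is locally part of a smooth adapted frame. -/
theorem LocalMetric.exists_frameField (hG : LocalMetric Ω G) (hx : x₀ ∈ Ω)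
    (hk : ContDiffOn ℝ ∞ k Ω) (hk0 : k x₀ ≠ 0) (hnull : ∀ y ∈ Ω, complexBilin (G y) (k y) (k y) = 0) :
    ∃ W, IsOpen W ∧ x₀ ∈ W ∧ W ⊆ Ω ∧ ∃ l n, FrameField W G k l n := by
  obtain ⟨v, hv⟩ := exists_complexBilin_ne_zero (hG.det_ne_zero x₀ hx) (hG.symm x₀ hx) hk0
  have hcv : ∀ v : Fin 3 → ℂ, ContDiffOn ℝ ∞ (fun _ : E3 => v) Ω := fun v => contDiffOn_const
  have s1 := contDiffOn_complexBilin hG.smooth hk (hcv v)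
  set W₁ := Ω ∩ {y | complexBilin (G y) (k y) v ≠ 0} with hW₁
  have hW₁o : IsOpen W₁ := isOpen_ne_zero hG.isOpen s1
  have hsub : W₁ ⊆ Ω := Set.inter_subset_left
  set c : E3 → ℂ := fun y => (complexBilin (G y) (k y) v)⁻¹ with hc
  have sc : ContDiffOn ℝ ∞ c W₁ := (s1.mono hsub).inv fun y hy => hy.2
  -- Scale `v` so that its product with `k` is `1`, then subtract the multiple of the null vector
  -- `k` that makes the result null.
  set l : E3 → Fin 3 → ℂ := fun y => c y • v -
    (1 / 2 * c y ^ 2 * complexBilin (G y) v v) • k y with hl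
  have sl : ContDiffOn ℝ ∞ l W₁ := (sc.smul (hcv v |>.mono hsub)).sub
    (((contDiffOn_const.mul (sc.pow 2)).mul
      ((contDiffOn_complexBilin hG.smooth (hcv v) (hcv v)).mono hsub)).smul (hk.mono hsub))
  have hcm : ∀ y ∈ W₁, c y * complexBilin (G y) (k y) v = 1 := fun y hy => inv_mul_cancel₀ hy.2
  have hkl : ∀ y ∈ W₁, complexBilin (G y) (k y) (l y) = 1 := fun y hy => by
    rw [hl]
    simp only [complexBilin_sub_right, complexBilin_smul_right, hnull y hy.1, hcm y hy]
    ring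
  have hll : ∀ y ∈ W₁, complexBilin (G y) (l y) (l y) = 0 := fun y hy => by
    rw [hl]
    simp only [complexBilin_sub_right, complexBilin_smul_right, complexBilin_sub_left,
      complexBilin_smul_left, hnull y hy.1, complexBilin_comm (hG.symm y hy.1) v (k y)]
    linear_combination (-c y ^ 2 * complexBilin (G y) v v) * hcm y hy
  have hG₁ := hG.mono hW₁o hsub
  have hx₁ : x₀ ∈ W₁ := ⟨hx, hv⟩
  -- This is the square of the part of `w` orthogonal to `k` and `l`. If it vanished for all `w`,
  -- polarisation would put every vector in the span of `k` and `l`, against dimension three.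
  obtain ⟨w, hw⟩ : ∃ w, complexBilin (G x₀) w w -
      2 * complexBilin (G x₀) w (l x₀) * complexBilin (G x₀) w (k x₀) ≠ 0 := by
    by_contra! hq
    have hpol : ∀ u w, complexBilin (G x₀) u w - complexBilin (G x₀) u (l x₀) *
        complexBilin (G x₀) w (k x₀) - complexBilin (G x₀) w (l x₀) *
        complexBilin (G x₀) u (k x₀) = 0 := fun u w => by
      have h1 := hq (u + w)
      simp only [complexBilin_add_left, complexBilin_add_right,
        complexBilin_comm (hG.symm x₀ hx) w u] at h1
      linear_combination (h1 - hq u - hq w) / 2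
    have hmem : ∀ w, w ∈ Submodule.span ℂ ({k x₀, l x₀} : Set (Fin 3 → ℂ)) := fun w => by
      have : w = complexBilin (G x₀) w (l x₀) • k x₀ + complexBilin (G x₀) w (k x₀) • l x₀ := by
        refine eq_of_complexBilin_eq (hG.det_ne_zero x₀ hx) fun u => ?_
        rw [complexBilin_add_right, complexBilin_smul_right, complexBilin_smul_right]
        linear_combination hpol u w
      rw [Submodule.mem_span_pair]
      exact ⟨_, _, this.symm⟩
    have h2 : Submodule.span ℂ ({k x₀, l x₀} : Set (Fin 3 → ℂ)) = ⊤ :=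
      (Submodule.eq_top_iff').mpr hmem
    have h3 := finrank_span_le_card (R := ℂ) ({k x₀, l x₀} : Set (Fin 3 → ℂ))
    rw [h2, finrank_top, Module.finrank_fin_fun] at h3
    have h4 := (Set.toFinset_card ({k x₀, l x₀} : Set (Fin 3 → ℂ))).symm ▸ h3
    have h5 : Fintype.card ({k x₀, l x₀} : Set (Fin 3 → ℂ)) ≤ 2 := by
      rw [← Nat.card_eq_fintype_card]
      exact (Set.ncard_insert_le _ _).trans (by simp)
    omega
  set p : E3 → Fin 3 → ℂ := fun y => w - complexBilin (G y) w (l y) • k y -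
    complexBilin (G y) w (k y) • l y with hp
  have hcw := (hcv w).mono hsub
  have hk₁ := hk.mono hsub
  have sp : ContDiffOn ℝ ∞ p W₁ :=
    (hcw.sub ((contDiffOn_complexBilin hG₁.smooth hcw sl).smul hk₁)).sub
      ((contDiffOn_complexBilin hG₁.smooth hcw hk₁).smul sl)
  have hkp : ∀ y ∈ W₁, complexBilin (G y) (k y) (p y) = 0 := fun y hy => by
    rw [hp]
    simp only [complexBilin_sub_right, complexBilin_smul_right, hnull y hy.1, hkl y hy,
      complexBilin_comm (hG.symm y hy.1) w (k y)]
    ring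
  have hlp : ∀ y ∈ W₁, complexBilin (G y) (l y) (p y) = 0 := fun y hy => by
    simp only [hp, complexBilin_sub_right, complexBilin_smul_right, hll y hy,
      complexBilin_comm (hG.symm y hy.1) (l y) (k y), hkl y hy,
      complexBilin_comm (hG.symm y hy.1) w (l y)]
    ring
  have hwp : ∀ y ∈ W₁, complexBilin (G y) (p y) (p y) = complexBilin (G y) w w -
      2 * complexBilin (G y) w (l y) * complexBilin (G y) w (k y) := fun y hy => by
    conv_lhs => enter [2]; rw [hp]
    simp only [complexBilin_sub_left, complexBilin_smul_left, hkp y hy, hlp y hy]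
    simp only [hp, complexBilin_sub_right, complexBilin_smul_right]
    ring
  -- Dividing `p` by a square root of `-2 g(p, p)` gives a vector of square `-1/2`.
  obtain ⟨c₁, hc₁⟩ := IsAlgClosed.exists_pow_nat_eq
    (-2 * complexBilin (G x₀) (p x₀) (p x₀)) two_pos
  obtain ⟨W₂, hW₂, hx₂, hs₂, h, sh, hsq, -⟩ := exists_smooth_sqrt (c := c₁)
    (f := fun y => -2 * complexBilin (G y) (p y) (p y)) hW₁o
    (contDiffOn_const.mul (contDiffOn_complexBilin hG₁.smooth sp sp)) hx₁ hc₁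
    (by rw [hwp x₀ hx₁]; exact mul_ne_zero (by norm_num) hw)
  have hW₃ : IsOpen (W₂ ∩ {y | h y ≠ 0}) := isOpen_ne_zero hW₂ sh
  have hh0 : h x₀ ≠ 0 := fun h0 => by
    have := hsq x₀ hx₂
    rw [h0, hwp x₀ hx₁] at this
    refine mul_ne_zero (by norm_num : (-2 : ℂ) ≠ 0) hw ?_
    rw [← this]; ring
  have hs₃ : W₂ ∩ {y | h y ≠ 0} ⊆ W₁ := Set.inter_subset_left.trans hs₂
  refine ⟨_, hW₃, ⟨hx₂, hh0⟩, hs₃.trans hsub, l, fun y => (h y)⁻¹ • p y, hk₁.mono hs₃,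
    sl.mono hs₃, ((sh.mono Set.inter_subset_left).inv fun y hy => hy.2).smul (sp.mono hs₃),
    fun y hy => ⟨hnull y (hsub (hs₃ hy)), hll y (hs₃ hy), hkl y (hs₃ hy), ?_, ?_, ?_⟩⟩
  · rw [complexBilin_smul_right, hkp y (hs₃ hy), mul_zero]
  · rw [complexBilin_smul_right, hlp y (hs₃ hy), mul_zero]
  · rw [complexBilin_smul_right, complexBilin_smul_left]
    have h1 := hsq y hy.1
    have h2 : h y ≠ 0 := hy.2
    field_simp
    linear_combination h1

/-- Two fields that are null and non-orthogonal at a point span a smooth null field near it. -/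
theorem LocalMetric.exists_null_combination (hG : LocalMetric Ω G) (hx : x₀ ∈ Ω)
    {u w : E3 → Fin 3 → ℂ} (hu : ContDiffOn ℝ ∞ u Ω) (hw : ContDiffOn ℝ ∞ w Ω)
    (huu : complexBilin (G x₀) (u x₀) (u x₀) = 0) (huw : complexBilin (G x₀) (u x₀) (w x₀) ≠ 0) :
    ∃ W, IsOpen W ∧ x₀ ∈ W ∧ W ⊆ Ω ∧ ∃ a : E3 → ℂ, ContDiffOn ℝ ∞ a W ∧ a x₀ = 0 ∧
      ∀ y ∈ W, complexBilin (G y) (u y + a y • w y) (u y + a y • w y) = 0 := by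
  have sA := contDiffOn_complexBilin hG.smooth hu hu
  have sP := contDiffOn_complexBilin hG.smooth hu hw
  have sC := contDiffOn_complexBilin hG.smooth hw hw
  -- The function `a` must solve `A + 2 P a + C a² = 0` with `A = g(u, u)`, `P = g(u, w)`, `C = g(w,
  -- w)`. Writing the small root as `-A / (P + h)`, with `h² = P² - A C` and `h = P` at `x₀`, keeps
  -- the denominator nonzero even where `C` vanishes.
  obtain ⟨W, hW, hxW, hs, h, sh, hsq, hc⟩ := exists_smooth_sqrt
    (c := complexBilin (G x₀) (u x₀) (w x₀)) (f := fun y =>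
    complexBilin (G y) (u y) (w y) ^ 2 - complexBilin (G y) (u y) (u y) *
      complexBilin (G y) (w y) (w y)) hG.isOpen ((sP.pow 2).sub (sA.mul sC)) hx
    (by rw [huu]; ring) (by rw [huu, zero_mul, sub_zero]; exact pow_ne_zero 2 huw)
  have sq : ContDiffOn ℝ ∞ (fun y => complexBilin (G y) (u y) (w y) + h y) W :=
    (sP.mono hs).add sh
  refine ⟨_, isOpen_ne_zero hW sq, ⟨hxW, ?_⟩, Set.inter_subset_left.trans hs,
    fun y => -complexBilin (G y) (u y) (u y) / (complexBilin (G y) (u y) (w y) + h y), ?_, ?_, ?_⟩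
  · simp only [Set.mem_ofPred_eq, hc, ← two_mul]
    exact mul_ne_zero two_ne_zero huw
  · simp only [div_eq_mul_inv]
    exact ((sA.mono (Set.inter_subset_left.trans hs)).neg).mul
      ((sq.mono Set.inter_subset_left).inv fun y hy => hy.2)
  · simp [huu]
  · intro y hy
    have h1 := hsq y hy.1
    have h2 : complexBilin (G y) (u y) (w y) + h y ≠ 0 := hy.2
    simp only [complexBilin_add_left, complexBilin_add_right, complexBilin_smul_left,
      complexBilin_smul_right, complexBilin_comm (hG.symm y (hs hy.1)) (w y) (u y)]
    field_simp
    linear_combination complexBilin (G y) (u y) (u y) * h1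

end Frames

/-! ### Connection, volume form and field equations in a moving frame -/

section FrameEquations

variable {Ω : Set E3} {G : E3 → Matrix (Fin 3) (Fin 3) ℝ} {x : E3}
  {k l n : E3 → Fin 3 → ℂ} {vol : Fin 3 → Fin 3 → Fin 3 → E3 → ℝ} {m Λ : ℝ}

theorem _root_.ContDiffOn.diffAt_vec {Y : E3 → Fin 3 → ℂ} (hY : ContDiffOn ℝ ∞ Y Ω)
    (hΩ : IsOpen Ω) (hx : x ∈ Ω) : DifferentiableAt ℝ Y x :=
  hY.differentiableAt_of_isOpen hΩ hx

/-- The covariant derivatives of fields with constant product. -/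
theorem LocalMetric.covD_add_covD_eq_zero (hG : LocalMetric Ω G) (hx : x ∈ Ω)
    {Y Z : E3 → Fin 3 → ℂ} {c : ℂ} (hY : ContDiffOn ℝ ∞ Y Ω) (hZ : ContDiffOn ℝ ∞ Z Ω)
    (h : ∀ y ∈ Ω, complexBilin (G y) (Y y) (Z y) = c) (v : Fin 3 → ℂ) :
    complexBilin (G x) (covD G v Y x) (Z x) + complexBilin (G x) (Y x) (covD G v Z x) = 0 := by
  rw [← hG.dirDeriv_metric hx (hY.diffAt_vec hG.isOpen hx) (hZ.diffAt_vec hG.isOpen hx)]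
  exact dirDeriv_eq_zero hG.isOpen h hx

/-- The connection in an adapted frame. -/
theorem LocalMetric.covD_frame (hG : LocalMetric Ω G) (hF : FrameField Ω G k l n) (hx : x ∈ Ω)
    (v : Fin 3 → ℂ) {a s s' : ℂ} (ha : complexBilin (G x) (covD G v k x) (l x) = a)
    (hs : complexBilin (G x) (covD G v k x) (n x) = s)
    (hs' : complexBilin (G x) (covD G v l x) (n x) = s') :
    covD G v k x = a • k x - (2 * s) • n x ∧ covD G v l x = (-a) • l x - (2 * s') • n x ∧
      covD G v n x = (-s') • k x - s • l x := by
  have hf := hF.adapted x hx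
  have hsy := hG.symm x hx
  -- The six products of the frame vectors are constant; their derivatives leave three free
  -- connection components in each direction.
  have hkk := hG.covD_add_covD_eq_zero hx hF.smooth_k hF.smooth_k
    (fun y hy => (hF.adapted y hy).kk) v
  have hll := hG.covD_add_covD_eq_zero hx hF.smooth_l hF.smooth_l
    (fun y hy => (hF.adapted y hy).ll) v
  have hnn := hG.covD_add_covD_eq_zero hx hF.smooth_n hF.smooth_n
    (fun y hy => (hF.adapted y hy).nn) v
  have hkl := hG.covD_add_covD_eq_zero hx hF.smooth_k hF.smooth_l
    (fun y hy => (hF.adapted y hy).kl) v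
  have hkn := hG.covD_add_covD_eq_zero hx hF.smooth_k hF.smooth_n
    (fun y hy => (hF.adapted y hy).kn) v
  have hln := hG.covD_add_covD_eq_zero hx hF.smooth_l hF.smooth_n
    (fun y hy => (hF.adapted y hy).ln) v
  rw [complexBilin_comm hsy (k x)] at hkk hkl hkn
  rw [complexBilin_comm hsy (l x)] at hll hln
  rw [complexBilin_comm hsy (n x)] at hnn
  rw [ha] at hkl
  rw [hs] at hkn
  rw [hs'] at hln
  have e1 : complexBilin (G x) (covD G v k x) (k x) = 0 := by linear_combination hkk / 2
  have e2 : complexBilin (G x) (covD G v l x) (l x) = 0 := by linear_combination hll / 2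
  have e3 : complexBilin (G x) (covD G v n x) (n x) = 0 := by linear_combination hnn / 2
  refine ⟨?_, ?_, ?_⟩
  · conv_lhs => rw [hf.expand hsy (covD G v k x), ha, hs, e1]
    simp
  · conv_lhs => rw [hf.expand hsy (covD G v l x), hs', e2, eq_neg_of_add_eq_zero_right hkl]
    simp
  · conv_lhs => rw [hf.expand hsy (covD G v n x), e3, eq_neg_of_add_eq_zero_right hkn,
      eq_neg_of_add_eq_zero_right hln]
    simp [sub_eq_add_neg]

theorem LocalMetric.diffAt_phi (hG : LocalMetric Ω G) (hx : x ∈ Ω) (i j : Fin 3) :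
    DifferentiableAt ℝ (fun y => phi G y i j) x :=
  (hG.contDiffOn_tracefreeRicci i j).differentiableAt_of_isOpen hG.isOpen hx

theorem LocalMetric.phi_symm (hG : LocalMetric Ω G) (hx : x ∈ Ω) (i j : Fin 3) :
    phi G x i j = phi G x j i := hG.tracefreeRicci_symm hx i j

/-- The covariant derivative of the tracefree Ricci tensor. -/
theorem LocalMetric.covTensor_phi (hG : LocalMetric Ω G) (hx : x ∈ Ω) {Y Z : E3 → Fin 3 → ℂ}
    (hY : ContDiffOn ℝ ∞ Y Ω) (hZ : ContDiffOn ℝ ∞ Z Ω) (v : Fin 3 → ℂ) :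
    covTensor G (phi G) x v (Y x) (Z x) =
      dirDeriv v (fun y => complexBilin (phi G y) (Y y) (Z y)) x -
        complexBilin (phi G x) (covD G v Y x) (Z x) -
        complexBilin (phi G x) (Y x) (covD G v Z x) := by
  rw [dirDeriv_complexBilin (G := G) (hG.diffAt_phi hx) (hY.diffAt_vec hG.isOpen hx)
    (hZ.diffAt_vec hG.isOpen hx)]
  ring

theorem LocalMetric.covTensor_phi_comm (hG : LocalMetric Ω G) (hx : x ∈ Ω) (u v w : Fin 3 → ℂ) :
    covTensor G (phi G) x u v w = covTensor G (phi G) x u w v := by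
  have hc : ∀ u : Fin 3 → ℂ, ContDiffOn ℝ ∞ (fun _ : E3 => u) Ω := fun u => contDiffOn_const
  have h1 := hG.covTensor_phi hx (hc v) (hc w) u
  have h2 := hG.covTensor_phi hx (hc w) (hc v) u
  rw [h1, h2, dirDeriv_congr hG.isOpen (fun y hy => complexBilin_comm (hG.phi_symm hy) v w) hx,
    complexBilin_comm (hG.phi_symm hx) _ w, complexBilin_comm (hG.phi_symm hx) v]
  ring

/-- Covariant differentiation commutes with the metric trace, so `∇_v Φ` is again tracefree. -/
theorem LocalMetric.covTensor_phi_trace (hG : LocalMetric Ω G) (hF : FrameField Ω G k l n)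
    (hx : x ∈ Ω) (v : Fin 3 → ℂ) :
    covTensor G (phi G) x v (k x) (l x) = covTensor G (phi G) x v (n x) (n x) := by
  obtain ⟨e1, e2, e3⟩ := hG.covD_frame hF hx v rfl rfl rfl
  have hs := hG.phi_symm hx
  rw [hG.covTensor_phi hx hF.smooth_k hF.smooth_l, hG.covTensor_phi hx hF.smooth_n hF.smooth_n,
    e1, e2, e3, dirDeriv_congr hG.isOpen (fun y hy => hG.phi_trace hy (hF.adapted y hy)) hx]
  simp only [complexBilin_sub_left, complexBilin_sub_right, complexBilin_smul_left,
    complexBilin_smul_right, complexBilin_comm hs (n x) (l x), complexBilin_comm hs (n x) (k x)]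
  ring

/-- The value `e(k, ℓ, n)` of the volume form on a frame. -/
def frameVol (vol : Fin 3 → Fin 3 → Fin 3 → E3 → ℝ) (k l n : E3 → Fin 3 → ℂ) (x : E3) : ℂ :=
  vol 0 1 2 x * (k x 0 * (l x 1 * n x 2 - l x 2 * n x 1) - k x 1 * (l x 0 * n x 2 - l x 2 * n x 0) +
    k x 2 * (l x 0 * n x 1 - l x 1 * n x 0))

theorem LocalVolume.sum_eq (hV : LocalVolume Ω G vol) (hx : x ∈ Ω) (u v w : Fin 3 → ℂ) :
    ∑ a, ∑ b, ∑ c, (vol a b c x : ℂ) * u a * v b * w c =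
      vol 0 1 2 x * (u 0 * (v 1 * w 2 - v 2 * w 1) - u 1 * (v 0 * w 2 - v 2 * w 0) +
        u 2 * (v 0 * w 1 - v 1 * w 0)) := by
  have h1 := hV.swap_left x hx
  have h2 := hV.swap_right x hx
  have d1 : ∀ a b, vol a a b x = 0 := fun a b => by linarith [h1 a a b]
  have d2 : ∀ a b, vol a b b x = 0 := fun a b => by linarith [h2 a b b]
  have d3 : ∀ a b, vol a b a x = 0 := fun a b => by rw [h1, d2, neg_zero]
  have e1 : vol 0 2 1 x = -vol 0 1 2 x := h2 _ _ _
  have e2 : vol 1 0 2 x = -vol 0 1 2 x := h1 _ _ _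
  have e3 : vol 1 2 0 x = vol 0 1 2 x := by rw [h2, e2, neg_neg]
  have e4 : vol 2 0 1 x = vol 0 1 2 x := by rw [h1, e1, neg_neg]
  have e5 : vol 2 1 0 x = -vol 0 1 2 x := by rw [h1, e3]
  simp only [Fin.sum_univ_three, d1, d2, d3, e1, e2, e3, e4, e5]
  push_cast
  ring

/-- Determinants in `mul_eq_one` give `2 d² det g = 1` for the coordinate determinant `d` of the
frame, while `e₀₁₂² = |det g|`. The fourth power removes the sign of `det g`, so all signatures are
treated at once. -/
theorem FrameField.frameVol_pow (hG : LocalMetric Ω G) (hV : LocalVolume Ω G vol)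
    (hF : FrameField Ω G k l n) (hx : x ∈ Ω) : frameVol vol k l n x ^ 4 = 1 / 4 := by
  have h1 := congrArg Matrix.det ((hF.adapted x hx).mul_eq_one (hG.symm x hx))
  rw [Matrix.det_mul, det_map_ofReal, Matrix.det_one] at h1
  have h2 : vol 0 1 2 x ^ 4 = (G x).det ^ 2 := by
    rw [← sq_abs (G x).det, ← hV.sq x hx]; ring
  have h3 : (vol 0 1 2 x : ℂ) ^ 4 = ((G x).det : ℂ) ^ 2 := by exact_mod_cast h2
  rw [frameVol, mul_pow, h3]
  simp only [Matrix.det_fin_three, Matrix.of_apply] at h1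
  set d := (k x 0 * (l x 1 * n x 2 - l x 2 * n x 1) - k x 1 * (l x 0 * n x 2 - l x 2 * n x 0) +
    k x 2 * (l x 0 * n x 1 - l x 1 * n x 0)) with hd
  have h4 : 2 * d ^ 2 * (((G x).det : ℝ) : ℂ) = 1 := by
    rw [← h1, hd, Matrix.det_fin_three]; push_cast; ring
  linear_combination (2 * d ^ 2 * (((G x).det : ℝ) : ℂ) + 1) / 4 * h4

theorem FrameField.frameVol_ne_zero (hG : LocalMetric Ω G) (hV : LocalVolume Ω G vol)
    (hF : FrameField Ω G k l n) (hx : x ∈ Ω) : frameVol vol k l n x ≠ 0 := by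
  intro h
  have := hF.frameVol_pow hG hV hx
  rw [h] at this
  norm_num at this

theorem FrameField.contDiffOn_frameVol (hV : LocalVolume Ω G vol)
    (hF : FrameField Ω G k l n) : ContDiffOn ℝ ∞ (frameVol vol k l n) Ω := by
  have h1 := contDiffOn_pi.mp hF.smooth_k
  have h2 := contDiffOn_pi.mp hF.smooth_l
  have h3 := contDiffOn_pi.mp hF.smooth_n
  have h4 := hV.smooth.ofReal
  unfold frameVol
  fun_prop

/-- The fourth power is a nonzero constant, so differentiating it suffices; parallelism of the
volume form is not needed. -/
theorem FrameField.dirDeriv_frameVol (hG : LocalMetric Ω G) (hV : LocalVolume Ω G vol)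
    (hF : FrameField Ω G k l n) (hx : x ∈ Ω) (v : Fin 3 → ℂ) :
    dirDeriv v (frameVol vol k l n) x = 0 := by
  have hs := hF.contDiffOn_frameVol hV
  have hd := hs.differentiableAt_of_isOpen hG.isOpen hx
  have h1 := dirDeriv_eq_zero (v := v) hG.isOpen (fun y hy => hF.frameVol_pow hG hV hy) hx
  have h2 : dirDeriv v (fun y => frameVol vol k l n y ^ 4) x =
      dirDeriv v (fun y => (frameVol vol k l n y * frameVol vol k l n y) *
        (frameVol vol k l n y * frameVol vol k l n y)) x :=
    dirDeriv_congr isOpen_univ (fun y _ => by ring) (Set.mem_univ x)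
  rw [h2, dirDeriv_mul (hd.fun_mul hd) (hd.fun_mul hd), dirDeriv_mul hd hd] at h1
  have h3 : 4 * frameVol vol k l n x ^ 3 * dirDeriv v (frameVol vol k l n) x = 0 := by
    linear_combination h1
  exact (mul_eq_zero.mp h3).resolve_left
    (mul_ne_zero (by norm_num) (pow_ne_zero 3 (hF.frameVol_ne_zero hG hV hx)))

/-- As `R = 6Λ`, the Schouten tensor is `-Φ - (Λ/2) g`. The metric part is parallel, so only the
antisymmetrised derivative of `-Φ` remains. -/
theorem LocalTMG.cotton_sum (h : LocalTMG Ω G vol m Λ) (hx : x ∈ Ω) (Z X Y : Fin 3 → ℂ) :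
    ∑ a, ∑ b, ∑ c, (cotton G a b c x : ℂ) * Z a * X b * Y c =
      covTensor G (phi G) x Y X Z - covTensor G (phi G) x X Y Z := by
  have hG := h.metric
  have h1 : ∀ b c a, covDeriv₂ G (schouten G) b c a x =
      -covDeriv₂ G (fun i j y => phi G y i j) b c a x := fun b c a => by
    have e1 : ∀ y ∈ Ω, ∀ c a, schouten G c a y = -phi G y c a - Λ / 2 * G y c a :=
      fun y hy c a => by
        rw [schouten, h.scalar y hy, phi, Matrix.of_apply]; ring
    have e2 : pd b (schouten G c a) x =
        -pd b (fun y => phi G y c a) x - Λ / 2 * pd b (fun y => G y c a) x := by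
      have hdG := (hG.smooth c a).differentiableAt_of_isOpen hG.isOpen hx
      rw [pd_congr hG.isOpen (fun y hy => e1 y hy c a) hx b,
        pd_sub (hG.diffAt_phi hx c a).fun_neg (hdG.const_mul _), pd_neg,
        pd_mul (differentiableAt_const _) hdG, pd_const]
      ring
    have e3 := hG.covDeriv₂_metric hx b c a
    simp only [covDeriv₂, e2, e1 x hx, Fin.sum_univ_three] at e3 ⊢
    linear_combination (-Λ / 2) * e3
  simp only [cotton, h1, covTensor, Fin.sum_univ_three]
  push_cast
  ring

theorem sum_mul_inv_frame {B : Matrix (Fin 3) (Fin 3) ℝ} {k l n : Fin 3 → ℂ}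
    (hB : ∀ i j, B i j = B j i) (h : IsAdaptedFrame B k l n) (p q : Fin 3 → ℂ) :
    ∑ i, ∑ j, p i * ((B⁻¹ i j : ℝ) : ℂ) * q j =
      (∑ i, p i * k i) * (∑ j, q j * l j) + (∑ i, p i * l i) * (∑ j, q j * k j) -
        2 * ((∑ i, p i * n i) * (∑ j, q j * n j)) := by
  simp only [h.inv_apply hB, Fin.sum_univ_three]
  ring

/-- Both inverse metrics are replaced by `k l + l k - 2 n n`, which gives three times three terms.
-/
theorem sum_mul_inv_mul_inv_frame {B : Matrix (Fin 3) (Fin 3) ℝ} {k l n : Fin 3 → ℂ}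
    (hB : ∀ i j, B i j = B j i) (h : IsAdaptedFrame B k l n) (w A : Fin 3 → Fin 3 → ℂ)
    {w' A' : (Fin 3 → ℂ) → (Fin 3 → ℂ) → ℂ} (hw : ∀ X Y, w' X Y = ∑ i, ∑ j, w i j * X i * Y j)
    (hA : ∀ X Y, A' X Y = ∑ i, ∑ j, A i j * X i * Y j) :
    ∑ c, ∑ d, ∑ c', ∑ d', w c' d' * ((B⁻¹ c' c : ℝ) : ℂ) * ((B⁻¹ d' d : ℝ) : ℂ) * A c d =
      w' k k * A' l l + w' k l * A' l k - 2 * w' k n * A' l n +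
      w' l k * A' k l + w' l l * A' k k - 2 * w' l n * A' k n -
      2 * w' n k * A' n l - 2 * w' n l * A' n k + 4 * w' n n * A' n n := by
  have e1 : ∑ c, ∑ d, ∑ c', ∑ d', w c' d' * ((B⁻¹ c' c : ℝ) : ℂ) * ((B⁻¹ d' d : ℝ) : ℂ) * A c d =
      ∑ d', ∑ d, (∑ c', ∑ c, w c' d' * ((B⁻¹ c' c : ℝ) : ℂ) * A c d) *
        ((B⁻¹ d' d : ℝ) : ℂ) := by
    simp only [Fin.sum_univ_three]; ring
  have e2 : ∀ p q : Fin 3 → ℂ, ∑ d', ∑ d, p d' * q d * ((B⁻¹ d' d : ℝ) : ℂ) =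
      (∑ i, p i * k i) * (∑ j, q j * l j) + (∑ i, p i * l i) * (∑ j, q j * k j) -
        2 * ((∑ i, p i * n i) * (∑ j, q j * n j)) := fun p q => by
    rw [← sum_mul_inv_frame hB h]
    exact Finset.sum_congr rfl fun _ _ => Finset.sum_congr rfl fun _ _ => by ring
  have e3 : ∀ X Y, w' X Y = ∑ j, (∑ i, w i j * X i) * Y j := fun X Y => by
    rw [hw]; simp only [Fin.sum_univ_three]; ring
  have e4 : ∀ X Y, A' X Y = ∑ j, (∑ i, A i j * X i) * Y j := fun X Y => by
    rw [hA]; simp only [Fin.sum_univ_three]; ring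
  have e5 : ∀ c : ℂ, ∀ p q : Fin 3 → ℂ, ∑ d', ∑ d, c * (p d' * q d) * ((B⁻¹ d' d : ℝ) : ℂ) =
      c * ∑ d', ∑ d, p d' * q d * ((B⁻¹ d' d : ℝ) : ℂ) := fun c p q => by
    simp only [Finset.mul_sum]
    exact Finset.sum_congr rfl fun _ _ => Finset.sum_congr rfl fun _ _ => by ring
  rw [e1]
  simp only [sum_mul_inv_frame hB h, add_mul, sub_mul, Finset.sum_add_distrib,
    Finset.sum_sub_distrib, e2, e5]
  simp only [← e3, ← e4]
  ring

/-- The field equations in an adapted frame. -/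
theorem LocalTMG.phi_frame (h : LocalTMG Ω G vol m Λ) (hF : FrameField Ω G k l n) (hx : x ∈ Ω)
    (Z : Fin 3 → ℂ) :
    (m * complexBilin (phi G x) Z (k x) = 2 * frameVol vol k l n x *
        (covTensor G (phi G) x (k x) (n x) Z - covTensor G (phi G) x (n x) (k x) Z)) ∧
    (m * complexBilin (phi G x) Z (n x) = -frameVol vol k l n x *
        (covTensor G (phi G) x (l x) (k x) Z - covTensor G (phi G) x (k x) (l x) Z)) ∧
    (m * complexBilin (phi G x) Z (l x) = -2 * frameVol vol k l n x *
        (covTensor G (phi G) x (l x) (n x) Z - covTensor G (phi G) x (n x) (l x) Z)) := by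
  have hm : (m : ℂ) ≠ 0 := by exact_mod_cast h.mass_ne_zero
  set A : (Fin 3 → ℂ) → (Fin 3 → ℂ) → ℂ := fun X Y =>
    ∑ a, ∑ b, ∑ c, (cotton G a b c x : ℂ) * Z a * X b * Y c with hA
  have hAe : ∀ X Y, A X Y = covTensor G (phi G) x Y X Z - covTensor G (phi G) x X Y Z :=
    fun X Y => h.cotton_sum hx Z X Y
  set V : (Fin 3 → ℂ) → (Fin 3 → ℂ) → (Fin 3 → ℂ) → ℂ := fun U X Y =>
    ∑ a, ∑ b, ∑ c, (vol a b c x : ℂ) * U a * X b * Y c with hVd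
  have hVe : ∀ u v w, V u v w = vol 0 1 2 x * (u 0 * (v 1 * w 2 - v 2 * w 1) -
      u 1 * (v 0 * w 2 - v 2 * w 0) + u 2 * (v 0 * w 1 - v 1 * w 0)) := h.volume.sum_eq hx
  -- Antisymmetry of the volume form and of the Cotton tensor reduces nine terms to three. For `U`
  -- equal to `k`, `n` or `l`, two of these repeat a vector in the volume form, and one survives.
  have key : ∀ U : Fin 3 → ℂ, m * complexBilin (phi G x) Z U =
      V U (k x) (l x) * A (l x) (k x) - 2 * V U (k x) (n x) * A (l x) (n x)
        - 2 * V U (l x) (n x) * A (k x) (n x) := by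
    intro U
    set w' : Fin 3 → (Fin 3 → ℂ) → (Fin 3 → ℂ) → ℂ := fun b X Y =>
      ∑ i, ∑ j, (vol b i j x : ℂ) * X i * Y j with hw'
    set A' : Fin 3 → (Fin 3 → ℂ) → (Fin 3 → ℂ) → ℂ := fun a X Y =>
      ∑ i, ∑ j, (cotton G a i j x : ℂ) * X i * Y j with hA'
    have e0 : ∀ a b, (m : ℂ) * (phi G x a b : ℂ) = (cottonDual G vol a b x : ℂ) := fun a b => by
      have := h.eqn x hx a b
      rw [phi, Matrix.of_apply, this]
      push_cast
      field_simp
    have e1 : ∀ a b, (cottonDual G vol a b x : ℂ) = 1 / 2 * _ := fun a b => by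
      rw [cottonDual]
      push_cast
      rw [sum_mul_inv_mul_inv_frame (hB := h.metric.symm x hx) (h := hF.adapted x hx)
        (w := fun i j => (vol b i j x : ℂ)) (A := fun i j => (cotton G a i j x : ℂ)) (w' := w' b)
        (A' := A' a) (fun _ _ => rfl) (fun _ _ => rfl)]
    have e2 : m * complexBilin (phi G x) Z U =
        ∑ a, ∑ b, (m : ℂ) * (phi G x a b : ℂ) * Z a * U b := by
      simp only [complexBilin, Finset.mul_sum]
      exact Finset.sum_congr rfl fun _ _ => Finset.sum_congr rfl fun _ _ => by ring
    have e3 : ∀ X Y, V U X Y = ∑ b, U b * w' b X Y := fun X Y => by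
      simp only [hVd, hw', Finset.mul_sum]
      exact Finset.sum_congr rfl fun _ _ => Finset.sum_congr rfl fun _ _ =>
        Finset.sum_congr rfl fun _ _ => by ring
    have e4 : ∀ X Y, A X Y = ∑ a, Z a * A' a X Y := fun X Y => by
      simp only [hA, hA', Finset.mul_sum]
      exact Finset.sum_congr rfl fun _ _ => Finset.sum_congr rfl fun _ _ =>
        Finset.sum_congr rfl fun _ _ => by ring
    have e5 : ∀ X, V U X X = 0 := fun X => by rw [hVe]; ring
    have e6 : ∀ X Y, V U X Y = -V U Y X := fun X Y => by rw [hVe, hVe]; ring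
    have e7 : ∀ X Y, A X Y = -A Y X := fun X Y => by rw [hAe, hAe]; ring
    have e8 : m * complexBilin (phi G x) Z U = 1 / 2 * (
      V U (k x) (k x) * A (l x) (l x) + V U (k x) (l x) * A (l x) (k x) -
      2 * V U (k x) (n x) * A (l x) (n x) +
      V U (l x) (k x) * A (k x) (l x) + V U (l x) (l x) * A (k x) (k x) -
      2 * V U (l x) (n x) * A (k x) (n x) - 2 * V U (n x) (k x) * A (n x) (l x) -
      2 * V U (n x) (l x) * A (n x) (k x) + 4 * V U (n x) (n x) * A (n x) (n x)) := by
      rw [e2]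
      simp only [e0, e1, e3, e4]
      clear_value w' A'
      simp only [Fin.sum_univ_three]
      ring
    rw [e8, e5, e5, e5, e6 (l x) (k x), e7 (k x) (l x), e6 (n x), e6 (n x), e7 (n x) (l x),
      e7 (n x) (k x)]
    ring
  refine ⟨?_, ?_, ?_⟩
  · rw [key, hAe, hAe, hAe, hVe, hVe, hVe, frameVol]; ring
  · rw [key, hAe, hAe, hAe, hVe, hVe, hVe, frameVol]; ring
  · rw [key, hAe, hAe, hAe, hVe, hVe, hVe, frameVol]; ring

end FrameEquations

/-! ### The two Goldberg–Sachs implications in a frame -/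

section GoldbergSachs

variable {Ω : Set E3} {G : E3 → Matrix (Fin 3) (Fin 3) ℝ} {x : E3}
  {k l n : E3 → Fin 3 → ℂ} {vol : Fin 3 → Fin 3 → Fin 3 → E3 → ℝ} {m Λ : ℝ}

/-- If `k` is a multiple principal null direction and `Φ ≠ 0`, then `k` is co-geodetic. -/
theorem LocalTMG.coGeodetic_of_special (h : LocalTMG Ω G vol m Λ) (hF : FrameField Ω G k l n)
    (hx : x ∈ Ω) (h0 : ∀ y ∈ Ω, complexBilin (phi G y) (k y) (k y) = 0)
    (h1 : ∀ y ∈ Ω, complexBilin (phi G y) (k y) (n y) = 0)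
    (h2 : complexBilin (phi G x) (n x) (n x) ≠ 0 ∨
      ((∀ y ∈ Ω, complexBilin (phi G y) (n y) (n y) = 0) ∧
        (complexBilin (phi G x) (n x) (l x) ≠ 0 ∨
          ((∀ y ∈ Ω, complexBilin (phi G y) (n y) (l y) = 0) ∧
            complexBilin (phi G x) (l x) (l x) ≠ 0)))) :
    complexBilin (G x) (covD G (k x) k x) (n x) = 0 ∧
      complexBilin (G x) (covD G (n x) k x) (n x) = 0 := by
  have hG := h.metric
  have hs := hG.phi_symm hx
  have hε := hF.frameVol_ne_zero hG h.volume hx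
  set ε := frameVol vol k l n x with hεd
  set T := covTensor G (phi G) x with hT
  have Tc : ∀ u v w, T u v w = T u w v := hG.covTensor_phi_comm hx
  have Ttr : ∀ v, T v (k x) (l x) = T v (n x) (n x) := hG.covTensor_phi_trace hF hx
  have ptr := hG.phi_trace hx (hF.adapted x hx)
  set σ : (Fin 3 → ℂ) → ℂ := fun v => complexBilin (G x) (covD G v k x) (n x) with hσ
  have E := fun v => hG.covD_frame hF hx v rfl rfl rfl
  set p2 := complexBilin (phi G x) (n x) (n x) with hp2
  set p3 := complexBilin (phi G x) (n x) (l x) with hp3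
  set p4 := complexBilin (phi G x) (l x) (l x) with hp4
  have q1 : complexBilin (phi G x) (n x) (k x) = 0 := by
    rw [complexBilin_comm hs, h1 x hx]
  have q2 : complexBilin (phi G x) (l x) (k x) = p2 := by
    rw [complexBilin_comm hs, ptr]
  have q3 : complexBilin (phi G x) (l x) (n x) = p3 := complexBilin_comm hs _ _
  -- Derivatives of identically vanishing components drop out and leave only connection terms. The
  -- factor `3` in `Tkn` below is `2 Φ(n, n)` from `∇k` plus `Φ(k, l) = Φ(n, n)` from `∇n`.
  have Tkk : ∀ v, T v (k x) (k x) = 0 := fun v => by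
    rw [hT, hG.covTensor_phi hx hF.smooth_k hF.smooth_k, dirDeriv_eq_zero hG.isOpen h0 hx, (E v).1]
    simp only [complexBilin_sub_left, complexBilin_sub_right, complexBilin_smul_left,
      complexBilin_smul_right, h0 x hx, h1 x hx, q1]
    ring
  have Tkn : ∀ v, T v (k x) (n x) = 3 * σ v * p2 := fun v => by
    rw [hT, hG.covTensor_phi hx hF.smooth_k hF.smooth_n, dirDeriv_eq_zero hG.isOpen h1 hx, (E v).1,
      (E v).2.2]
    simp only [complexBilin_sub_left, complexBilin_sub_right, complexBilin_smul_left,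
      complexBilin_smul_right, h0 x hx, h1 x hx, ptr]
    ring
  have F := h.phi_frame hF hx
  simp only [← hT, ← hεd] at F
  have Tkln : ∀ {a b c : ℂ}, a ≠ 0 → a * (b - c) = 0 → b = c := fun ha hb =>
    sub_eq_zero.mp ((mul_eq_zero.mp hb).resolve_left ha)
  have hε2 : 2 * ε ≠ 0 := mul_ne_zero two_ne_zero hε
  have hε3 : -2 * ε ≠ 0 := mul_ne_zero (by norm_num) hε
  have A1 : T (k x) (n x) (k x) = 0 := by
    have := (F (k x)).1
    rw [h0 x hx, mul_zero] at this
    rw [Tkln hε2 this.symm, Tkk]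
  have A2 : T (k x) (k x) (l x) = 0 := by
    have := (F (k x)).2.1
    rw [h1 x hx, mul_zero] at this
    rw [Tc, ← Tkln (neg_ne_zero.mpr hε) this.symm, Tkk]
  -- The field equation exchanges the first two slots; tracefreeness then turns `T(k, n, n)` into
  -- `T(k, k, l)`, which is zero by `A2`.
  have A3 : T (n x) (k x) (n x) = 0 := by
    have := (F (n x)).1
    rw [q1, mul_zero] at this
    rw [← Tkln hε2 this.symm, ← Ttr, A2]
  rw [Tc, Tkn] at A1
  rw [Tkn] at A3
  rcases h2 with h2 | ⟨z2, h2⟩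
  · constructor
    · simpa [h2] using A1
    · simpa [h2] using A3
  -- When `Φ(n, n)` vanishes, the relations above are empty and `Φ(n, l)` takes its place. Vanishing
  -- near `x` is needed, because the derivative of `Φ(k, l)` enters.
  have p2z : p2 = 0 := z2 x hx
  have z2' : ∀ y ∈ Ω, complexBilin (phi G y) (k y) (l y) = 0 := fun y hy => by
    rw [hG.phi_trace hy (hF.adapted y hy), z2 y hy]
  have Tkl : ∀ v, T v (k x) (l x) = 2 * σ v * p3 := fun v => by
    rw [hT, hG.covTensor_phi hx hF.smooth_k hF.smooth_l, dirDeriv_eq_zero hG.isOpen z2' hx, (E v).1,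
      (E v).2.1]
    simp only [complexBilin_sub_left, complexBilin_sub_right, complexBilin_smul_left,
      complexBilin_smul_right, h1 x hx, ptr, p2z, ← hp3]
    ring
  have A4 : T (k x) (n x) (l x) = T (n x) (k x) (l x) := by
    have := (F (l x)).1
    rw [q2, p2z, mul_zero] at this
    exact Tkln hε2 this.symm
  have A5 : T (k x) (l x) (n x) = 0 := by
    have := (F (n x)).2.1
    rw [← hp2, p2z, mul_zero] at this
    rw [← Tkln (neg_ne_zero.mpr hε) this.symm, Tkn, p2z, mul_zero]
  rw [Tkl] at A2 A4
  rw [Tc] at A5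
  rcases h2 with h2 | ⟨z3, h2⟩
  · constructor
    · simpa [h2] using A2
    · simpa [h2] using A4.symm.trans A5
  -- In the last stage only `Φ(l, l)` is left, as the factor of `σ` in `T(v, n, l)`.
  have p3z : p3 = 0 := z3 x hx
  have Tnl : ∀ v, T v (n x) (l x) = σ v * p4 := fun v => by
    rw [hT, hG.covTensor_phi hx hF.smooth_n hF.smooth_l, dirDeriv_eq_zero hG.isOpen z3 hx,
      (E v).2.1, (E v).2.2]
    simp only [complexBilin_sub_left, complexBilin_sub_right, complexBilin_smul_left,
      complexBilin_smul_right, ptr, p2z, p3z, ← hp2, ← hp3, ← hp4]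
    ring
  have A6 : T (n x) (l x) (n x) = 0 := by
    have := (F (n x)).2.2
    rw [← hp3, p3z, mul_zero] at this
    rw [← Tkln hε3 this.symm, ← Ttr, Tkl, p3z, mul_zero]
  rw [Tnl] at A5
  rw [Tc, Tnl] at A6
  exact ⟨by simpa [h2] using A5, by simpa [h2] using A6⟩

/-- A co-geodetic null direction is a multiple principal null direction. -/
theorem LocalTMG.special_of_coGeodetic (h : LocalTMG Ω G vol m Λ) (hF : FrameField Ω G k l n)
    (hκ : ∀ y ∈ Ω, complexBilin (G y) (covD G (k y) k y) (n y) = 0)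
    (hρ : ∀ y ∈ Ω, complexBilin (G y) (covD G (n y) k y) (n y) = 0) (hx : x ∈ Ω) :
    complexBilin (phi G x) (k x) (k x) = 0 ∧ complexBilin (phi G x) (k x) (n x) = 0 := by
  have hG := h.metric
  have sk := hF.smooth_k
  have sl := hF.smooth_l
  have sn := hF.smooth_n
  set α : E3 → ℂ := fun y => complexBilin (G y) (covD G (k y) k y) (l y) with hα
  set γ : E3 → ℂ := fun y => complexBilin (G y) (covD G (n y) k y) (l y) with hγ
  set τ : E3 → ℂ := fun y => complexBilin (G y) (covD G (l y) k y) (n y) with hτ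
  set β : E3 → ℂ := fun y => -complexBilin (G y) (covD G (k y) l y) (n y) with hβ
  have sα : ContDiffOn ℝ ∞ α Ω := contDiffOn_complexBilin hG.smooth (hG.contDiffOn_covD sk sk) sl
  have sγ : ContDiffOn ℝ ∞ γ Ω := contDiffOn_complexBilin hG.smooth (hG.contDiffOn_covD sn sk) sl
  have sτ : ContDiffOn ℝ ∞ τ Ω := contDiffOn_complexBilin hG.smooth (hG.contDiffOn_covD sl sk) sn
  -- With the two co-geodetic components zero, `∇k` along `k` and `n` is proportional to `k`, and
  -- `[k, n] = (β - γ) k`, so `k^⊥` is involutive.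
  have Ek : ∀ y ∈ Ω, covD G (k y) k y = α y • k y := fun y hy => by
    rw [(hG.covD_frame hF hy (k y) rfl (hκ y hy) rfl).1]; simp [hα]
  have Ekn : ∀ y ∈ Ω, covD G (k y) n y = β y • k y := fun y hy => by
    rw [(hG.covD_frame hF hy (k y) rfl (hκ y hy) rfl).2.2]; simp [hβ]
  have Ekl : ∀ y ∈ Ω, covD G (k y) l y = (-α y) • l y - (2 * -β y) • n y := fun y hy => by
    rw [(hG.covD_frame hF hy (k y) rfl (hκ y hy) rfl).2.1]; simp [hβ, hα]
  have En : ∀ y ∈ Ω, covD G (n y) k y = γ y • k y := fun y hy => by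
    rw [(hG.covD_frame hF hy (n y) rfl (hρ y hy) rfl).1]; simp [hγ]
  have Enn : ∀ y ∈ Ω, ∃ s : ℂ, covD G (n y) n y = s • k y := fun y hy =>
    ⟨_, by rw [(hG.covD_frame hF hy (n y) rfl (hρ y hy) rfl).2.2, zero_smul, sub_zero]⟩
  have El : ∀ y ∈ Ω, ∃ a : ℂ, covD G (l y) k y = a • k y - (2 * τ y) • n y := fun y hy =>
    ⟨_, (hG.covD_frame hF hy (l y) rfl rfl rfl).1⟩
  -- The coefficient is the curvature of the connection induced on the line of `k` along `k^⊥`.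
  have curv1 : ∀ y ∈ Ω, curv G y (k y) (n y) (k y) = (dirDeriv (k y) γ y - dirDeriv (n y) α y -
      (β y - γ y) * α y) • k y := fun y hy => by
    rw [hG.ricci_identity hy sk sn sk, covD_congr hG.isOpen En hy, covD_congr hG.isOpen Ek hy,
      covD_smul (sγ.differentiableAt_of_isOpen hG.isOpen hy) (sk.diffAt_vec hG.isOpen hy),
      covD_smul (sα.differentiableAt_of_isOpen hG.isOpen hy) (sk.diffAt_vec hG.isOpen hy),
      Ekn y hy, En y hy, ← sub_smul, covD_smul_left, Ek y hy]
    module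
  have curv2 : ∀ y ∈ Ω, complexBilin (G y) (curv G y (k y) (l y) (k y)) (n y) =
      dirDeriv (k y) τ y := fun y hy => by
    obtain ⟨a, ha⟩ := El y hy
    have hf := hF.adapted y hy
    have hnk := (complexBilin_comm (hG.symm y hy) (n y) (k y)).trans hf.kn
    have sF := hG.contDiffOn_covD sl sk
    have e1 : complexBilin (G y) (covD G (k y) (fun z => covD G (l z) k z) y) (n y) =
        dirDeriv (k y) τ y := by
      have := hG.dirDeriv_metric hy (sF.diffAt_vec hG.isOpen hy) (sn.diffAt_vec hG.isOpen hy) (k y)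
      rw [Ekn y hy, ha] at this
      simp only [complexBilin_sub_left, complexBilin_smul_left, complexBilin_smul_right, hf.kk,
        hnk] at this
      rw [hτ, this]; ring
    rw [hG.ricci_identity hy sk sl sk, covD_congr hG.isOpen Ek hy,
      covD_smul (sα.differentiableAt_of_isOpen hG.isOpen hy) (sk.diffAt_vec hG.isOpen hy),
      Ekl y hy, ha, complexBilin_sub_left, complexBilin_sub_left, e1]
    simp only [covD_sub_left, covD_smul_left, Ek y hy, En y hy, ha, complexBilin_sub_left,
      complexBilin_smul_left, complexBilin_add_left, hf.kn, hf.nn]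
    ring
  have anti : ∀ y ∈ Ω, ∀ u v w, complexBilin (G y) (curv G y u v w) w = 0 := fun y hy u v w => by
    have := hG.curv_antisymm hy u v w w
    rw [complexBilin_comm (hG.symm y hy) w] at this
    linear_combination this / 2
  have phi0 : ∀ y ∈ Ω, complexBilin (phi G y) (k y) (k y) = 0 := fun y hy => by
    have hf := hF.adapted y hy
    rw [complexBilin_phi, hG.ricci_frame hy hf, hf.kk, curv_self, complexBilin_zero_left,
      anti y hy, curv1 y hy, complexBilin_smul_left, hf.kn]
    ring
  -- `Φ(k, n)` is computed twice: here from `R(k, l)`, and in `phi1b`, by symmetry of `Φ`, from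
  -- `R(k, n)`. Both derivative expressions reappear in the final commutator.
  have phi1a : ∀ y ∈ Ω, complexBilin (phi G y) (k y) (n y) = -dirDeriv (k y) τ y := fun y hy => by
    have hf := hF.adapted y hy
    have := hG.curv_antisymm hy (k y) (l y) (k y) (n y)
    rw [curv2 y hy, complexBilin_comm (hG.symm y hy) (k y)] at this
    rw [complexBilin_phi, hG.ricci_frame hy hf, hf.kn, curv_self, complexBilin_zero_left,
      anti y hy]
    linear_combination this
  have phi1b : ∀ y ∈ Ω, complexBilin (phi G y) (k y) (n y) =
      -(dirDeriv (k y) γ y - dirDeriv (n y) α y - (β y - γ y) * α y) := fun y hy => by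
    have hf := hF.adapted y hy
    have hnk := (complexBilin_comm (hG.symm y hy) (n y) (k y)).trans hf.kn
    rw [complexBilin_comm (hG.phi_symm hy), complexBilin_phi, hG.ricci_frame hy hf, hnk, curv_self,
      complexBilin_zero_left, anti y hy, curv_antisymm_left, curv1 y hy, complexBilin_neg_left,
      complexBilin_smul_left, hf.kl]
    ring
  set φ : E3 → ℂ := fun y => complexBilin (phi G y) (k y) (n y) with hφ
  have sφ : ContDiffOn ℝ ∞ φ Ω := contDiffOn_complexBilin hG.contDiffOn_tracefreeRicci sk sn
  set ε := frameVol vol k l n with hε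
  have sε : ContDiffOn ℝ ∞ ε Ω := hF.contDiffOn_frameVol h.volume
  -- This is `m / (2ε)`, written without division by means of `ε⁴ = 1/4`.
  set c : E3 → ℂ := fun y => 2 * m * ε y ^ 3 with hc
  have hcε : ∀ y ∈ Ω, c y * (2 * ε y) = m := fun y hy => by
    have := hF.frameVol_pow hG h.volume hy
    rw [hc]; linear_combination 4 * (m : ℂ) * this
  have sc : ContDiffOn ℝ ∞ c Ω := contDiffOn_const.mul (sε.pow 3)
  have dc : ∀ y ∈ Ω, ∀ v, dirDeriv v c y = 0 := fun y hy v => by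
    have hd := sε.differentiableAt_of_isOpen hG.isOpen hy
    have e1 : dirDeriv v c y = dirDeriv v (fun y => (2 * (m : ℂ)) * (ε y * (ε y * ε y))) y :=
      dirDeriv_congr isOpen_univ (fun y _ => by rw [hc]; ring) (Set.mem_univ y)
    rw [e1, dirDeriv_mul (differentiableAt_const _) (hd.fun_mul (hd.fun_mul hd)), dirDeriv_const,
      dirDeriv_mul hd (hd.fun_mul hd), dirDeriv_mul hd hd,
      hF.dirDeriv_frameVol hG h.volume hy]
    ring
  -- Three components of the field equations, after eliminating `T(k, k, l)`, give both derivatives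
  -- of `φ` along `k^⊥` as multiples of `φ`.
  have D1 : ∀ y ∈ Ω, dirDeriv (k y) φ y = α y * φ y ∧
      dirDeriv (n y) φ y = (γ y + 4 * τ y + c y) * φ y := fun y hy => by
    have hf := hF.adapted y hy
    have hs := hG.phi_symm hy
    obtain ⟨a, ha⟩ := El y hy
    obtain ⟨b, hb⟩ := Enn y hy
    have hε0 : ε y ≠ 0 := hF.frameVol_ne_zero hG h.volume hy
    have hp0 := phi0 y hy
    have hnk := complexBilin_comm hs (n y) (k y)
    set T := covTensor G (phi G) y with hT
    have Tc : ∀ u v w, T u v w = T u w v := hG.covTensor_phi_comm hy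
    have Ttr : ∀ v, T v (k y) (l y) = T v (n y) (n y) := hG.covTensor_phi_trace hF hy
    have t1 : T (n y) (k y) (k y) = 0 := by
      rw [hT, hG.covTensor_phi hy sk sk, dirDeriv_eq_zero hG.isOpen phi0 hy, En y hy]
      simp only [complexBilin_smul_left, complexBilin_smul_right, hp0]; ring
    have t2 : T (k y) (k y) (n y) = dirDeriv (k y) φ y - α y * φ y := by
      rw [hT, hG.covTensor_phi hy sk sn, Ek y hy, Ekn y hy]
      simp only [complexBilin_smul_left, complexBilin_smul_right, hp0, hφ]; ring
    have t3 : T (l y) (k y) (k y) = 4 * τ y * φ y := by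
      rw [hT, hG.covTensor_phi hy sk sk, dirDeriv_eq_zero hG.isOpen phi0 hy, ha]
      simp only [complexBilin_sub_left, complexBilin_sub_right, complexBilin_smul_left,
        complexBilin_smul_right, hp0, hnk, hφ]; ring
    have t4 : T (n y) (k y) (n y) = dirDeriv (n y) φ y - γ y * φ y := by
      rw [hT, hG.covTensor_phi hy sk sn, En y hy, hb]
      simp only [complexBilin_smul_left, complexBilin_smul_right, hp0, hφ]; ring
    have f1 := (h.phi_frame hF hy (k y)).1
    have f2 := (h.phi_frame hF hy (n y)).1
    have f3 := (h.phi_frame hF hy (k y)).2.1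
    rw [← hT, ← hε] at f1 f2 f3
    rw [Tc (k y) (n y) (k y), t1, t2, hp0] at f1
    rw [← Ttr, t4, hnk] at f2
    rw [Tc (k y) (l y) (k y), t3] at f3
    change m * φ y = _ at f2 f3
    constructor
    · have : 2 * ε y * (dirDeriv (k y) φ y - α y * φ y) = 0 := by linear_combination -f1
      have := (mul_eq_zero.mp this).resolve_left (mul_ne_zero two_ne_zero hε0)
      linear_combination this
    · have : 2 * ε y * (dirDeriv (n y) φ y - (γ y + 4 * τ y + c y) * φ y) = 0 := by
        linear_combination f2 - 2 * f3 - φ y * hcε y hy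
      have := (mul_eq_zero.mp this).resolve_left (mul_ne_zero two_ne_zero hε0)
      linear_combination this
  -- The integrability condition `[k, n] φ = (β - γ) k(φ)` of this system. In it `k(γ) - n(α) - (β -
  -- γ) α` contributes `-φ` by `phi1b` and `4 k(τ)` contributes `-4φ` by `phi1a`; both are
  -- multiplied by `φ`, whence `5 φ² = 0`.
  have hcomm := hG.dirDeriv_comm hx sk sn sφ
  have d : ∀ {f : E3 → ℂ}, ContDiffOn ℝ ∞ f Ω → DifferentiableAt ℝ f x := fun hf =>
    hf.differentiableAt_of_isOpen hG.isOpen hx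
  rw [dirDeriv_congr hG.isOpen (fun y hy => (D1 y hy).2) hx,
    dirDeriv_congr hG.isOpen (fun y hy => (D1 y hy).1) hx,
    dirDeriv_mul (((d sγ).fun_add ((d sτ).const_mul 4)).fun_add (d sc)) (d sφ),
    dirDeriv_mul (d sα) (d sφ),
    dirDeriv_add ((d sγ).fun_add ((d sτ).const_mul 4)) (d sc),
    dirDeriv_add (d sγ) ((d sτ).const_mul 4),
    dirDeriv_mul (differentiableAt_const _) (d sτ), dirDeriv_const, dc x hx, (D1 x hx).1,
    (D1 x hx).2, Ekn x hx, En x hx, ← sub_smul, dirDeriv_smul_left, (D1 x hx).1] at hcomm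
  have e1 := phi1a x hx
  have e2 := phi1b x hx
  change φ x = _ at e1 e2
  have : 5 * φ x ^ 2 = 0 := by linear_combination 4 * φ x * e1 + φ x * e2 - hcomm
  exact ⟨phi0 x hx, by simpa using this⟩

end GoldbergSachs

/-! ### Petrov types and the endomorphism obtained from `Φ` -/

section Petrov

/-- Pointwise properties of a metric and a symmetric tracefree tensor. -/
structure IsTracefreePair (B Φ : Matrix (Fin 3) (Fin 3) ℝ) : Prop where
  symm : ∀ i j, B i j = B j i
  det_ne_zero : B.det ≠ 0
  symm' : ∀ i j, Φ i j = Φ j i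
  trace : ∀ k l n, IsAdaptedFrame B k l n → complexBilin Φ k l = complexBilin Φ n n

/-- The endomorphism obtained from `Φ` by raising an index. -/
def sharp (B Φ : Matrix (Fin 3) (Fin 3) ℝ) : Matrix (Fin 3) (Fin 3) ℂ :=
  (B⁻¹ * Φ).map Complex.ofReal

/-- The eigenvalue of an algebraically special tracefree endomorphism along its multiple principal
null direction. -/
def specialEigenvalue (A : Matrix (Fin 3) (Fin 3) ℂ) : ℂ :=
  -(A * (A * A)).trace / (A * A).trace

/-- A rank-one polynomial in the endomorphism `A` for the Petrov types II, III, N, D. -/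
def specialMatrix (A : Matrix (Fin 3) (Fin 3) ℂ) : PetrovType → Matrix (Fin 3) (Fin 3) ℂ
  | .II => (A - specialEigenvalue A • 1) * (A + (2 * specialEigenvalue A) • 1)
  | .III => A * A
  | .N => A
  | .D => A - specialEigenvalue A • 1
  | _ => 0

variable {B Φ : Matrix (Fin 3) (Fin 3) ℝ} {k l n u v w : Fin 3 → ℂ} {τ : PetrovType}

theorem complexBilin_sharp (h : IsTracefreePair B Φ) (v w : Fin 3 → ℂ) :
    complexBilin B ((sharp B Φ).mulVec v) w = complexBilin Φ v w := by
  rw [complexBilin_comm h.symm, complexBilin_comm h.symm' v, complexBilin_eq_dotProduct,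
    complexBilin_eq_dotProduct, Matrix.mulVec_mulVec]
  congr 2
  have h1 : B * (B⁻¹ * Φ) = Φ :=
    Matrix.mul_nonsing_inv_cancel_left B Φ (isUnit_iff_ne_zero.mpr h.det_ne_zero)
  have h2 := congrArg (fun A : Matrix (Fin 3) (Fin 3) ℝ => A.map Complex.ofRealHom) h1
  rw [Matrix.map_mul] at h2
  exact h2

theorem IsAdaptedFrame.sharp_eq (h : IsTracefreePair B Φ) (hf : IsAdaptedFrame B k l n)
    (v : Fin 3 → ℂ) : (sharp B Φ).mulVec v =
      complexBilin Φ v l • k + complexBilin Φ v k • l - (2 * complexBilin Φ v n) • n := by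
  conv_lhs => rw [hf.expand h.symm ((sharp B Φ).mulVec v)]
  simp only [complexBilin_sharp h]

theorem IsAdaptedFrame.trace_matrix (h : IsTracefreePair B Φ) (hf : IsAdaptedFrame B k l n)
    (A : Matrix (Fin 3) (Fin 3) ℂ) : A.trace = complexBilin B (A.mulVec k) l +
      complexBilin B (A.mulVec l) k - 2 * complexBilin B (A.mulVec n) n :=
  hf.trace_eq h.symm (fun d c => A c d)

/-- An adapted frame whose first vector is a multiple principal null direction. -/
structure IsSpecialFrame (B Φ : Matrix (Fin 3) (Fin 3) ℝ) (k l n : Fin 3 → ℂ) : Prop extends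
    IsAdaptedFrame B k l n where
  phi_kk : complexBilin Φ k k = 0
  phi_kn : complexBilin Φ k n = 0

/-- In the order `k, n, l` the endomorphism is upper triangular with diagonal `λ, -2λ, λ`, where `λ
= Φ(n, n)`. This and the next two lemmas are its columns; traces and special matrices are read off
from them. -/
theorem IsSpecialFrame.sharp_k (h : IsTracefreePair B Φ) (hf : IsSpecialFrame B Φ k l n) :
    (sharp B Φ).mulVec k = complexBilin Φ n n • k := by
  rw [hf.toIsAdaptedFrame.sharp_eq h, hf.phi_kk, hf.phi_kn, h.trace k l n hf.toIsAdaptedFrame]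
  simp

theorem IsSpecialFrame.sharp_n (h : IsTracefreePair B Φ) (hf : IsSpecialFrame B Φ k l n) :
    (sharp B Φ).mulVec n = complexBilin Φ n l • k - (2 * complexBilin Φ n n) • n := by
  rw [hf.toIsAdaptedFrame.sharp_eq h, complexBilin_comm h.symm' n k, hf.phi_kn]
  simp

theorem IsSpecialFrame.sharp_l (h : IsTracefreePair B Φ) (hf : IsSpecialFrame B Φ k l n) :
    (sharp B Φ).mulVec l = complexBilin Φ l l • k + complexBilin Φ n n • l -
      (2 * complexBilin Φ n l) • n := by
  rw [hf.toIsAdaptedFrame.sharp_eq h, complexBilin_comm h.symm' l k,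
    h.trace k l n hf.toIsAdaptedFrame, complexBilin_comm h.symm' l n]

theorem IsSpecialFrame.trace_sq (h : IsTracefreePair B Φ) (hf : IsSpecialFrame B Φ k l n) :
    (sharp B Φ * sharp B Φ).trace = 6 * complexBilin Φ n n ^ 2 := by
  have hlk := (complexBilin_comm h.symm l k).trans hf.kl
  have hnk := (complexBilin_comm h.symm n k).trans hf.kn
  rw [hf.toIsAdaptedFrame.trace_matrix h]
  simp only [← Matrix.mulVec_mulVec, hf.sharp_k h, hf.sharp_n h, hf.sharp_l h, Matrix.mulVec_add,
    Matrix.mulVec_sub, Matrix.mulVec_smul, complexBilin_add_left, complexBilin_sub_left,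
    complexBilin_smul_left, hf.kk, hf.nn, hf.kl, hf.kn, hlk, hnk]
  ring

theorem IsSpecialFrame.trace_cube (h : IsTracefreePair B Φ) (hf : IsSpecialFrame B Φ k l n) :
    (sharp B Φ * (sharp B Φ * sharp B Φ)).trace = -6 * complexBilin Φ n n ^ 3 := by
  have hlk := (complexBilin_comm h.symm l k).trans hf.kl
  have hnk := (complexBilin_comm h.symm n k).trans hf.kn
  rw [hf.toIsAdaptedFrame.trace_matrix h]
  simp only [← Matrix.mulVec_mulVec, hf.sharp_k h, hf.sharp_n h, hf.sharp_l h, Matrix.mulVec_add,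
    Matrix.mulVec_sub, Matrix.mulVec_smul, complexBilin_add_left, complexBilin_sub_left,
    complexBilin_smul_left, hf.kk, hf.nn, hf.kl, hf.kn, hlk, hnk]
  ring

theorem IsSpecialFrame.specialEigenvalue_eq (h : IsTracefreePair B Φ)
    (hf : IsSpecialFrame B Φ k l n) : specialEigenvalue (sharp B Φ) = complexBilin Φ n n := by
  rw [specialEigenvalue, hf.trace_sq h, hf.trace_cube h]
  by_cases h0 : complexBilin Φ n n = 0
  -- Both traces vanish here, and `0 / 0 = 0` is the correct eigenvalue.
  · simp [h0]
  · field_simp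

/-- The product kills `k` and `n` and sends `l` to a multiple of `k`. The coefficient times `-2` is
the discriminant of the quadratic left after removing the double root, so it is nonzero exactly when
that quadratic has distinct roots. -/
theorem IsSpecialFrame.specialMatrix_II (h : IsTracefreePair B Φ) (hf : IsSpecialFrame B Φ k l n)
    (v : Fin 3 → ℂ) : (specialMatrix (sharp B Φ) .II).mulVec v =
      ((3 * complexBilin Φ n n * complexBilin Φ l l - 2 * complexBilin Φ n l ^ 2) *
        complexBilin B v k) • k := by
  rw [specialMatrix, hf.specialEigenvalue_eq h, hf.toIsAdaptedFrame.expand h.symm v]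
  simp only [← Matrix.mulVec_mulVec, Matrix.sub_mulVec, Matrix.add_mulVec, Matrix.smul_mulVec,
    Matrix.one_mulVec, hf.sharp_k h, hf.sharp_n h, hf.sharp_l h, Matrix.mulVec_add,
    Matrix.mulVec_sub, Matrix.mulVec_smul]
  simp only [complexBilin_add_left, complexBilin_sub_left, complexBilin_smul_left, hf.kk,
    (complexBilin_comm h.symm l k).trans hf.kl, (complexBilin_comm h.symm n k).trans hf.kn]
  module

/-- With eigenvalue zero the endomorphism is strictly triangular, so its square retains only the
passage from `l` through `n` to `k`. -/
theorem IsSpecialFrame.specialMatrix_III (h : IsTracefreePair B Φ) (hf : IsSpecialFrame B Φ k l n)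
    (h2 : complexBilin Φ n n = 0)
    (v : Fin 3 → ℂ) : (specialMatrix (sharp B Φ) .III).mulVec v =
      (-2 * complexBilin Φ n l ^ 2 * complexBilin B v k) • k := by
  rw [specialMatrix, hf.toIsAdaptedFrame.expand h.symm v]
  simp only [← Matrix.mulVec_mulVec, hf.sharp_k h, hf.sharp_n h, hf.sharp_l h, Matrix.mulVec_add,
    Matrix.mulVec_sub, Matrix.mulVec_smul, h2]
  simp only [complexBilin_add_left, complexBilin_sub_left, complexBilin_smul_left, hf.kk,
    (complexBilin_comm h.symm l k).trans hf.kl, (complexBilin_comm h.symm n k).trans hf.kn]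
  module

theorem IsSpecialFrame.specialMatrix_N (h : IsTracefreePair B Φ) (hf : IsSpecialFrame B Φ k l n)
    (h2 : complexBilin Φ n n = 0) (h3 : complexBilin Φ n l = 0)
    (v : Fin 3 → ℂ) : (specialMatrix (sharp B Φ) .N).mulVec v =
      (complexBilin Φ l l * complexBilin B v k) • k := by
  rw [specialMatrix, hf.toIsAdaptedFrame.expand h.symm v]
  simp only [hf.sharp_k h, hf.sharp_n h, hf.sharp_l h, Matrix.mulVec_add,
    Matrix.mulVec_sub, Matrix.mulVec_smul, h2, h3]
  simp only [complexBilin_add_left, complexBilin_sub_left, complexBilin_smul_left, hf.kk,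
    (complexBilin_comm h.symm l k).trans hf.kl, (complexBilin_comm h.symm n k).trans hf.kn]
  module

/-- The double linear factor of the quartic form gives a special frame, in which the quartic form
is `t²` times the product of the transformed remaining factors. -/
theorem exists_specialFrame (h : IsTracefreePair B Φ) (hf : IsAdaptedFrame B k l n)
    {a b c : ℂ × ℂ} (ha : a ≠ (0, 0))
    (hq : ∀ s t, ricciQuartic Φ k l n s t = linForm a s t ^ 2 * linForm b s t * linForm c s t) :
    ∃ k' l' n', IsSpecialFrame B Φ k' l' n' ∧ ∃ b' c' : ℂ,
      3 * complexBilin Φ n' n' = (a.1 * b.2 - a.2 * b.1) * (a.1 * c.2 - a.2 * c.1) ∧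
      2 * complexBilin Φ n' l' = (a.1 * b.2 - a.2 * b.1) * c' + b' * (a.1 * c.2 - a.2 * c.1) ∧
      1 / 2 * complexBilin Φ l' l' = b' * c' ∧
      (a.1 * b.2 - a.2 * b.1) * c' - b' * (a.1 * c.2 - a.2 * c.1) = b.1 * c.2 - b.2 * c.1 ∧
      (b = a → b' = -1) ∧ (c = a → c' = -1) := by
  have h0 : ((-a.2, a.1) : ℂ × ℂ) ≠ (0, 0) := fun h => ha (by
    have h1 := congrArg Prod.fst h
    have h2 := congrArg Prod.snd h
    simp only [neg_eq_zero] at h1 h2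
    exact Prod.ext h2 h1)
  -- The form `a` vanishes at `(-a₂, a₁)`. In the rotated coordinates it is `-t`, with square `t²`;
  -- this is also why a further factor equal to `a` has `t`-coefficient `-1`.
  obtain ⟨s₁, t₁, l', n', hd, hf', hq'⟩ := exists_frame_of_root (Φ := Φ) h.symm hf h0
  have h1 := quartic_coeff_eq (b₀ := 0) (b₁ := 0)
    (b₂ := (a.1 * b.2 - a.2 * b.1) * (a.1 * c.2 - a.2 * c.1))
    (b₃ := (a.1 * b.2 - a.2 * b.1) * (c.1 * s₁ + c.2 * t₁) +
      (b.1 * s₁ + b.2 * t₁) * (a.1 * c.2 - a.2 * c.1))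
    (b₄ := (b.1 * s₁ + b.2 * t₁) * (c.1 * s₁ + c.2 * t₁))
    (fun s t => (ricciQuartic_eq h.symm' (nullVector k l n (-a.2) a.1) l' n' s t).symm.trans
    ((hq' s t).trans ((hq _ _).trans (by
      simp only [linForm]
      linear_combination (-a.2 * t₁ - a.1 * s₁ + 1) * t ^ 2 *
        (b.1 * (s * -a.2 + t * s₁) + b.2 * (s * a.1 + t * t₁)) *
        (c.1 * (s * -a.2 + t * s₁) + c.2 * (s * a.1 + t * t₁)) * hd))))
  have htr := h.trace _ _ _ hf'
  refine ⟨_, l', n', ⟨hf', by linear_combination 2 * h1.1, by linear_combination (1/2) * h1.2.1⟩,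
    b.1 * s₁ + b.2 * t₁, c.1 * s₁ + c.2 * t₁, ?_, h1.2.2.2.1, h1.2.2.2.2, ?_, ?_, ?_⟩
  · linear_combination h1.2.2.1 - htr
  · linear_combination (b.1 * c.2 - b.2 * c.1) * hd
  · rintro rfl; linear_combination -hd
  · rintro rfl; linear_combination -hd

theorem NotProp.ne_zero {a b : ℂ × ℂ} (h : NotProp a b) : a ≠ (0, 0) := by
  rintro rfl; simp [NotProp] at h

theorem exists_specialFrame_II (h : IsTracefreePair B Φ) (hf : IsAdaptedFrame B k l n)
    (hq : QuarticHasType (ricciQuartic Φ k l n) .II) : ∃ k' l' n', IsSpecialFrame B Φ k' l' n' ∧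
      complexBilin Φ n' n' ≠ 0 ∧
      3 * complexBilin Φ n' n' * complexBilin Φ l' l' - 2 * complexBilin Φ n' l' ^ 2 ≠ 0 := by
  obtain ⟨a, b, c, hab, hac, hbc, hq⟩ := hq
  obtain ⟨k', l', n', hf', b', c', e2, e3, e4, e5, -⟩ := exists_specialFrame h hf hab.ne_zero hq
  refine ⟨k', l', n', hf', fun h0 => ?_, fun h0 => ?_⟩
  · rw [h0, mul_zero] at e2
    exact mul_ne_zero hab hac e2.symm
  -- The squared determinant of two linear forms is the discriminant of their product.
  · have : (b.1 * c.2 - b.2 * c.1) ^ 2 = 0 := by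
      rw [← e5]
      linear_combination (2 * complexBilin Φ n' l' + ((a.1 * b.2 - a.2 * b.1) * c' +
        b' * (a.1 * c.2 - a.2 * c.1))) * -e3 + 4 * b' * c' * e2 +
        12 * complexBilin Φ n' n' * e4 - 2 * h0
    exact hbc (pow_eq_zero_iff two_ne_zero |>.mp this)

theorem exists_specialFrame_D (h : IsTracefreePair B Φ) (hf : IsAdaptedFrame B k l n)
    (hq : QuarticHasType (ricciQuartic Φ k l n) .D) : ∃ k' l' n', IsSpecialFrame B Φ k' l' n' ∧
      complexBilin Φ n' n' ≠ 0 ∧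
      3 * complexBilin Φ n' n' * complexBilin Φ l' l' - 2 * complexBilin Φ n' l' ^ 2 = 0 := by
  obtain ⟨a, b, hab, hq⟩ := hq
  obtain ⟨k', l', n', hf', b', c', e2, e3, e4, e5, -⟩ := exists_specialFrame (b := b) (c := b) h hf
    hab.ne_zero (fun s t => (hq s t).trans (by ring))
  refine ⟨k', l', n', hf', fun h0 => ?_, ?_⟩
  · rw [h0, mul_zero] at e2
    exact mul_ne_zero hab hab e2.symm
  · linear_combination (-1/2) * ((2 * complexBilin Φ n' l' + ((a.1 * b.2 - a.2 * b.1) * c' +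
        b' * (a.1 * b.2 - a.2 * b.1))) * e3 - 4 * b' * c' * e2 -
        12 * complexBilin Φ n' n' * e4 + ((a.1 * b.2 - a.2 * b.1) * c' -
        b' * (a.1 * b.2 - a.2 * b.1)) * e5)

theorem exists_specialFrame_III (h : IsTracefreePair B Φ) (hf : IsAdaptedFrame B k l n)
    (hq : QuarticHasType (ricciQuartic Φ k l n) .III) : ∃ k' l' n', IsSpecialFrame B Φ k' l' n' ∧
      complexBilin Φ n' n' = 0 ∧ complexBilin Φ n' l' ≠ 0 := by
  obtain ⟨a, b, hab, hq⟩ := hq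
  obtain ⟨k', l', n', hf', b', c', e2, e3, e4, e5, e6, e7⟩ := exists_specialFrame (b := a) (c := b) h hf
    hab.ne_zero (fun s t => (hq s t).trans (by ring))
  rw [e6 rfl] at e3
  refine ⟨k', l', n', hf', by linear_combination e2 / 3, fun h0 => hab ?_⟩
  linear_combination e3 - 2 * h0

theorem exists_specialFrame_N (h : IsTracefreePair B Φ) (hf : IsAdaptedFrame B k l n)
    (hq : QuarticHasType (ricciQuartic Φ k l n) .N) : ∃ k' l' n', IsSpecialFrame B Φ k' l' n' ∧
      complexBilin Φ n' n' = 0 ∧ complexBilin Φ n' l' = 0 ∧ complexBilin Φ l' l' ≠ 0 := by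
  obtain ⟨a, ha, hq⟩ := hq
  obtain ⟨k', l', n', hf', b', c', e2, e3, e4, e5, e6, e7⟩ := exists_specialFrame (b := a) (c := a) h hf
    ha (fun s t => (hq s t).trans (by ring))
  rw [e6 rfl, e7 rfl] at e4
  rw [e6 rfl] at e3
  refine ⟨k', l', n', hf', by linear_combination e2 / 3, by linear_combination e3 / 2,
    fun h0 => ?_⟩
  rw [h0] at e4
  norm_num at e4

/-- A special frame has a double root at `[1 : 0]`: one factor vanishes there by the `s⁴`
coefficient and a second by the `s³t` coefficient, so two factors would be proportional. -/
theorem not_isSpecialFrame_of_I (h : IsTracefreePair B Φ)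
    (hq : QuarticHasType (ricciQuartic Φ k l n) .I) : ¬IsSpecialFrame B Φ k l n := by
  rintro hf
  obtain ⟨a, b, c, d, hab, hac, had, hbc, hbd, hcd, hq⟩ := hq
  have h1 := quartic_coeff_eq (b₀ := a.1 * b.1 * c.1 * d.1)
    (b₁ := a.2 * b.1 * c.1 * d.1 + a.1 * b.2 * c.1 * d.1 + a.1 * b.1 * c.2 * d.1 +
      a.1 * b.1 * c.1 * d.2)
    (b₂ := a.2 * b.2 * c.1 * d.1 + a.2 * b.1 * c.2 * d.1 + a.2 * b.1 * c.1 * d.2 +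
      a.1 * b.2 * c.2 * d.1 + a.1 * b.2 * c.1 * d.2 + a.1 * b.1 * c.2 * d.2)
    (b₃ := a.1 * b.2 * c.2 * d.2 + a.2 * b.1 * c.2 * d.2 + a.2 * b.2 * c.1 * d.2 +
      a.2 * b.2 * c.2 * d.1) (b₄ := a.2 * b.2 * c.2 * d.2)
    (fun s t => (ricciQuartic_eq h.symm' k l n s t).symm.trans ((hq s t).trans (by
      simp only [linForm]; ring)))
  have e0 := h1.1
  have e1 := h1.2.1
  rw [hf.phi_kk] at e0
  rw [hf.phi_kn] at e1
  simp only [NotProp] at hab hac had hbc hbd hcd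
  have e0' : a.1 * b.1 * c.1 * d.1 = 0 := by rw [← e0]; ring
  simp only [mul_eq_zero] at e0'
  rcases e0' with ((ha | hb) | hc) | hd <;> simp_all

theorem IsNullEigen.exists_specialFrame (h : IsTracefreePair B Φ) (hk : IsNullEigen B Φ k) :
    ∃ l n, IsSpecialFrame B Φ k l n := by
  obtain ⟨hk0, hkk, μ, hμ⟩ := hk
  -- Completing a null vector to a frame at one point is the smooth statement for a constant metric.
  have hG : LocalMetric Set.univ (fun _ => B) :=
    ⟨isOpen_univ, fun _ _ => contDiffOn_const, fun _ _ => h.symm, fun _ _ => h.det_ne_zero⟩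
  obtain ⟨W, -, hW, -, l, n, hF⟩ := hG.exists_frameField (k := fun _ => k) (Set.mem_univ 0)
    contDiffOn_const hk0 (fun _ _ => hkk)
  have hf := hF.adapted 0 hW
  exact ⟨l 0, n 0, hf, by rw [hμ, hkk, mul_zero], by rw [hμ, hf.kn, mul_zero]⟩

theorem IsSpecialFrame.isNullEigen (h : IsTracefreePair B Φ) (hf : IsSpecialFrame B Φ k l n) :
    IsNullEigen B Φ k :=
  hf.toIsAdaptedFrame.isNullEigen h.symm hf.phi_kk hf.phi_kn

/-- The components of `Φ` in a special frame, according to the Petrov type. -/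
def SpecialComponents (Φ : Matrix (Fin 3) (Fin 3) ℝ) (l n : Fin 3 → ℂ) : PetrovType → Prop
  | .II => complexBilin Φ n n ≠ 0 ∧
      3 * complexBilin Φ n n * complexBilin Φ l l - 2 * complexBilin Φ n l ^ 2 ≠ 0
  | .III => complexBilin Φ n n = 0 ∧ complexBilin Φ n l ≠ 0
  | .N => complexBilin Φ n n = 0 ∧ complexBilin Φ n l = 0 ∧ complexBilin Φ l l ≠ 0
  | .D => complexBilin Φ n n ≠ 0 ∧
      3 * complexBilin Φ n n * complexBilin Φ l l - 2 * complexBilin Φ n l ^ 2 = 0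
  | _ => True

theorem exists_specialFrame_of_type (h : IsTracefreePair B Φ) (hf : IsAdaptedFrame B k l n)
    (hτ : HasPetrovType B Φ τ) (hI : τ ≠ .I) (hO : τ ≠ .O) :
    ∃ k' l' n', IsSpecialFrame B Φ k' l' n' ∧ SpecialComponents Φ l' n' τ := by
  have hq := hτ k l n hf
  cases τ
  · exact absurd rfl hI
  · exact exists_specialFrame_II h hf hq
  · exact exists_specialFrame_III h hf hq
  · exact exists_specialFrame_N h hf hq
  · exact exists_specialFrame_D h hf hq
  · exact absurd rfl hO

/-- The pattern of components does not depend on the special frame. -/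
theorem IsSpecialFrame.specialComponents (h : IsTracefreePair B Φ) (hf : IsSpecialFrame B Φ k l n)
    (hτ : HasPetrovType B Φ τ) (hI : τ ≠ .I) (hO : τ ≠ .O) : SpecialComponents Φ l n τ := by
  obtain ⟨k', l', n', hf', hc⟩ := exists_specialFrame_of_type h hf.toIsAdaptedFrame hτ hI hO
  -- `Φ(n, n)²` is one sixth of the trace of the squared endomorphism, hence independent of the
  -- frame. The special matrices depend on the endomorphism alone, so evaluating them on `l` or `l'`
  -- in both frames transfers the other components.
  have htr : complexBilin Φ n n ^ 2 = complexBilin Φ n' n' ^ 2 := by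
    have := (hf.trace_sq h).symm.trans (hf'.trace_sq h)
    linear_combination this / 6
  have hlk' := (complexBilin_comm h.symm l' k').trans hf'.kl
  have hlk := (complexBilin_comm h.symm l k).trans hf.kl
  have hz : ∀ {c : ℂ} {k : Fin 3 → ℂ}, k ≠ 0 → (c * 1) • k = 0 → c = 0 := fun hk hc => by
    rw [mul_one] at hc; exact (smul_eq_zero.mp hc).resolve_right hk
  have hz' : ∀ {c b : ℂ} {k k' : Fin 3 → ℂ}, k ≠ 0 → (c * 1) • k = (0 * b) • k' → c = 0 :=
    fun hk hc => hz hk (by rw [hc, zero_mul, zero_smul])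
  cases τ
  · exact absurd rfl hI
  · refine ⟨fun h0 => hc.1 ?_, fun h0 => hc.2 ?_⟩
    · rw [h0] at htr
      exact pow_eq_zero_iff two_ne_zero |>.mp (htr.symm.trans (by ring))
    · have e1 := hf'.specialMatrix_II h l'
      rw [hf.specialMatrix_II h, h0, hlk'] at e1
      exact hz' hf'.k_ne_zero e1.symm
  · have h2 : complexBilin Φ n n = 0 := by
      rw [hc.1] at htr
      exact pow_eq_zero_iff two_ne_zero |>.mp (htr.trans (by ring))
    refine ⟨h2, fun h0 => hc.2 ?_⟩
    have e1 := hf'.specialMatrix_III h hc.1 l'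
    rw [hf.specialMatrix_III h h2, h0, hlk'] at e1
    have := hz hf'.k_ne_zero (e1.symm.trans (by simp))
    simpa using this
  · have h2 : complexBilin Φ n n = 0 := by
      rw [hc.1] at htr
      exact pow_eq_zero_iff two_ne_zero |>.mp (htr.trans (by ring))
    have h3 : complexBilin Φ n l = 0 := by
      have e1 := hf.specialMatrix_III h h2 l
      rw [hf'.specialMatrix_III h hc.1, hc.2.1, hlk] at e1
      have := hz hf.k_ne_zero (e1.symm.trans (by simp))
      simpa using this
    refine ⟨h2, h3, fun h0 => hc.2.2 ?_⟩
    have e1 := hf'.specialMatrix_N h hc.1 hc.2.1 l'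
    rw [hf.specialMatrix_N h h2 h3, h0, hlk'] at e1
    exact hz' hf'.k_ne_zero e1.symm
  · refine ⟨fun h0 => hc.1 ?_, ?_⟩
    · rw [h0] at htr
      exact pow_eq_zero_iff two_ne_zero |>.mp (htr.symm.trans (by ring))
    · have e1 := hf.specialMatrix_II h l
      rw [hf'.specialMatrix_II h, hc.2, hlk] at e1
      exact hz' hf.k_ne_zero e1.symm
  · exact absurd rfl hO

/-- In types II, III and N the special matrix has rank one with image the multiple principal null
direction. -/
theorem IsSpecialFrame.exists_specialMatrix_eq (h : IsTracefreePair B Φ)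
    (hf : IsSpecialFrame B Φ k l n) (hτ : HasPetrovType B Φ τ) (hI : τ ≠ .I) (hO : τ ≠ .O)
    (hD : τ ≠ .D) : ∃ μ : ℂ, μ ≠ 0 ∧ ∀ v, (specialMatrix (sharp B Φ) τ).mulVec v =
      (μ * complexBilin B v k) • k := by
  have hc := hf.specialComponents h hτ hI hO
  cases τ
  · exact absurd rfl hI
  · exact ⟨_, hc.2, hf.specialMatrix_II h⟩
  · exact ⟨_, mul_ne_zero (by norm_num) (pow_ne_zero 2 hc.2), hf.specialMatrix_III h hc.1⟩
  · exact ⟨_, hc.2.2, hf.specialMatrix_N h hc.1 hc.2.1⟩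
  · exact absurd rfl hD
  · exact absurd rfl hO

/-- In types II, III and N the multiple principal null direction is unique. -/
theorem IsNullEigen.span_eq (h : IsTracefreePair B Φ) (hu : IsNullEigen B Φ u)
    (hv : IsNullEigen B Φ v) (hτ : HasPetrovType B Φ τ) (hI : τ ≠ .I) (hO : τ ≠ .O)
    (hD : τ ≠ .D) : Submodule.span ℂ {u} = Submodule.span ℂ {v} := by
  obtain ⟨l, n, hf⟩ := hu.exists_specialFrame h
  obtain ⟨l', n', hf'⟩ := hv.exists_specialFrame h
  obtain ⟨μ, hμ, e⟩ := hf.exists_specialMatrix_eq h hτ hI hO hD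
  obtain ⟨μ', hμ', e'⟩ := hf'.exists_specialMatrix_eq h hτ hI hO hD
  -- Both frames describe the same rank-one matrix, whose image is spanned by `u` and by `v`.
  have h1 := (e l).symm.trans (e' l)
  rw [(complexBilin_comm h.symm l u).trans hf.kl, mul_one] at h1
  have h2 : u = (μ⁻¹ * (μ' * complexBilin B l v)) • v := by
    rw [mul_smul, ← h1, smul_smul, inv_mul_cancel₀ hμ, one_smul]
  have h3 : μ⁻¹ * (μ' * complexBilin B l v) ≠ 0 := fun h0 => hf.k_ne_zero (by
    rw [h2, h0, zero_smul])
  rw [h2]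
  exact Submodule.span_singleton_smul_eq (isUnit_iff_ne_zero.mpr h3) v

/-- In type D the special matrix has rank one with image a non-null vector, and the null vectors
orthogonal to it are multiple principal. -/
theorem exists_frame_of_type_D (h : IsTracefreePair B Φ) (hf : IsAdaptedFrame B k l n)
    (hτ : HasPetrovType B Φ .D) : ∃ k' l' n', IsSpecialFrame B Φ k' l' n' ∧
      (sharp B Φ * sharp B Φ).trace ≠ 0 ∧ ∃ μ : ℂ, μ ≠ 0 ∧
      ∀ v, (specialMatrix (sharp B Φ) .D).mulVec v = (μ * complexBilin B v n') • n' := by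
  obtain ⟨k', l', n', hf', h2, h3⟩ := exists_specialFrame_D h hf (hτ k l n hf)
  -- The null rotation about `k'` with this parameter removes `Φ(n, l)` and, since the discriminant
  -- vanishes, also `Φ(l, l)`. The endomorphism becomes diagonal with entries `λ, -2λ, λ`, so
  -- subtracting `λ` leaves image the new `n`.
  set c : ℂ := -complexBilin Φ n' l' / (3 * complexBilin Φ n' n') with hc
  have hr := hf'.toIsAdaptedFrame.rotate h.symm (s₀ := 1) (t₀ := 0) (s₁ := c) (t₁ := 1) (by ring)
  have e1 : nullVector k' l' n' 1 0 = k' := by simp [nullVector]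
  rw [e1] at hr
  have e2 : (1 * c) • k' + (1 * 1 + 0 * c) • n' + ((0 : ℂ) * 1) • l' = c • k' + n' := by
    simp
  rw [e2] at hr
  have hs : IsSpecialFrame B Φ k' (nullVector k' l' n' c 1) (c • k' + n') :=
    ⟨hr, hf'.phi_kk, by
      rw [complexBilin_add_right, complexBilin_smul_right, hf'.phi_kk, hf'.phi_kn]; ring⟩
  refine ⟨k', _, _, hs, ?_, 6 * complexBilin Φ n' n', mul_ne_zero (by norm_num) h2, fun v => ?_⟩
  · rw [hf'.trace_sq h]
    exact mul_ne_zero (by norm_num) (pow_ne_zero 2 h2)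
  · have h4 : complexBilin Φ n' l' = -3 * complexBilin Φ n' n' * c := by
      rw [hc]; field_simp
    have h5 : complexBilin Φ l' l' = 6 * complexBilin Φ n' n' * c ^ 2 := by
      have : 3 * complexBilin Φ n' n' * (complexBilin Φ l' l' - 6 * complexBilin Φ n' n' * c ^ 2) =
          0 := by
        linear_combination h3 + 2 * (complexBilin Φ n' l' - 3 * complexBilin Φ n' n' * c) * h4
      linear_combination (mul_eq_zero.mp this).resolve_left (mul_ne_zero (by norm_num) h2)
    rw [specialMatrix, hf'.specialEigenvalue_eq h, hf'.toIsAdaptedFrame.expand h.symm v]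
    simp only [Matrix.sub_mulVec, Matrix.smul_mulVec, Matrix.one_mulVec, hf'.sharp_k h,
      hf'.sharp_n h, hf'.sharp_l h, Matrix.mulVec_add, Matrix.mulVec_sub, Matrix.mulVec_smul, h4,
      h5, complexBilin_add_left, complexBilin_sub_left, complexBilin_smul_left,
      complexBilin_add_right, complexBilin_smul_right, hf'.kk, hf'.kn, hf'.ln, hf'.nn,
      (complexBilin_comm h.symm l' k').trans hf'.kl, (complexBilin_comm h.symm n' k').trans hf'.kn]
    module

end Petrov

/-! ### Smooth multiple principal directions for constant Petrov type -/

section SmoothRoot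

variable {Ω : Set E3} {G : E3 → Matrix (Fin 3) (Fin 3) ℝ} {x x₀ : E3} {τ : PetrovType}
  {vol : Fin 3 → Fin 3 → Fin 3 → E3 → ℝ} {m Λ : ℝ} {K : E3 → Fin 3 → ℂ}

theorem LocalMetric.isTracefreePair (hG : LocalMetric Ω G) (hx : x ∈ Ω) :
    IsTracefreePair (G x) (phi G x) :=
  ⟨hG.symm x hx, hG.det_ne_zero x hx, hG.phi_symm hx, fun _ _ _ h => hG.phi_trace hx h⟩

theorem LocalMetric.contDiffOn_sharp (hG : LocalMetric Ω G) (i j : Fin 3) :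
    ContDiffOn ℝ ∞ (fun y => sharp (G y) (phi G y) i j) Ω := by
  simp only [sharp, Matrix.map_apply, Matrix.mul_apply]
  exact ContDiffOn.ofReal (ContDiffOn.sum fun a _ =>
    (hG.contDiffOn_inv i a).mul (hG.contDiffOn_tracefreeRicci a j))

theorem contDiffOn_matrix_mul {A A' : E3 → Matrix (Fin 3) (Fin 3) ℂ}
    (hA : ∀ i j, ContDiffOn ℝ ∞ (fun y => A y i j) Ω)
    (hA' : ∀ i j, ContDiffOn ℝ ∞ (fun y => A' y i j) Ω) (i j : Fin 3) :
    ContDiffOn ℝ ∞ (fun y => (A y * A' y) i j) Ω := by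
  simp only [Matrix.mul_apply]
  exact ContDiffOn.sum fun a _ => (hA i a).mul (hA' a j)

theorem contDiffOn_trace {A : E3 → Matrix (Fin 3) (Fin 3) ℂ}
    (hA : ∀ i j, ContDiffOn ℝ ∞ (fun y => A y i j) Ω) :
    ContDiffOn ℝ ∞ (fun y => (A y).trace) Ω :=
  ContDiffOn.sum fun a _ => hA a a

theorem contDiffOn_mulVec {A : E3 → Matrix (Fin 3) (Fin 3) ℂ}
    (hA : ∀ i j, ContDiffOn ℝ ∞ (fun y => A y i j) Ω) (c : Fin 3 → ℂ) :
    ContDiffOn ℝ ∞ (fun y => (A y).mulVec c) Ω := by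
  refine contDiffOn_pi.mpr fun i => ?_
  simp only [Matrix.mulVec, dotProduct]
  exact ContDiffOn.sum fun a _ => (hA i a).mul contDiffOn_const

theorem contDiffOn_smul_one {f : E3 → ℂ} (hf : ContDiffOn ℝ ∞ f Ω) (i j : Fin 3) :
    ContDiffOn ℝ ∞ (fun y => (f y • (1 : Matrix (Fin 3) (Fin 3) ℂ)) i j) Ω := by
  simp only [Matrix.smul_apply, smul_eq_mul]
  exact hf.mul contDiffOn_const

theorem LocalMetric.contDiffOn_specialMatrix (hG : LocalMetric Ω G)
    (h : τ = .II ∨ τ = .D → ∀ y ∈ Ω, (sharp (G y) (phi G y) * sharp (G y) (phi G y)).trace ≠ 0)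
    (i j : Fin 3) : ContDiffOn ℝ ∞ (fun y => specialMatrix (sharp (G y) (phi G y)) τ i j) Ω := by
  have s1 := hG.contDiffOn_sharp
  have s2 := contDiffOn_matrix_mul s1 s1
  have s3 : (τ = .II ∨ τ = .D) →
      ContDiffOn ℝ ∞ (fun y => specialEigenvalue (sharp (G y) (phi G y))) Ω := fun hτ => by
    simp only [specialEigenvalue, div_eq_mul_inv]
    exact (contDiffOn_trace (contDiffOn_matrix_mul s1 s2)).neg.mul
      ((contDiffOn_trace s2).inv (h hτ))
  cases τ
  · exact contDiffOn_const
  · refine contDiffOn_matrix_mul (fun i j => (s1 i j).sub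
      (contDiffOn_smul_one (s3 (Or.inl rfl)) i j)) (fun i j => (s1 i j).add
      (contDiffOn_smul_one (contDiffOn_const.mul (s3 (Or.inl rfl))) i j)) i j
  · exact s2 i j
  · exact s1 i j
  · exact (s1 i j).sub (contDiffOn_smul_one (s3 (Or.inr rfl)) i j)
  · exact contDiffOn_const

theorem isOpen_vec_ne_zero (hΩ : IsOpen Ω) (hK : ContDiffOn ℝ ∞ K Ω) :
    IsOpen (Ω ∩ {y | K y ≠ 0}) :=
  hK.continuousOn.isOpen_inter_preimage hΩ isOpen_ne

/-- A null vector at `x₀` extends to a smooth null field `k + a l`, which is then completed to a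
frame. -/
theorem LocalMetric.exists_frame_near (hG : LocalMetric Ω G) (hx : x₀ ∈ Ω) {k l n : Fin 3 → ℂ}
    (hf : IsAdaptedFrame (G x₀) k l n) : ∃ W, IsOpen W ∧ x₀ ∈ W ∧ W ⊆ Ω ∧ ∃ k' l' n',
      FrameField W G k' l' n' := by
  obtain ⟨W, hW, hxW, hs, a, sa, ha, hn⟩ := hG.exists_null_combination hx (u := fun _ => k)
    (w := fun _ => l) contDiffOn_const contDiffOn_const hf.kk (by rw [hf.kl]; exact one_ne_zero)
  obtain ⟨W', hW', hxW', hs', l', n', hF⟩ := (hG.mono hW hs).exists_frameField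
    (k := fun y => k + a y • l) hxW
    (contDiffOn_const.add (sa.smul contDiffOn_const))
    (by rw [ha, zero_smul, add_zero]; exact hf.k_ne_zero) hn
  exact ⟨W', hW', hxW', hs'.trans hs, _, l', n', hF⟩

/-- If the Petrov type is constant, and neither I nor O, then there is locally a smooth multiple
principal null direction. -/
theorem LocalMetric.exists_smooth_nullEigen (hG : LocalMetric Ω G) (hx : x₀ ∈ Ω)
    (hτ : ∀ y ∈ Ω, HasPetrovType (G y) (phi G y) τ) (hI : τ ≠ .I) (hO : τ ≠ .O)
    {k l n : Fin 3 → ℂ} (hf : IsAdaptedFrame (G x₀) k l n) :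
    ∃ W, IsOpen W ∧ x₀ ∈ W ∧ W ⊆ Ω ∧ ∃ K : E3 → Fin 3 → ℂ, ContDiffOn ℝ ∞ K W ∧
      ∀ y ∈ W, IsNullEigen (G y) (phi G y) (K y) := by
  obtain ⟨W, hW, hxW, hs, k', l', n', hF⟩ := hG.exists_frame_near hx hf
  have hG' := hG.mono hW hs
  have hp : ∀ y ∈ W, IsTracefreePair (G y) (phi G y) := fun y hy => hG'.isTracefreePair hy
  have hsp := fun y (hy : y ∈ W) => exists_specialFrame_of_type (hp y hy) (hF.adapted y hy)
    (hτ y (hs hy)) hI hO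
  have hM := hG'.contDiffOn_specialMatrix (τ := τ) (fun hτ' y hy => by
    obtain ⟨k', l', n', h1, h2⟩ := hsp y hy
    rw [h1.trace_sq (hp y hy)]
    refine mul_ne_zero (by norm_num) (pow_ne_zero 2 ?_)
    rcases hτ' with rfl | rfl
    · exact h2.1
    · exact h2.1)
  by_cases hD : τ = .D
  · subst hD
    have hd := fun y (hy : y ∈ W) => exists_frame_of_type_D (hp y hy) (hF.adapted y hy)
      (hτ y (hs hy))
    obtain ⟨k₀, l₀, n₀, hf₀, -, μ, hμ, hM₀⟩ := hd x₀ hxW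
    -- The rank-one matrix applied to a fixed vector gives a smooth field along the simple
    -- eigendirection, non-null near `x₀`.
    set N : E3 → Fin 3 → ℂ := fun y => (specialMatrix (sharp (G y) (phi G y)) .D).mulVec n₀ with hN
    have sN : ContDiffOn ℝ ∞ N W := contDiffOn_mulVec hM n₀
    have hN₀ : N x₀ = (-μ / 2) • n₀ := by
      rw [hN]; simp only [hM₀, hf₀.nn]; congr 1; ring
    have sNN := contDiffOn_complexBilin hG'.smooth sN sN
    set W₁ := W ∩ {y | complexBilin (G y) (N y) (N y) ≠ 0} with hW₁
    have hW₁o : IsOpen W₁ := isOpen_ne_zero hW sNN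
    have hs₁ : W₁ ⊆ W := Set.inter_subset_left
    have hx₁ : x₀ ∈ W₁ := ⟨hxW, by
      simp only [Set.mem_ofPred_eq, hN₀, complexBilin_smul_left, complexBilin_smul_right, hf₀.nn]
      exact mul_ne_zero (by simpa using hμ) (mul_ne_zero (by simpa using hμ) (by norm_num))⟩
    have hG₁ := hG'.mono hW₁o hs₁
    -- Projection to `N^⊥`, the eigenspace of the double eigenvalue. It fixes `k₀` and `l₀` at `x₀`,
    -- so a null combination of the projected fields is a smooth choice of one of the two null
    -- directions in `N^⊥`.
    set P : (Fin 3 → ℂ) → E3 → Fin 3 → ℂ := fun v y =>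
      v - (complexBilin (G y) v (N y) * (complexBilin (G y) (N y) (N y))⁻¹) • N y with hP
    have sP : ∀ v, ContDiffOn ℝ ∞ (P v) W₁ := fun v =>
      contDiffOn_const.sub (((contDiffOn_complexBilin hG₁.smooth contDiffOn_const
        (sN.mono hs₁)).mul ((sNN.mono hs₁).inv fun y hy => hy.2)).smul (sN.mono hs₁))
    have hPN : ∀ v, ∀ y ∈ W₁, complexBilin (G y) (P v y) (N y) = 0 := fun v y hy => by
      have h2 : complexBilin (G y) (N y) (N y) ≠ 0 := hy.2
      simp only [hP, complexBilin_sub_left, complexBilin_smul_left]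
      field_simp
      ring
    have hPx : ∀ v, complexBilin (G x₀) v n₀ = 0 → P v x₀ = v := fun v hv => by
      simp only [hP, hN₀, complexBilin_smul_right, hv]
      simp
    have hPk := hPx k₀ hf₀.kn
    have hPl := hPx l₀ hf₀.ln
    obtain ⟨W₂, hW₂, hx₂, hs₂, a, sa, ha, hn⟩ := hG₁.exists_null_combination hx₁ (sP k₀) (sP l₀)
      (by rw [hPk, hf₀.kk]) (by rw [hPk, hPl, hf₀.kl]; exact one_ne_zero)
    set K : E3 → Fin 3 → ℂ := fun y => P k₀ y + a y • P l₀ y with hK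
    have sK : ContDiffOn ℝ ∞ K W₂ := ((sP k₀).mono hs₂).add (sa.smul ((sP l₀).mono hs₂))
    refine ⟨W₂ ∩ {y | K y ≠ 0}, isOpen_vec_ne_zero hW₂ sK, ⟨hx₂, ?_⟩,
      Set.inter_subset_left.trans (hs₂.trans (hs₁.trans hs)), K, sK.mono Set.inter_subset_left,
      fun y hy => ⟨hy.2, hn y hy.1, ?_⟩⟩
    · simp only [Set.mem_ofPred_eq, hK, ha, hPk, zero_smul, add_zero]
      exact hf₀.k_ne_zero
    · have hy₁ := hs₂ hy.1
      have hyW := hs₁ hy₁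
      obtain ⟨k₁, l₁, n₁, hf₁, -, μ₁, hμ₁, hM₁⟩ := hd y hyW
      have h1 : complexBilin (G y) (K y) (N y) = 0 := by
        rw [hK]
        simp only [complexBilin_add_left, complexBilin_smul_left, hPN k₀ y hy₁, hPN l₀ y hy₁]
        ring
      have h2 : N y = (μ₁ * complexBilin (G y) n₀ n₁) • n₁ := hM₁ n₀
      have h3 : μ₁ * complexBilin (G y) n₀ n₁ ≠ 0 := fun h0 => hy₁.2 (by
        rw [h2, h0, zero_smul, complexBilin_zero_left])
      have h4 : complexBilin (G y) (K y) n₁ = 0 := by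
        rw [h2, complexBilin_smul_right] at h1
        exact (mul_eq_zero.mp h1).resolve_left h3
      have h5 := hM₁ (K y)
      rw [h4, mul_zero, zero_smul, specialMatrix, Matrix.sub_mulVec, Matrix.smul_mulVec,
        Matrix.one_mulVec, sub_eq_zero] at h5
      exact ⟨_, fun w => by rw [← complexBilin_sharp (hp y hyW), h5, complexBilin_smul_left]⟩
  · obtain ⟨k₀, l₀, n₀, hf₀, -⟩ := hsp x₀ hxW
    -- The image of the rank-one matrix is the principal direction itself, so a fixed vector outside
    -- the kernel at `x₀` yields a smooth generator.
    set K : E3 → Fin 3 → ℂ := fun y => (specialMatrix (sharp (G y) (phi G y)) τ).mulVec l₀ with hK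
    have sK : ContDiffOn ℝ ∞ K W := contDiffOn_mulVec hM l₀
    refine ⟨W ∩ {y | K y ≠ 0}, isOpen_vec_ne_zero hW sK, ⟨hxW, ?_⟩,
      Set.inter_subset_left.trans hs, K, sK.mono Set.inter_subset_left, fun y hy => ?_⟩
    · obtain ⟨μ, hμ, h1⟩ := hf₀.exists_specialMatrix_eq (hp x₀ hxW) (hτ x₀ hx) hI hO hD
      simp only [Set.mem_ofPred_eq, hK, h1, complexBilin_comm (hG'.symm x₀ hxW) l₀ k₀, hf₀.kl,
        mul_one]
      exact smul_ne_zero hμ hf₀.k_ne_zero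
    · obtain ⟨k₁, l₁, n₁, hf₁, -⟩ := hsp y hy.1
      obtain ⟨μ, hμ, h1⟩ := hf₁.exists_specialMatrix_eq (hp y hy.1) (hτ y (hs hy.1)) hI hO hD
      have h2 : K y = (μ * complexBilin (G y) l₀ k₁) • k₁ := h1 l₀
      rw [h2]
      refine (hf₁.isNullEigen (hp y hy.1)).smul fun h0 => hy.2 ?_
      rw [h2, h0, zero_smul]

/-- The null field `K` is co-geodetic on `Ω`. -/
def CoGeodeticOn (Ω : Set E3) (G : E3 → Matrix (Fin 3) (Fin 3) ℝ) (K : E3 → Fin 3 → ℂ) : Prop :=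
  ∀ x ∈ Ω, ∀ u w, complexBilin (G x) u (K x) = 0 → complexBilin (G x) w (K x) = 0 →
    complexBilin (G x) (covD G u K x) w = 0

/-- `k^⊥` is spanned by `k` and `n`, and `∇k` is always orthogonal to `k`, so the two components
with `n` decide. -/
theorem FrameField.coGeodetic_of_frame (hG : LocalMetric Ω G) {k l n : E3 → Fin 3 → ℂ}
    (hF : FrameField Ω G k l n) (hx : x ∈ Ω)
    (hκ : complexBilin (G x) (covD G (k x) k x) (n x) = 0)
    (hρ : complexBilin (G x) (covD G (n x) k x) (n x) = 0) (u w : Fin 3 → ℂ)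
    (hu : complexBilin (G x) u (k x) = 0) (hw : complexBilin (G x) w (k x) = 0) :
    complexBilin (G x) (covD G u k x) w = 0 := by
  have hf := hF.adapted x hx
  rw [hf.expand (hG.symm x hx) u, hf.expand (hG.symm x hx) w, hu, hw, zero_smul, add_zero, add_zero,
    covD_sub_left, covD_smul_left, covD_smul_left,
    (hG.covD_frame hF hx (k x) rfl hκ rfl).1, (hG.covD_frame hF hx (n x) rfl hρ rfl).1]
  simp only [complexBilin_sub_left, complexBilin_sub_right, complexBilin_smul_left,
    complexBilin_smul_right, hf.kk, hf.kn]
  simp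

/-- A smooth multiple principal null direction is co-geodetic, if `Φ` does not vanish. -/
theorem LocalTMG.coGeodeticOn (h : LocalTMG Ω G vol m Λ)
    (hτ : ∀ y ∈ Ω, HasPetrovType (G y) (phi G y) τ) (hI : τ ≠ .I) (hO : τ ≠ .O)
    (sK : ContDiffOn ℝ ∞ K Ω) (hK : ∀ y ∈ Ω, IsNullEigen (G y) (phi G y) (K y)) :
    CoGeodeticOn Ω G K := by
  intro x hx
  obtain ⟨W, hW, hxW, hs, l, n, hF⟩ := h.metric.exists_frameField hx sK (hK x hx).1
    (fun y hy => (hK y hy).2.1)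
  have h' := h.mono hW hs
  have hsp : ∀ y ∈ W, IsSpecialFrame (G y) (phi G y) (K y) (l y) (n y) := fun y hy => by
    obtain ⟨-, h2, μ, h3⟩ := hK y (hs hy)
    exact ⟨hF.adapted y hy, by rw [h3, h2, mul_zero],
      by rw [h3, (hF.adapted y hy).kn, mul_zero]⟩
  -- Constancy of the type makes the vanishing conditions hold on all of `W`, as the
  -- differentiations in `coGeodetic_of_special` require.
  have hc : ∀ y ∈ W, SpecialComponents (phi G y) (l y) (n y) τ := fun y hy =>
    (hsp y hy).specialComponents (h'.metric.isTracefreePair hy) (hτ y (hs hy)) hI hO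
  have key := h'.coGeodetic_of_special hF hxW (fun y hy => (hsp y hy).phi_kk)
    (fun y hy => (hsp y hy).phi_kn) (by
      cases τ
      · exact absurd rfl hI
      · exact Or.inl (hc x hxW).1
      · exact Or.inr ⟨fun y hy => (hc y hy).1, Or.inl (hc x hxW).2⟩
      · exact Or.inr ⟨fun y hy => (hc y hy).1, Or.inr ⟨fun y hy => (hc y hy).2.1,
          (hc x hxW).2.2⟩⟩
      · exact Or.inl (hc x hxW).1
      · exact absurd rfl hO)
  exact hF.coGeodetic_of_frame h'.metric hxW key.1 key.2

/-- A co-geodetic null field is a multiple principal null direction. -/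
theorem LocalTMG.exists_specialFrame (h : LocalTMG Ω G vol m Λ) (sK : ContDiffOn ℝ ∞ K Ω)
    (h0 : ∀ y ∈ Ω, K y ≠ 0) (hn : ∀ y ∈ Ω, complexBilin (G y) (K y) (K y) = 0)
    (hK : CoGeodeticOn Ω G K) (hx : x ∈ Ω) :
    ∃ l n, IsSpecialFrame (G x) (phi G x) (K x) l n := by
  obtain ⟨W, hW, hxW, hs, l, n, hF⟩ := h.metric.exists_frameField hx sK (h0 x hx) hn
  have h' := h.mono hW hs
  have e1 : ∀ y ∈ W, complexBilin (G y) (n y) (K y) = 0 := fun y hy => by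
    rw [complexBilin_comm (h'.metric.symm y hy), (hF.adapted y hy).kn]
  have key := h'.special_of_coGeodetic hF
    (fun y hy => hK y (hs hy) _ _ (hn y (hs hy)) (e1 y hy))
    (fun y hy => hK y (hs hy) _ _ (e1 y hy) (e1 y hy)) hxW
  exact ⟨l x, n x, hF.adapted x hxW, key.1, key.2⟩

end SmoothRoot

/-! ### Local parallel sections of a flat connection -/

section FlatConnection

open Metric Filter Topology

variable {E F : Type*} [NormedAddCommGroup E] [NormedSpace ℝ E] [NormedAddCommGroup F]
  [NormedSpace ℝ F]

/-- Existence for linear ordinary differential equations with small coefficients. -/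
theorem exists_linear_ode_solution [CompleteSpace F] {B : ℝ → F →L[ℝ] F}
    (hB : ContinuousOn B (Set.Icc 0 1)) (hb : ∀ t ∈ Set.Icc (0 : ℝ) 1, ‖B t‖ ≤ 1 / 2) (c : F) :
    ∃ Y : ℝ → F, Y 0 = c ∧ (∀ t ∈ Set.Icc (0 : ℝ) 1, ‖Y t‖ ≤ 2 * ‖c‖) ∧
      ∀ t ∈ Set.Icc (0 : ℝ) 1, HasDerivWithinAt Y (B t (Y t)) (Set.Icc 0 1) t := by
  -- On the ball of radius `‖c‖` about `c` the field has norm at most `½ · 2‖c‖ = ‖c‖`, so the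
  -- solution stays inside for unit time.
  have key : IsPicardLindelof (fun t v => B t v) (⟨0, by simp⟩ : Set.Icc (0 : ℝ) 1) c
      ‖c‖₊ 0 ‖c‖₊ 1 := by
    refine ⟨fun t ht => ?_, fun v _ => hB.clm_apply continuousOn_const, fun t ht v hv => ?_, ?_⟩
    · refine LipschitzOnWith.of_dist_le_mul fun u _ v _ => ?_
      rw [dist_eq_norm, dist_eq_norm, ← map_sub]
      refine (ContinuousLinearMap.le_opNorm _ _).trans ?_
      have := hb t ht
      have := norm_nonneg (u - v)
      rw [NNReal.coe_one]
      nlinarith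
    · have h1 : ‖v‖ ≤ 2 * ‖c‖ := by
        rw [mem_closedBall, dist_eq_norm, coe_nnnorm] at hv
        have := norm_le_norm_add_norm_sub' v c
        linarith
      refine (ContinuousLinearMap.le_opNorm _ _).trans ?_
      have := hb t ht
      have := norm_nonneg v
      rw [coe_nnnorm]
      nlinarith
    · simp
  obtain ⟨Y, h0, hY⟩ := key.exists_eq_forall_mem_Icc_hasDerivWithinAt₀
  refine ⟨Y, h0, fun t ht => ?_, hY⟩
  have h1 := norm_le_gronwallBound_of_norm_deriv_right_le (f := Y) (f' := fun t => B t (Y t))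
    (δ := ‖c‖) (K := 1 / 2) (ε := 0) (a := 0) (b := 1) (fun t ht => (hY t ht).continuousWithinAt)
    (fun t ht => (hY t ⟨ht.1, ht.2.le⟩).mono_of_mem_nhdsWithin
      (Icc_mem_nhdsGE_of_mem ht)) (by rw [h0])
    (fun t ht => by
      rw [add_zero]
      refine (ContinuousLinearMap.le_opNorm _ _).trans ?_
      exact mul_le_mul_of_nonneg_right (hb t ⟨ht.1, ht.2.le⟩) (norm_nonneg _)) t ht
  rw [gronwallBound_of_K_ne_0 (by norm_num)] at h1
  refine h1.trans ?_
  have h2 : Real.exp (1 / 2 * (t - 0)) ≤ 2 := by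
    have h3 : Real.exp (1 / 2 * (t - 0)) ≤ Real.exp (1 / 2) :=
      Real.exp_le_exp.mpr (by linarith [ht.2])
    have h4 : Real.exp (1 / 2) * Real.exp (1 / 2) = Real.exp 1 := by rw [← Real.exp_add]; norm_num
    have := Real.exp_one_lt_d9
    nlinarith [Real.exp_pos (1 / 2)]
  have := norm_nonneg c
  simp only [zero_div, zero_mul, add_zero]
  nlinarith

/-- Gronwall's inequality with zero initial value. The rate `1` is a crude bound for `1/2`, and `e -
1 ≤ 2` gives the constant. -/
theorem norm_le_of_linear_ode {B : ℝ → F →L[ℝ] F} {D r : ℝ → F} {ε : ℝ}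
    (hb : ∀ t ∈ Set.Icc (0 : ℝ) 1, ‖B t‖ ≤ 1 / 2) (h0 : D 0 = 0)
    (hD : ∀ t ∈ Set.Icc (0 : ℝ) 1, HasDerivWithinAt D (B t (D t) + r t) (Set.Icc 0 1) t)
    (hr : ∀ t ∈ Set.Icc (0 : ℝ) 1, ‖r t‖ ≤ ε) :
    ∀ t ∈ Set.Icc (0 : ℝ) 1, ‖D t‖ ≤ 2 * ε := by
  intro t ht
  have hε : 0 ≤ ε := (norm_nonneg _).trans (hr t ht)
  have h1 := norm_le_gronwallBound_of_norm_deriv_right_le (f := D)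
    (f' := fun t => B t (D t) + r t)
    (δ := 0) (K := 1) (ε := ε) (a := 0) (b := 1) (fun t ht => (hD t ht).continuousWithinAt)
    (fun t ht => (hD t ⟨ht.1, ht.2.le⟩).mono_of_mem_nhdsWithin
      (Icc_mem_nhdsGE_of_mem ht)) (by rw [h0, norm_zero])
    (fun t ht => by
      refine (norm_add_le _ _).trans (add_le_add ?_ (hr t ⟨ht.1, ht.2.le⟩))
      refine (ContinuousLinearMap.le_opNorm _ _).trans ?_
      have := hb t ⟨ht.1, ht.2.le⟩
      exact mul_le_mul_of_nonneg_right (by linarith) (norm_nonneg _)) t ht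
  rw [gronwallBound_of_K_ne_0 one_ne_zero] at h1
  refine h1.trans ?_
  have h3 : Real.exp (1 * (t - 0)) ≤ Real.exp 1 := Real.exp_le_exp.mpr (by linarith [ht.2])
  have := Real.exp_one_lt_d9
  simp only [zero_mul, div_one, zero_add]
  nlinarith

set_option maxSynthPendingDepth 3 in
/-- A flat linear connection on a trivial bundle has local parallel sections. -/
theorem exists_parallel_section [CompleteSpace F] {A : E → E →L[ℝ] F →L[ℝ] F} {x₀ : E}
    {Ω : Set E} (hΩ : IsOpen Ω) (hx₀ : x₀ ∈ Ω) (hA : ContDiffOn ℝ 2 A Ω)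
    (hflat : ∀ x ∈ Ω, ∀ u v, fderiv ℝ A x u v + (A x v).comp (A x u) =
      fderiv ℝ A x v u + (A x u).comp (A x v)) :
    ∃ R > 0, ball x₀ R ⊆ Ω ∧ ∀ c : F, ∃ Y : E → F, Y x₀ = c ∧
      ∀ x ∈ ball x₀ R, HasFDerivAt Y ((A x).flip (Y x)) x := by
  have hA' : ContDiffAt ℝ 2 A x₀ := hA.contDiffAt (hΩ.mem_nhds hx₀)
  have hdA : ContDiffAt ℝ 1 (fderiv ℝ A) x₀ := hA'.fderiv_right (by norm_num)
  obtain ⟨L, t, ht, hL⟩ := hdA.exists_lipschitzOnWith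
  have hn1 : ∀ᶠ x in 𝓝 x₀, ‖A x‖ < ‖A x₀‖ + 1 :=
    hA'.continuousAt.norm.eventually_lt continuousAt_const (by linarith)
  have hn2 : ∀ᶠ x in 𝓝 x₀, ‖fderiv ℝ A x‖ < ‖fderiv ℝ A x₀‖ + 1 :=
    hdA.continuousAt.norm.eventually_lt continuousAt_const (by linarith)
  obtain ⟨R₀, hR₀, hball⟩ := Metric.eventually_nhds_iff_ball.mp
    (hn1.and (hn2.and ((show ∀ᶠ x in 𝓝 x₀, x ∈ t from ht).and (hΩ.mem_nhds hx₀))))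
  obtain ⟨M, hM1, hMA, hMd, hML⟩ : ∃ M : ℝ, 1 ≤ M ∧ ‖A x₀‖ + 1 ≤ M ∧ ‖fderiv ℝ A x₀‖ + 1 ≤ M ∧
      (L : ℝ) ≤ M :=
    ⟨‖A x₀‖ + 1 + (‖fderiv ℝ A x₀‖ + 1) + L, by
      have := norm_nonneg (A x₀); have := norm_nonneg (fderiv ℝ A x₀); have := L.2
      refine ⟨?_, ?_, ?_, ?_⟩ <;> simp only [NNReal.val_eq_coe] at * <;> linarith⟩
  -- `M R ≤ 1/2` puts every radial equation in the ball within reach of the two preceding lemmas.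
  obtain ⟨R, hR, hRR, hR1, hRM⟩ : ∃ R > 0, R ≤ R₀ ∧ R ≤ 1 ∧ M * R ≤ 1 / 2 := by
    refine ⟨min R₀ (1 / (2 * M)), lt_min hR₀ (by positivity), min_le_left _ _, ?_, ?_⟩
    · refine (min_le_right _ _).trans ?_
      rw [div_le_one (by positivity)]; linarith
    · refine (mul_le_mul_of_nonneg_left (min_le_right _ _) (by positivity)).trans ?_
      field_simp; rfl
  have hb : ∀ x ∈ ball x₀ R, ‖A x‖ ≤ M ∧ ‖fderiv ℝ A x‖ ≤ M ∧ x ∈ t ∧ x ∈ Ω := fun x hx => by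
    obtain ⟨h1, h2, h3, h4⟩ := hball x (ball_subset_ball hRR hx)
    exact ⟨by linarith, by linarith, h3, h4⟩
  have hdiff : ∀ x ∈ ball x₀ R, HasFDerivAt A (fderiv ℝ A x) x := fun x hx =>
    ((hA.contDiffAt (hΩ.mem_nhds (hb x hx).2.2.2)).differentiableAt (by norm_num)).hasFDerivAt
  have hA1 : ∀ x ∈ ball x₀ R, ∀ y ∈ ball x₀ R, ‖A y - A x‖ ≤ M * ‖y - x‖ := fun x hx y hy =>
    (convex_ball x₀ R).norm_image_sub_le_of_norm_hasFDerivWithin_le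
      (fun z hz => (hdiff z hz).hasFDerivWithinAt) (fun z hz => (hb z hz).2.1) hx hy
  have hA2 : ∀ x ∈ ball x₀ R, ∀ y ∈ ball x₀ R,
      ‖A y - A x - fderiv ℝ A x (y - x)‖ ≤ M * ‖y - x‖ * ‖y - x‖ := fun x hx y hy => by
    refine (convex_segment x y).norm_image_sub_le_of_norm_hasFDerivWithin_le'
      (fun z hz => (hdiff z ((convex_ball x₀ R).segment_subset hx hy hz)).hasFDerivWithinAt)
      (fun z hz => ?_) (left_mem_segment ℝ x y) (right_mem_segment ℝ x y)
    have hz' := (convex_ball x₀ R).segment_subset hx hy hz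
    have h1 := hL.dist_le_mul z (hb z hz').2.2.1 x (hb x hx).2.2.1
    rw [dist_eq_norm, dist_eq_norm] at h1
    refine h1.trans (mul_le_mul hML ?_ (norm_nonneg _) (by linarith))
    obtain ⟨a, b, ha, hb', hab, rfl⟩ := hz
    have : a • x + b • y - x = b • (y - x) := by
      rw [← eq_sub_iff_add_eq] at hab; rw [hab]; module
    rw [this, norm_smul, Real.norm_of_nonneg hb']
    exact mul_le_of_le_one_left (norm_nonneg _) (by linarith)
  set p : E → ℝ → E := fun x s => x₀ + s • (x - x₀) with hp
  have hpb : ∀ x ∈ ball x₀ R, ∀ s ∈ Set.Icc (0 : ℝ) 1, p x s ∈ ball x₀ R := fun x hx s hs => by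
    rw [mem_ball, dist_eq_norm] at hx ⊢
    rw [hp, add_sub_cancel_left, norm_smul, Real.norm_of_nonneg hs.1]
    exact lt_of_le_of_lt (mul_le_of_le_one_left (norm_nonneg _) hs.2) hx
  have hpd : ∀ x s, HasDerivAt (p x) (x - x₀) s := fun x s => by
    have := ((hasDerivAt_id s).smul_const (x - x₀)).const_add x₀
    rwa [one_smul] at this
  set B : E → ℝ → F →L[ℝ] F := fun x s => A (p x s) (x - x₀) with hB
  have hBn : ∀ x ∈ ball x₀ R, ∀ s ∈ Set.Icc (0 : ℝ) 1, ‖B x s‖ ≤ 1 / 2 := fun x hx s hs => by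
    have h1 := (hb _ (hpb x hx s hs)).1
    rw [mem_ball, dist_eq_norm] at hx
    refine (ContinuousLinearMap.le_opNorm _ _).trans (le_trans ?_ hRM)
    exact mul_le_mul h1 hx.le (norm_nonneg _) (by linarith)
  have hAd : ∀ x ∈ ball x₀ R, ∀ s ∈ Set.Icc (0 : ℝ) 1,
      HasDerivAt (fun s => A (p x s)) (fderiv ℝ A (p x s) (x - x₀)) s := fun x hx s hs =>
    (hdiff _ (hpb x hx s hs)).comp_hasDerivAt s (hpd x s)
  have hBc : ∀ x ∈ ball x₀ R, ContinuousOn (B x) (Set.Icc 0 1) := fun x hx s hs =>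
    ((hAd x hx s hs).continuousAt.clm_apply continuousAt_const).continuousWithinAt
  refine ⟨R, hR, fun x hx => (hb x hx).2.2.2, fun c => ?_⟩
  -- Parallel transport of `c` along the segment from `x₀` to `x`; the section is its value at the
  -- endpoint.
  choose! Y hY0 hYn hYd using fun x (hx : x ∈ ball x₀ R) =>
    exists_linear_ode_solution (hBc x hx) (hBn x hx) c
  have hx₀R : x₀ ∈ ball x₀ R := mem_ball_self hR
  have h1mem : (1 : ℝ) ∈ Set.Icc (0 : ℝ) 1 := by simp
  refine ⟨fun x => Y x 1, ?_, fun x hx => ?_⟩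
  · have h1 : Y x₀ 1 - c = 0 := by
      have := norm_le_of_linear_ode (B := B x₀) (D := fun s => Y x₀ s - c) (r := 0) (ε := 0)
        (hBn x₀ hx₀R) (by simp [hY0 x₀ hx₀R]) (fun s hs => by
          have h2 := (hYd x₀ hx₀R s hs).sub_const c
          have h3 : B x₀ s = 0 := by simp [hB]
          simpa [h3] using h2) (by simp) 1 h1mem
      simpa using this
    exact sub_eq_zero.mp h1
  · set N : ℝ := 2 * ‖c‖ with hN
    have hN0 : 0 ≤ N := by positivity
    have hp1 : p x 1 = x := by simp [hp]
    have main : ∀ y ∈ ball x₀ R, ‖Y y 1 - Y x 1 - A x (y - x) (Y x 1)‖ ≤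
        2 * (2 * M * (4 * M * N) + 2 * M * N) * ‖y - x‖ ^ 2 := fun y hy => by
      have hξ : ‖x - x₀‖ ≤ 1 := by
        rw [mem_ball, dist_eq_norm] at hx; linarith
      have hη : ‖y - x₀‖ ≤ 1 := by
        rw [mem_ball, dist_eq_norm] at hy; linarith
      have hh := norm_nonneg (y - x)
      have hyx : y - x₀ = (x - x₀) + (y - x) := by abel
      have hpp : ∀ s, p y s - p x s = s • (y - x) := fun s => by simp only [hp]; module
      have hpn : ∀ s ∈ Set.Icc (0 : ℝ) 1, ‖p y s - p x s‖ ≤ ‖y - x‖ := fun s hs => by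
        rw [hpp, norm_smul, Real.norm_of_nonneg hs.1]
        exact mul_le_of_le_one_left hh hs.2
      have hAA : ∀ s ∈ Set.Icc (0 : ℝ) 1, ‖A (p y s) - A (p x s)‖ ≤ M * ‖y - x‖ := fun s hs =>
        (hA1 _ (hpb x hx s hs) _ (hpb y hy s hs)).trans
          (mul_le_mul_of_nonneg_left (hpn s hs) (by linarith))
      have hAA2 : ∀ s ∈ Set.Icc (0 : ℝ) 1,
          ‖A (p y s) - A (p x s) - fderiv ℝ A (p x s) (s • (y - x))‖ ≤ M * ‖y - x‖ * ‖y - x‖ :=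
        fun s hs => by
          have h1 := hA2 _ (hpb x hx s hs) _ (hpb y hy s hs)
          rw [hpp] at h1
          have h2 := hpn s hs
          rw [hpp] at h2
          refine h1.trans ?_
          gcongr
      have hBB : ∀ s ∈ Set.Icc (0 : ℝ) 1, ‖B y s - B x s‖ ≤ 2 * M * ‖y - x‖ := fun s hs => by
        have e : B y s - B x s = (A (p y s) - A (p x s)) (y - x₀) + A (p x s) (y - x) := by
          simp only [hB, sub_apply]
          rw [hyx, map_add, map_add]
          abel
        rw [e]
        refine (norm_add_le _ _).trans ?_
        have i1 := (ContinuousLinearMap.le_opNorm (A (p y s) - A (p x s)) (y - x₀)).trans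
          (mul_le_mul (hAA s hs) hη (norm_nonneg _) (by positivity))
        have i2 := (ContinuousLinearMap.le_opNorm (A (p x s)) (y - x)).trans
          (mul_le_mul_of_nonneg_right (hb _ (hpb x hx s hs)).1 hh)
        linarith
      have hBB2 : ∀ s ∈ Set.Icc (0 : ℝ) 1, ‖B y s - B x s - A (p x s) (y - x) -
          s • fderiv ℝ A (p x s) (y - x) (x - x₀)‖ ≤ 2 * M * ‖y - x‖ ^ 2 := fun s hs => by
        have e : B y s - B x s - A (p x s) (y - x) -
            s • fderiv ℝ A (p x s) (y - x) (x - x₀) = (A (p y s) - A (p x s)) (y - x) +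
            (A (p y s) - A (p x s) - fderiv ℝ A (p x s) (s • (y - x))) (x - x₀) := by
          simp only [hB, sub_apply, map_smul, smul_apply]
          rw [hyx, map_add]
          abel
        rw [e]
        refine (norm_add_le _ _).trans ?_
        have i1 := (ContinuousLinearMap.le_opNorm (A (p y s) - A (p x s)) (y - x)).trans
          (mul_le_mul_of_nonneg_right (hAA s hs) hh)
        have i2 := (ContinuousLinearMap.le_opNorm (A (p y s) - A (p x s) -
          fderiv ℝ A (p x s) (s • (y - x))) (x - x₀)).trans
          (mul_le_mul (hAA2 s hs) hξ (norm_nonneg _) (by positivity))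
        linarith
      have hd : ∀ s ∈ Set.Icc (0 : ℝ) 1, ‖Y y s - Y x s‖ ≤ 2 * (2 * M * ‖y - x‖ * N) :=
        norm_le_of_linear_ode (B := B y) (r := fun s => (B y s - B x s) (Y x s)) (hBn y hy)
          (by rw [hY0 x hx, hY0 y hy, sub_self]) (fun s hs => by
            refine ((hYd y hy s hs).sub (hYd x hx s hs)).congr_deriv ?_
            rw [sub_apply, map_sub]; abel) (fun s hs =>
            (ContinuousLinearMap.le_opNorm _ _).trans
              (mul_le_mul (hBB s hs) (hYn x hx s hs) (norm_nonneg _) (by positivity)))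
      -- The comparison function subtracts the expected variation `s A(y - x) Y_x(s)` from `Y_y -
      -- Y_x`. It solves the radial equation of `x` up to a source quadratic in `y - x`.
      have hD := norm_le_of_linear_ode (B := B x)
        (D := fun s => Y y s - Y x s - s • A (p x s) (y - x) (Y x s))
        (r := fun s => (B y s - B x s) (Y y s - Y x s) + (B y s - B x s - A (p x s) (y - x) -
          s • fderiv ℝ A (p x s) (y - x) (x - x₀)) (Y x s))
        (ε := 2 * M * ‖y - x‖ * (2 * (2 * M * ‖y - x‖ * N)) + 2 * M * ‖y - x‖ ^ 2 * N)
        (hBn x hx) (by simp [hY0 x hx, hY0 y hy]) (fun s hs => by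
          have h1 := ((hAd x hx s hs).clm_apply (hasDerivAt_const s (y - x))).hasDerivWithinAt
            (s := Set.Icc 0 1)
          have h2 := (hasDerivWithinAt_id s (Set.Icc 0 1)).smul (h1.clm_apply (hYd x hx s hs))
          refine (((hYd y hy s hs).sub (hYd x hx s hs)).sub h2).congr_deriv ?_
          -- Flatness exchanges the radial direction with `y - x`, so that the first-order terms of
          -- the source cancel.
          have h3 : s • fderiv ℝ A (p x s) (y - x) (x - x₀) (Y x s) +
              s • B x s (A (p x s) (y - x) (Y x s)) =
              s • fderiv ℝ A (p x s) (x - x₀) (y - x) (Y x s) +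
              s • A (p x s) (y - x) (B x s (Y x s)) := by
            have := congrArg (fun T : F →L[ℝ] F => s • T (Y x s))
              (hflat (p x s) (hb _ (hpb x hx s hs)).2.2.2 (y - x) (x - x₀))
            simpa only [add_apply, ContinuousLinearMap.comp_apply, smul_add] using this
          generalize A (p x s) (y - x) = P at h3 ⊢
          generalize fderiv ℝ A (p x s) (y - x) (x - x₀) = Q at h3 ⊢
          generalize fderiv ℝ A (p x s) (x - x₀) (y - x) = Q' at h3 ⊢
          simp only [map_sub, map_smul, sub_apply, smul_apply, map_zero, add_zero,
            id_eq, one_smul, smul_add]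
          rw [← sub_eq_zero] at h3 ⊢
          rw [← h3]
          module) (fun s hs => by
          refine (norm_add_le _ _).trans (add_le_add ?_ ?_)
          · exact (ContinuousLinearMap.le_opNorm _ _).trans
              (mul_le_mul (hBB s hs) (hd s hs) (norm_nonneg _) (by positivity))
          · exact (ContinuousLinearMap.le_opNorm _ _).trans
              (mul_le_mul (hBB2 s hs) (hYn x hx s hs) (norm_nonneg _) (by positivity))) 1 h1mem
      simp only [hp1, one_smul] at hD
      refine hD.trans (le_of_eq ?_)
      ring
    have h1 : HasFDerivAt (fun y => Y y 1 - Y x 1 - A x (y - x) (Y x 1)) (0 : E →L[ℝ] F) x := by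
      refine Asymptotics.IsBigO.hasFDerivAt (n := 2) (Asymptotics.IsBigO.of_bound
        (2 * (2 * M * (4 * M * N) + 2 * M * N)) ?_) one_lt_two
      filter_upwards [isOpen_ball.mem_nhds hx] with y hy
      rw [Real.norm_of_nonneg (by positivity)]
      exact main y hy
    have h2 : HasFDerivAt (fun y => A x (y - x) (Y x 1)) ((A x).flip (Y x 1)) x := by
      have := ((A x).flip (Y x 1)).hasFDerivAt.comp x ((hasFDerivAt_id x).sub_const x)
      exact this
    have h3 := (h1.add h2).add_const (Y x 1)
    rw [zero_add] at h3
    convert h3 using 1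
    funext y
    simp

end FlatConnection

/-! ### Parallel sections in coordinates -/

section ConstantCurvature

open Metric

/-- Matrices acting on vectors, as a continuous real-linear map. -/
def matrixAction (ι : Type*) [Fintype ι] : (ι → ι → ℂ) →L[ℝ] (ι → ℂ) →L[ℝ] (ι → ℂ) :=
  LinearMap.toContinuousLinearMap
    { toFun := fun M => LinearMap.toContinuousLinearMap
        { toFun := fun v p => ∑ q, M p q * v q
          map_add' := fun u v => by
            funext p; simp only [Pi.add_apply, mul_add, Finset.sum_add_distrib]
          map_smul' := fun c v => by
            funext p
            simp only [Pi.smul_apply, mul_smul_comm, Finset.smul_sum, RingHom.id_apply] }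
      map_add' := fun M M' => by
        ext v p
        simp [add_mul, Finset.sum_add_distrib]
      map_smul' := fun c M => by
        ext v p
        simp [Finset.mul_sum, mul_assoc] }

theorem matrixAction_apply {ι : Type*} [Fintype ι] (M : ι → ι → ℂ) (v : ι → ℂ) (p : ι) :
    matrixAction ι M v p = ∑ q, M p q * v q := rfl

theorem hasFDerivAt_iff_pd {ι : Type*} [Fintype ι] {Y : E3 → ι → ℂ} {T : E3 →L[ℝ] ι → ℂ} {x : E3}
    (h : HasFDerivAt Y T x) (i : Fin 3) (p : ι) :
    pd i (fun y => Y y p) x = T (EuclideanSpace.single i 1) p := by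
  rw [pd, ((hasFDerivAt_pi'.mp h) p).fderiv]
  rfl

set_option maxSynthPendingDepth 3 in
/-- Parallel sections of a flat linear connection on a trivial bundle over an open subset of
`ℝ³`. -/
theorem exists_parallel_coords {ι : Type*} [Fintype ι] {Ω : Set E3} (hΩ : IsOpen Ω) {x₀ : E3}
    (hx₀ : x₀ ∈ Ω) {a : Fin 3 → E3 → ι → ι → ℂ}
    (ha : ∀ i p q, ContDiffOn ℝ ∞ (fun x => a i x p q) Ω)
    (hflat : ∀ x ∈ Ω, ∀ i j p q,
      pd i (fun y => a j y p q) x + ∑ r, a j x p r * a i x r q =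
      pd j (fun y => a i y p q) x + ∑ r, a i x p r * a j x r q) :
    ∃ R > 0, ball x₀ R ⊆ Ω ∧ ∀ c : ι → ℂ, ∃ Y : E3 → ι → ℂ, Y x₀ = c ∧
      (∀ p, ContDiffOn ℝ ∞ (fun x => Y x p) (ball x₀ R)) ∧
      ∀ x ∈ ball x₀ R, ∀ i p, pd i (fun y => Y y p) x = ∑ q, a i x p q * Y x q := by
  set A : E3 → E3 →L[ℝ] (ι → ℂ) →L[ℝ] (ι → ℂ) := fun x =>
    ∑ i, (EuclideanSpace.proj i : E3 →L[ℝ] ℝ).smulRight (matrixAction ι (a i x)) with hA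
  have hav : ∀ i, ContDiffOn ℝ ∞ (a i) Ω := fun i =>
    contDiffOn_pi.mpr fun p => contDiffOn_pi.mpr fun q => ha i p q
  have sA : ContDiffOn ℝ ∞ A Ω := ContDiffOn.sum fun i _ =>
    ((ContinuousLinearMap.smulRightL ℝ E3 ((ι → ℂ) →L[ℝ] (ι → ℂ))
      (EuclideanSpace.proj i : E3 →L[ℝ] ℝ)).comp (matrixAction ι)).contDiff.comp_contDiffOn (hav i)
  have hAa : ∀ x h v p, A x h v p = ∑ i, h i * ∑ q, a i x p q * v q := fun x h v p => by
    simp [hA, matrixAction_apply]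
  have hdA : ∀ x ∈ Ω, ∀ u h v p, fderiv ℝ A x u h v p =
      ∑ j, u j * ∑ i, h i * ∑ q, pd j (fun y => a i y p q) x * v q := by
    intro x hx u h v p
    have hd : ∀ i q, DifferentiableAt ℝ (fun y => a i y p q) x := fun i q =>
      (ha i p q).differentiableAt_of_isOpen hΩ hx
    have h1 : HasFDerivAt A (fderiv ℝ A x) x :=
      (((sA.contDiffAt (hΩ.mem_nhds hx))).differentiableAt (by norm_num)).hasFDerivAt
    have h2 := hasFDerivAt_pi'.mp ((h1.clm_apply (hasFDerivAt_const h x)).clm_apply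
      (hasFDerivAt_const v x)) p
    have h3 := fderiv_apply_eq_sum_pd (fun y => A y h v p) x u
    rw [h2.fderiv] at h3
    have h4 : fderiv ℝ A x u h v p = ∑ j, u j • pd j (fun y => A y h v p) x := by
      rw [← h3]; simp
    rw [h4]
    refine Finset.sum_congr rfl fun j _ => ?_
    rw [Complex.real_smul]
    congr 1
    simp only [hAa]
    rw [pd_sum (f := fun i y => (h i : ℂ) * ∑ q, a i y p q * v q) fun i _ =>
      (DifferentiableAt.fun_sum fun q _ => (hd i q).mul_const _).const_mul _]
    refine Finset.sum_congr rfl fun i _ => ?_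
    rw [pd_mul (differentiableAt_const _) (DifferentiableAt.fun_sum fun q _ =>
      (hd i q).mul_const _), pd_const, zero_mul, zero_add, pd_sum
      (f := fun q y => a i y p q * v q) fun q _ => (hd i q).mul_const _]
    congr 1
    refine Finset.sum_congr rfl fun q _ => ?_
    rw [pd_mul (hd i q) (differentiableAt_const _), pd_const, mul_zero, add_zero]
  obtain ⟨R, hR, hball, H⟩ := exists_parallel_section hΩ hx₀
    (sA.of_le ENat.LEInfty.out) (fun x hx u v => by
      have h1 : ∀ (u v : E3) w p, fderiv ℝ A x u v w p + A x v (A x u w) p =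
          ∑ j, ∑ i, u j * v i * ∑ q, (pd j (fun y => a i y p q) x +
            ∑ r, a i x p r * a j x r q) * w q := fun u v w p => by
        have h3 : ∀ i, (∑ q, a i x p q * A x u w q) =
            ∑ j, u j * ∑ q, (∑ r, a i x p r * a j x r q) * w q := fun i => by
          simp only [hAa, Finset.mul_sum, Finset.sum_mul]
          rw [Finset.sum_comm]
          refine Finset.sum_congr rfl fun j _ => ?_
          rw [Finset.sum_comm]
          refine Finset.sum_congr rfl fun q _ => Finset.sum_congr rfl fun r _ => ?_
          ring
        rw [hdA x hx, hAa x v (A x u w)]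
        simp only [h3, add_mul, Finset.sum_add_distrib, mul_add]
        congr 1
        · simp only [Finset.mul_sum, mul_assoc]
        · simp only [Finset.mul_sum]
          rw [Finset.sum_comm]
          refine Finset.sum_congr rfl fun j _ => Finset.sum_congr rfl fun i _ =>
            Finset.sum_congr rfl fun q _ => ?_
          ring
      ext w p
      simp only [add_apply, ContinuousLinearMap.comp_apply, Pi.add_apply, h1]
      rw [Finset.sum_comm]
      refine Finset.sum_congr rfl fun i _ => Finset.sum_congr rfl fun j _ => ?_
      rw [mul_comm (v i : ℂ)]
      congr 1
      refine Finset.sum_congr rfl fun q _ => ?_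
      rw [hflat x hx])
  refine ⟨R, hR, hball, fun c => ?_⟩
  obtain ⟨Y, hY0, hY⟩ := H c
  have hpd : ∀ x ∈ ball x₀ R, ∀ i p, pd i (fun y => Y y p) x = ∑ q, a i x p q * Y x q :=
    fun x hx i p => by
      rw [hasFDerivAt_iff_pd (hY x hx), ContinuousLinearMap.flip_apply, hAa,
        Finset.sum_eq_single i (fun j _ hj => by simp [hj]) (by simp)]
      simp
  refine ⟨Y, hY0, fun p => ?_, hpd⟩
  -- Bootstrap: the derivative of `Y` is a smooth family of linear maps applied to `Y`, so each
  -- degree of smoothness yields the next.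
  have hs : ContDiffOn ℝ ∞ Y (ball x₀ R) := by
    rw [contDiffOn_infty]
    intro n
    induction n with
    | zero =>
      exact contDiffOn_zero.mpr fun x hx => (hY x hx).continuousAt.continuousWithinAt
    | succ n ih =>
      rw [Nat.cast_add, Nat.cast_one]
      refine (contDiffOn_succ_iff_fderiv_of_isOpen isOpen_ball).mpr
        ⟨fun x hx => (hY x hx).differentiableAt.differentiableWithinAt,
          fun h => (WithTop.natCast_ne_top n h).elim, ?_⟩
      refine ContDiffOn.congr (f := fun x => (A x).flip (Y x)) ?_ fun x hx => (hY x hx).fderiv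
      have h1 : ContDiffOn ℝ n (fun x => (A x).flip) (ball x₀ R) :=
        (ContinuousLinearMap.flipₗᵢ ℝ E3 (ι → ℂ) (ι → ℂ)).contDiff.comp_contDiffOn
          ((sA.of_le ENat.LEInfty.out).mono hball)
      exact h1.clm_apply ih
  exact contDiffOn_pi.mp hs p

end ConstantCurvature

/-! ### Vanishing `Φ` forces constant curvature -/

section TypeO

open Metric

variable {Ω : Set E3} {G : E3 → Matrix (Fin 3) (Fin 3) ℝ} {x x₀ : E3} {Λ : ℝ}

/-- Antisymmetry supplies linearity in the second slot, so three values on pairs of frame vectors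
determine `f`. -/
theorem IsAdaptedFrame.antisymm_eq_zero {B : Matrix (Fin 3) (Fin 3) ℝ} {k l n : Fin 3 → ℂ}
    (h : IsAdaptedFrame B k l n) (hB : ∀ i j, B i j = B j i) {f : (Fin 3 → ℂ) → (Fin 3 → ℂ) → ℂ}
    (hadd : ∀ u u' v, f (u + u') v = f u v + f u' v) (hsmul : ∀ (c : ℂ) u v, f (c • u) v = c * f u v)
    (hanti : ∀ u v, f u v = -f v u) (hkl : f k l = 0) (hkn : f k n = 0) (hln : f l n = 0)
    (u v : Fin 3 → ℂ) : f u v = 0 := by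
  have hsub : ∀ u u' v, f (u - u') v = f u v - f u' v := fun u u' v => by
    rw [show u - u' = u + (-1 : ℂ) • u' by module, hadd, hsmul]; ring
  have hexp : ∀ u v, f k v = 0 → f l v = 0 → f n v = 0 → f u v = 0 := fun u v h1 h2 h3 => by
    rw [h.expand hB u, hsub, hadd, hsmul, hsmul, hsmul, h1, h2, h3]; ring
  have hself : ∀ u, f u u = 0 := fun u => by
    have := hanti u u
    linear_combination this / 2
  have hv : ∀ w, f k w = 0 → f l w = 0 → f n w = 0 → ∀ v, f w v = 0 := fun w h1 h2 h3 v => by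
    rw [hanti, hexp v w h1 h2 h3, neg_zero]
  refine hexp u v (hv k (hself k) ?_ ?_ v) (hv l hkl (hself l) ?_ v) (hv n hkn hln (hself n) v)
  · rw [hanti, hkl, neg_zero]
  · rw [hanti, hkn, neg_zero]
  · rw [hanti, hln, neg_zero]

theorem curv_add_left (u u' v w : Fin 3 → ℂ) :
    curv G x (u + u') v w = curv G x u v w + curv G x u' v w := by
  funext c
  simp only [curv, Pi.add_apply, mul_add, add_mul, Finset.sum_add_distrib]

theorem curv_smul_left (c : ℂ) (u v w : Fin 3 → ℂ) :
    curv G x (c • u) v w = c • curv G x u v w := by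
  funext d
  simp only [curv, Pi.smul_apply, smul_eq_mul, Finset.mul_sum]
  refine Finset.sum_congr rfl fun a _ => Finset.sum_congr rfl fun b _ =>
    Finset.sum_congr rfl fun e _ => ?_
  ring

theorem curv_add_right (u v w w' : Fin 3 → ℂ) :
    curv G x u v (w + w') = curv G x u v w + curv G x u v w' := by
  funext c
  simp only [curv, Pi.add_apply, mul_add, Finset.sum_add_distrib]

theorem curv_smul_right (c : ℂ) (u v w : Fin 3 → ℂ) :
    curv G x u v (c • w) = c • curv G x u v w := by
  funext d
  simp only [curv, Pi.smul_apply, smul_eq_mul, Finset.mul_sum]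
  refine Finset.sum_congr rfl fun a _ => Finset.sum_congr rfl fun b _ =>
    Finset.sum_congr rfl fun e _ => ?_
  ring

/-- An Einstein metric in three dimensions has constant curvature. -/
theorem LocalMetric.curv_of_phi_eq_zero (hG : LocalMetric Ω G) (hx : x ∈ Ω) {k l n : Fin 3 → ℂ}
    (hf : IsAdaptedFrame (G x) k l n) (hR : scalarCurv G x = 6 * Λ) (hΦ : phi G x = 0)
    (u v w : Fin 3 → ℂ) : curv G x u v w =
      (Λ : ℂ) • (complexBilin (G x) u w • v - complexBilin (G x) v w • u) := by
  have hB := hG.symm x hx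
  have hric : ∀ u v, complexBilin (G x) (curv G x u k v) l + complexBilin (G x) (curv G x u l v) k -
      2 * complexBilin (G x) (curv G x u n v) n = 2 * Λ * complexBilin (G x) u v := fun u v => by
    rw [← hG.ricci_frame hx hf]
    have h1 := complexBilin_phi (G := G) (x := x) u v
    rw [hΦ, hR] at h1
    have h2 : complexBilin 0 u v = 0 := by simp [complexBilin]
    rw [h2] at h1
    push_cast at h1
    linear_combination -h1
  -- The curvature minus its constant-curvature model. It is antisymmetric in both pairs and its
  -- Ricci contraction vanishes: nine equations for nine components, so neither pair symmetry nor
  -- the Bianchi identity is needed.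
  set T : (Fin 3 → ℂ) → (Fin 3 → ℂ) → (Fin 3 → ℂ) → (Fin 3 → ℂ) → ℂ := fun u v z w =>
    complexBilin (G x) (curv G x u v z) w - Λ * (complexBilin (G x) u z * complexBilin (G x) v w -
      complexBilin (G x) v z * complexBilin (G x) u w) with hT
  have hT1 : ∀ u v z w, T u v z w = -T v u z w := fun u v z w => by
    simp only [hT]
    rw [curv_antisymm_left, complexBilin_neg_left]; ring
  have hT2 : ∀ u v z w, T u v z w = -T u v w z := fun u v z w => by
    have := hG.curv_antisymm hx u v z w
    rw [complexBilin_comm hB z] at this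
    simp only [hT]
    linear_combination this
  have hadd : ∀ u u' v z w, T (u + u') v z w = T u v z w + T u' v z w := fun u u' v z w => by
    simp only [hT, curv_add_left, complexBilin_add_left]; ring
  have hsmul : ∀ (c : ℂ) u v z w, T (c • u) v z w = c * T u v z w := fun c u v z w => by
    simp only [hT, curv_smul_left, complexBilin_smul_left]; ring
  have hadd' : ∀ u v z z' w, T u v (z + z') w = T u v z w + T u v z' w := fun u v z z' w => by
    simp only [hT, curv_add_right, complexBilin_add_left, complexBilin_add_right]; ring
  have hsmul' : ∀ (c : ℂ) u v z w, T u v (c • z) w = c * T u v z w := fun c u v z w => by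
    simp only [hT, curv_smul_right, complexBilin_smul_left, complexBilin_smul_right]; ring
  have hs1 : ∀ u z w, T u u z w = 0 := fun u z w => by
    linear_combination hT1 u u z w / 2
  have hs2 : ∀ u v z, T u v z z = 0 := fun u v z => by
    linear_combination hT2 u v z z / 2
  have hRT : ∀ u v, T u k v l + T u l v k - 2 * T u n v n = 0 := fun u v => by
    have h2 := hric u v
    have h3 := congrArg (complexBilin (G x) u) (hf.expand hB v)
    simp only [complexBilin_add_right, complexBilin_sub_right, complexBilin_smul_right] at h3
    have h4 : complexBilin (G x) k v = complexBilin (G x) v k := complexBilin_comm hB _ _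
    have h5 : complexBilin (G x) l v = complexBilin (G x) v l := complexBilin_comm hB _ _
    have h6 : complexBilin (G x) n v = complexBilin (G x) v n := complexBilin_comm hB _ _
    have h7 : complexBilin (G x) l k = 1 := by rw [complexBilin_comm hB, hf.kl]
    simp only [hT, h4, h5, h6, hf.kl, h7, hf.nn]
    linear_combination h2 - Λ * h3
  have key : ∀ u v, T u v k l = 0 ∧ T u v k n = 0 ∧ T u v l n = 0 := by
    have a1 := hRT k k
    have a2 := hRT k l
    have a3 := hRT l k
    have a4 := hRT l l
    have a5 := hRT k n
    have a6 := hRT n k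
    have a7 := hRT l n
    have a8 := hRT n l
    have a9 := hRT n n
    have b1 := hT1 l k
    have b2 := hT1 n k
    have b3 := hT1 n l
    simp only [hs1, hs2, b1, b2, b3] at a1 a2 a3 a4 a5 a6 a7 a8 a9
    have c1 := fun u v => hT2 u v l k
    have c2 := fun u v => hT2 u v n k
    have c3 := fun u v => hT2 u v n l
    simp only [c1, c2, c3] at a1 a2 a3 a4 a5 a6 a7 a8 a9
    -- Three equations couple `T k l k l`, `T k n l n` and `T l n k n`; each of the other six
    -- determines a single component.
    have d1 : T k n l n = 0 := by linear_combination (2 * a9 + a3 - a2) / 4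
    have d2 : T l n k n = 0 := by linear_combination (2 * a9 - a3 + a2) / 4
    refine fun u v => ⟨?_, ?_, ?_⟩
    · refine hf.antisymm_eq_zero hB (f := fun u v => T u v k l) (fun _ _ _ => hadd _ _ _ _ _)
        (fun _ _ _ => hsmul _ _ _ _ _) (fun _ _ => hT1 _ _ _ _) ?_ ?_ ?_ u v
      · linear_combination -a2 - 2 * d1
      · linear_combination -a6
      · linear_combination a8
    · refine hf.antisymm_eq_zero hB (f := fun u v => T u v k n) (fun _ _ _ => hadd _ _ _ _ _)
        (fun _ _ _ => hsmul _ _ _ _ _) (fun _ _ => hT1 _ _ _ _) ?_ ?_ ?_ u v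
      · linear_combination -a5
      · linear_combination -a1 / 2
      · exact d2
    · refine hf.antisymm_eq_zero hB (f := fun u v => T u v l n) (fun _ _ _ => hadd _ _ _ _ _)
        (fun _ _ _ => hsmul _ _ _ _ _) (fun _ _ => hT1 _ _ _ _) ?_ ?_ ?_ u v
      · linear_combination a7
      · exact d1
      · linear_combination -a4 / 2
  have hzero : ∀ z w, T u v z w = 0 := fun z w =>
    hf.antisymm_eq_zero hB (fun _ _ _ => hadd' _ _ _ _ _) (fun _ _ _ => hsmul' _ _ _ _ _)
      (fun _ _ => hT2 _ _ _ _) (key u v).1 (key u v).2.1 (key u v).2.2 z w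
  refine eq_of_complexBilin_eq (hG.det_ne_zero x hx) fun z => ?_
  have h1 := hzero w z
  simp only [hT] at h1
  rw [complexBilin_smul_right, complexBilin_sub_right, complexBilin_smul_right,
    complexBilin_smul_right, complexBilin_comm hB z, complexBilin_comm hB z v,
    complexBilin_comm hB z u]
  linear_combination h1

theorem LocalMetric.riemann_of_phi_eq_zero (hG : LocalMetric Ω G) (hx : x ∈ Ω)
    {k l n : Fin 3 → ℂ} (hf : IsAdaptedFrame (G x) k l n) (hR : scalarCurv G x = 6 * Λ)
    (hΦ : phi G x = 0) (a b d c : Fin 3) : riemann G a b d c x =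
      Λ * (G x a d * (if b = c then 1 else 0) - G x b d * (if a = c then 1 else 0)) := by
  have h1 := congrFun (hG.curv_of_phi_eq_zero hx hf hR hΦ (Pi.single a 1) (Pi.single b 1)
    (Pi.single d 1)) c
  simp only [curv, complexBilin, Pi.single_apply, Pi.smul_apply, Pi.sub_apply, smul_eq_mul, mul_ite,
    mul_one, mul_zero, Finset.sum_ite_eq', Finset.mem_univ, if_true, eq_comm (a := c)] at h1
  apply Complex.ofReal_injective
  rw [h1]
  push_cast
  split_ifs <;> simp

end TypeO

/-! ### Co-geodetic null fields in constant curvature -/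

section TypeOSolution

open Metric

variable {Ω : Set E3} {G : E3 → Matrix (Fin 3) (Fin 3) ℝ} {x x₀ : E3} {Λ : ℝ}

/-- The connection matrices of the system `∇_u V = Λ f u`, `∂_u f = g(u, V)` for a vector field `V`
and a function `f`. -/
def prolongation (G : E3 → Matrix (Fin 3) (Fin 3) ℝ) (Λ : ℝ) (i : Fin 3) (x : E3) :
    Option (Fin 3) → Option (Fin 3) → ℂ
  | some c, some d => -(christoffel G c i d x : ℂ)
  | some c, none => if i = c then (Λ : ℂ) else 0
  | none, some d => (G x i d : ℂ)
  | none, none => 0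

theorem LocalMetric.contDiffOn_prolongation (hG : LocalMetric Ω G) (i : Fin 3)
    (p q : Option (Fin 3)) : ContDiffOn ℝ ∞ (fun x => prolongation G Λ i x p q) Ω := by
  rcases p with _ | c <;> rcases q with _ | d
  · exact contDiffOn_const
  · exact (hG.smooth i d).ofReal
  · exact contDiffOn_const
  · exact (hG.contDiffOn_christoffel c i d).ofReal.neg

/-- The four blocks are symmetry of the metric, metric compatibility, absence of torsion, and the
constant-curvature identity, whose two terms are the products passing through the function slot. -/
theorem LocalMetric.prolongation_flat (hG : LocalMetric Ω G) (hx : x ∈ Ω)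
    (hR : ∀ a b d c, riemann G a b d c x =
      Λ * (G x a d * (if b = c then 1 else 0) - G x b d * (if a = c then 1 else 0)))
    (i j : Fin 3) (p q : Option (Fin 3)) :
    pd i (fun y => prolongation G Λ j y p q) x +
      ∑ r, prolongation G Λ j x p r * prolongation G Λ i x r q =
    pd j (fun y => prolongation G Λ i y p q) x +
      ∑ r, prolongation G Λ i x p r * prolongation G Λ j x r q := by
  have hΓ : ∀ a b d, DifferentiableAt ℝ (christoffel G a b d) x := fun a b d =>
    (hG.contDiffOn_christoffel a b d).differentiableAt_of_isOpen hG.isOpen hx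
  rw [Fintype.sum_option, Fintype.sum_option]
  rcases p with _ | c <;> rcases q with _ | d
  · simp only [prolongation, pd_const, mul_ite, mul_zero, Finset.sum_ite_eq, Finset.mem_univ,
      if_true, hG.symm x hx i j]
  · have h1 := hG.covDeriv₂_metric hx i j d
    have h2 := hG.covDeriv₂_metric hx j i d
    simp only [covDeriv₂, Fin.sum_univ_three] at h1 h2
    have h3 := congrArg Complex.ofReal (h1.trans h2.symm)
    simp only [prolongation, pd_ofReal ((hG.smooth _ _).differentiableAt_of_isOpen hG.isOpen hx),
      Fin.sum_univ_three]
    have e := hG.christoffel_symm hx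
    push_cast at h3
    rw [e 0 j i, e 1 j i, e 2 j i] at h3
    linear_combination h3
  · simp only [prolongation, pd_const, mul_zero, mul_ite, Finset.sum_ite_eq, Finset.mem_univ,
      if_true, hG.christoffel_symm hx c i j]
  · have h1 := congrArg Complex.ofReal (hR i j d c)
    simp only [riemann, Fin.sum_univ_three] at h1
    have h2 : ∀ a b d, pd a (fun y => -(christoffel G c b d y : ℂ)) x =
        -((pd a (christoffel G c b d) x : ℝ) : ℂ) := fun a b d => by
      rw [pd_neg, pd_ofReal (hΓ c b d)]
    simp only [prolongation, h2, Fin.sum_univ_three]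
    push_cast at h1
    split_ifs at h1 ⊢ <;> push_cast at h1 <;> linear_combination -h1

/-- A three-dimensional Einstein metric locally admits a co-geodetic null vector field. -/
theorem LocalMetric.exists_coGeodetic_of_einstein (hG : LocalMetric Ω G) (hx : x₀ ∈ Ω)
    (hf : ∀ y ∈ Ω, ∃ k l n, IsAdaptedFrame (G y) k l n)
    (hR : ∀ y ∈ Ω, scalarCurv G y = 6 * Λ) (hΦ : ∀ y ∈ Ω, phi G y = 0) :
    ∃ W, IsOpen W ∧ x₀ ∈ W ∧ W ⊆ Ω ∧ ∃ K : E3 → Fin 3 → ℂ, ContDiffOn ℝ ∞ K W ∧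
      (∀ y ∈ W, K y ≠ 0 ∧ complexBilin (G y) (K y) (K y) = 0) ∧ CoGeodeticOn W G K := by
  obtain ⟨R, hR, hball, H⟩ := exists_parallel_coords hG.isOpen hx
    (hG.contDiffOn_prolongation (Λ := Λ)) (fun x hx i j p q => by
      obtain ⟨k, l, n, h⟩ := hf x hx
      exact hG.prolongation_flat hx (hG.riemann_of_phi_eq_zero hx h (hR x hx) (hΦ x hx)) i j p q)
  have hG' := hG.mono isOpen_ball hball
  have hB := fun y hy => hG'.symm y hy
  have hx' : x₀ ∈ ball x₀ R := mem_ball_self hR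
  have H' : ∀ (v : Fin 3 → ℂ) (c : ℂ), ∃ (V : E3 → Fin 3 → ℂ) (f : E3 → ℂ), V x₀ = v ∧ f x₀ = c ∧
      ContDiffOn ℝ ∞ V (ball x₀ R) ∧ ContDiffOn ℝ ∞ f (ball x₀ R) ∧ ∀ x ∈ ball x₀ R, ∀ u,
        covD G u V x = (Λ * f x) • u ∧ dirDeriv u f x = complexBilin (G x) u (V x) := fun v c => by
    obtain ⟨Y, hY0, hYs, hY⟩ := H fun p => p.elim c v
    refine ⟨fun x i => Y x (some i), fun x => Y x none, funext fun i => congrFun hY0 (some i), congrFun hY0 none,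
      contDiffOn_pi.mpr fun i => hYs (some i), hYs none, fun x hx u => ⟨?_, ?_⟩⟩
    · rw [covD_eq_sum]
      funext c
      have h1 := fun i => hY x hx i (some c)
      simp only [Fintype.sum_option, prolongation] at h1
      simp only [Finset.sum_apply, Pi.smul_apply, covCoord, h1, smul_eq_mul]
      simp only [neg_mul, Finset.sum_neg_distrib, neg_add_cancel_right, ite_mul, zero_mul, mul_ite,
        mul_zero, Finset.sum_ite_eq', Finset.mem_univ, if_true]
      ring
    · have h1 := fun i => hY x hx i none
      simp only [Fintype.sum_option, prolongation, zero_mul, zero_add] at h1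
      simp only [dirDeriv, h1, complexBilin, Finset.mul_sum]
      refine Finset.sum_congr rfl fun i _ => Finset.sum_congr rfl fun j _ => ?_
      ring
  obtain ⟨k, l, n, hf₀⟩ := hf x₀ hx
  -- `μ² = -2Λ` makes `(μ n, 1)` null for the pairing `g(V, V') - Λ f f'`; together with `(k, 0)` it
  -- spans a totally null plane of initial data.
  obtain ⟨μ, hμ⟩ := IsAlgClosed.exists_pow_nat_eq (-2 * Λ : ℂ) two_pos
  obtain ⟨V₁, f₁, hV₁, hf₁, sV₁, sf₁, D₁⟩ := H' k 0
  obtain ⟨V₂, f₂, hV₂, hf₂, sV₂, sf₂, D₂⟩ := H' (μ • n) 1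
  have hd : ∀ {V : E3 → Fin 3 → ℂ}, ContDiffOn ℝ ∞ V (ball x₀ R) → ∀ x ∈ ball x₀ R,
      DifferentiableAt ℝ V x := fun hV x hx => hV.diffAt_vec isOpen_ball hx
  have hd' : ∀ {f : E3 → ℂ}, ContDiffOn ℝ ∞ f (ball x₀ R) → ∀ x ∈ ball x₀ R,
      DifferentiableAt ℝ f x := fun hf x hx => hf.differentiableAt_of_isOpen isOpen_ball hx
  -- The pairing is constant along solutions, so it remains zero if it is zero at `x₀`.
  have cons : ∀ {V V' : E3 → Fin 3 → ℂ} {f f' : E3 → ℂ}, ContDiffOn ℝ ∞ V (ball x₀ R) →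
      ContDiffOn ℝ ∞ V' (ball x₀ R) → ContDiffOn ℝ ∞ f (ball x₀ R) →
      ContDiffOn ℝ ∞ f' (ball x₀ R) → (∀ x ∈ ball x₀ R, ∀ u,
        covD G u V x = (Λ * f x) • u ∧ dirDeriv u f x = complexBilin (G x) u (V x)) →
      (∀ x ∈ ball x₀ R, ∀ u,
        covD G u V' x = (Λ * f' x) • u ∧ dirDeriv u f' x = complexBilin (G x) u (V' x)) →
      complexBilin (G x₀) (V x₀) (V' x₀) = Λ * f x₀ * f' x₀ →
      ∀ x ∈ ball x₀ R, complexBilin (G x) (V x) (V' x) = Λ * f x * f' x := by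
    intro V V' f f' sV sV' sf sf' hD hD' h0 x hx
    have s1 := contDiffOn_complexBilin hG'.smooth sV sV'
    have s2 : ContDiffOn ℝ ∞ (fun y => (Λ : ℂ) * f y * f' y) (ball x₀ R) :=
      (contDiffOn_const.mul sf).mul sf'
    have h1 : ∀ y ∈ ball x₀ R, fderiv ℝ (fun y => complexBilin (G y) (V y) (V' y) -
        Λ * f y * f' y) y = 0 := fun y hy => by
      ext h
      have h2 := fderiv_apply_eq_sum_pd (fun y => complexBilin (G y) (V y) (V' y) -
        Λ * f y * f' y) y h
      have h3 := dirDeriv_sub (v := fun i => (h i : ℂ)) (hd' s1 y hy) (hd' s2 y hy)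
      rw [hG'.dirDeriv_metric hy (hd sV y hy) (hd sV' y hy), (hD y hy _).1, (hD' y hy _).1,
        dirDeriv_mul ((hd' (contDiffOn_const.mul sf) y hy)) (hd' sf' y hy),
        dirDeriv_mul (differentiableAt_const _) (hd' sf y hy), dirDeriv_const, (hD y hy _).2,
        (hD' y hy _).2, complexBilin_smul_left, complexBilin_smul_right,
        complexBilin_comm (hB y hy) (V y)] at h3
      have h4 : dirDeriv (fun i => (h i : ℂ)) (fun y => complexBilin (G y) (V y) (V' y) -
        Λ * f y * f' y) y = 0 := by
        rw [h3]; ring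
      rw [h2, zero_apply, ← h4]
      simp only [dirDeriv, Complex.real_smul]
    have h2 := isOpen_ball.is_const_of_fderiv_eq_zero (convex_ball x₀ R).isPreconnected
      (fun y hy => ((hd' s1 y hy).sub (hd' s2 y hy)).differentiableWithinAt) h1 hx hx'
    simp only [Pi.sub_apply] at h2
    rw [h0, sub_self, sub_eq_zero] at h2
    exact h2
  have c11 := cons sV₁ sV₁ sf₁ sf₁ D₁ D₁ (by rw [hV₁, hf₁, hf₀.kk]; ring)
  have c12 := cons sV₁ sV₂ sf₁ sf₂ D₁ D₂ (by
    rw [hV₁, hV₂, hf₁, complexBilin_smul_right, hf₀.kn]; ring)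
  have c22 := cons sV₂ sV₂ sf₂ sf₂ D₂ D₂ (by
    rw [hV₂, hf₂, complexBilin_smul_right, complexBilin_smul_left, hf₀.nn]
    linear_combination -hμ / 2)
  -- The combination of the two solutions whose function component vanishes. It is null because the
  -- plane is totally null, and the terms `Λ f u` cancel in its derivative.
  set K : E3 → Fin 3 → ℂ := fun y => f₂ y • V₁ y + (-f₁ y) • V₂ y with hK
  have sK : ContDiffOn ℝ ∞ K (ball x₀ R) := (sf₂.smul sV₁).add (sf₁.neg.smul sV₂)
  have hW₁ := isOpen_ne_zero isOpen_ball sf₂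
  have hs₁ : ball x₀ R ∩ {y | f₂ y ≠ 0} ⊆ ball x₀ R := Set.inter_subset_left
  refine ⟨_, isOpen_vec_ne_zero hW₁ (sK.mono hs₁), ⟨⟨hx', ?_⟩, ?_⟩,
    (Set.inter_subset_left.trans hs₁).trans hball, K,
    sK.mono (Set.inter_subset_left.trans hs₁), fun y hy => ⟨hy.2, ?_⟩, ?_⟩
  · simp [hf₂]
  · simp only [Set.mem_ofPred_eq, hK, hf₁, hf₂, hV₁, one_smul, neg_zero, zero_smul, add_zero]
    exact hf₀.k_ne_zero
  · have hy' := hs₁ hy.1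
    simp only [hK, complexBilin_add_left, complexBilin_add_right, complexBilin_smul_left,
      complexBilin_smul_right, complexBilin_comm (hB y hy') (V₂ y) (V₁ y), c11 y hy', c12 y hy',
      c22 y hy']
    ring
  · intro y hy u w hu hw
    have hy' := hs₁ hy.1
    have h2 : f₂ y ≠ 0 := hy.1.2
    have h3 : covD G u K y = complexBilin (G y) u (V₂ y) • V₁ y -
        complexBilin (G y) u (V₁ y) • V₂ y := by
      have h4 : dirDeriv u (fun y => -f₁ y) y = -complexBilin (G y) u (V₁ y) := by
        rw [← (D₁ y hy' u).2]
        simp only [dirDeriv, pd_neg, mul_neg, Finset.sum_neg_distrib]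
      rw [hK, covD_add (((hd' sf₂ y hy').fun_smul (hd sV₁ y hy')))
        ((hd' sf₁.neg y hy').fun_smul (hd sV₂ y hy')),
        covD_smul (hd' sf₂ y hy') (hd sV₁ y hy'), covD_smul (hd' sf₁.neg y hy') (hd sV₂ y hy'), h4,
        (D₁ y hy' u).1, (D₂ y hy' u).1, (D₂ y hy' u).2]
      module
    -- Orthogonality to `K` says `f₂ g(u, V₁) = f₁ g(u, V₂)`, and likewise for `w`; the
    -- antisymmetric expression then vanishes after multiplication by `f₂`.
    refine (mul_eq_zero.mp ?_).resolve_left h2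
    rw [h3]
    rw [complexBilin_comm (hB y hy') w] at hw
    simp only [hK, complexBilin_add_left, complexBilin_add_right, complexBilin_smul_left,
      complexBilin_smul_right, complexBilin_sub_left] at hu hw ⊢
    linear_combination complexBilin (G y) u (V₂ y) * hw -
      complexBilin (G y) (V₂ y) w * hu

end TypeOSolution

/-! ### Metric and volume form in charts -/

section Charts

variable {M : Type*} [TopologicalSpace M] [ChartedSpace E3 M] [IsManifold (𝓡 3) ∞ M]
  {e e' : OpenPartialHomeomorph M E3}

theorem contMDiffOn_coordVec (he : e ∈ atlas E3 M) (i : Fin 3) :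
    ContMDiffOn (𝓡 3) (𝓡 3).tangent ∞
      (fun x => Bundle.TotalSpace.mk' E3 (E := (TangentSpace (𝓡 3) : M → Type _)) (e.symm x)
        (coordVec e i x)) e.target := by
  have h1 : ContMDiffOn (𝓡 3) (𝓡 3) ∞ e.symm e.target :=
    contMDiffOn_symm_of_mem_maximalAtlas
      (StructureGroupoid.subset_maximalAtlas (contDiffGroupoid ∞ (𝓡 3)) he)
  have h2 := h1.contMDiffOn_tangentMapWithin (m := ∞) (by simp)
    e.open_target.uniqueMDiffOn
  have h3 : ContMDiffOn (𝓡 3) (𝓡 3).tangent ∞ (fun x : E3 => Bundle.TotalSpace.mk' E3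
      (E := (TangentSpace (𝓡 3) : E3 → Type _)) x (EuclideanSpace.single i (1 : ℝ) : E3))
      e.target :=
    contMDiffOn_vectorSpace_iff_contDiffOn.mpr contDiffOn_const
  refine (h2.comp h3 fun x hx => hx).congr fun x hx => ?_
  simp only [Function.comp, tangentMapWithin, coordVec]
  rw [mfderivWithin_of_isOpen e.open_target hx]

theorem PseudoRiemannianMetric.contDiffOn_comp (g : PseudoRiemannianMetric M)
    (he : e ∈ atlas E3 M) (i j : Fin 3) :
    ContDiffOn ℝ ∞ (fun x => g.comp e x i j) e.target := by
  have h0 : ContMDiffOn (𝓡 3) (𝓡 3) ∞ e.symm e.target :=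
    contMDiffOn_symm_of_mem_maximalAtlas
      (StructureGroupoid.subset_maximalAtlas (contDiffGroupoid ∞ (𝓡 3)) he)
  have h1 : ContMDiffOn (𝓡 3) ((𝓡 3).prod 𝓘(ℝ, ℝ)) ∞
      (fun x => Bundle.TotalSpace.mk' ℝ (E := Bundle.Trivial M ℝ) (e.symm x)
        (g.inner (e.symm x) (coordVec e i x) (coordVec e j x))) e.target := by
    apply ContMDiffOn.clm_bundle_apply₂ (F₁ := E3) (F₂ := E3)
    · exact g.contMDiff.comp_contMDiffOn h0
    · exact contMDiffOn_coordVec he i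
    · exact contMDiffOn_coordVec he j
  rw [← contMDiffOn_iff_contDiffOn]
  intro x hx
  have h2 := h1 x hx
  simp only [Bundle.contMDiffWithinAt_totalSpace] at h2
  exact h2.2

theorem mfderiv_symm_comp (he : e ∈ atlas E3 M) {x : E3} (hx : x ∈ e.target) (v : E3) :
    (mfderiv (𝓡 3) (𝓡 3) e (e.symm x) (mfderiv (𝓡 3) (𝓡 3) e.symm x v : TangentSpace (𝓡 3) (e.symm x)) : E3) = v := by
  have h := (mdifferentiable_of_mem_atlas (I := 𝓡 3) he).comp_symm_deriv hx
  exact congrArg (fun T : E3 →L[ℝ] E3 => T v) h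

theorem mfderiv_comp_symm (he : e ∈ atlas E3 M) {x : E3} (hx : x ∈ e.target)
    (v : TangentSpace (𝓡 3) (e.symm x)) :
    (mfderiv (𝓡 3) (𝓡 3) e.symm x (mfderiv (𝓡 3) (𝓡 3) e (e.symm x) v : E3) :
      TangentSpace (𝓡 3) (e.symm x)) = v := by
  have h := (mdifferentiable_of_mem_atlas (I := 𝓡 3) he).symm_comp_deriv (e.map_target hx)
  rw [e.right_inv hx] at h
  exact congrArg (fun T => T v) h

/-- The coordinate vector fields form a frame. -/
def coordBasis (he : e ∈ atlas E3 M) {x : E3} (hx : x ∈ e.target) :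
    Module.Basis (Fin 3) ℝ (TangentSpace (𝓡 3) (e.symm x)) :=
  (EuclideanSpace.basisFun (Fin 3) ℝ).toBasis.map
    { toFun := fun v => (mfderiv (𝓡 3) (𝓡 3) e.symm x (v : E3) : TangentSpace (𝓡 3) (e.symm x))
      map_add' := fun u v => map_add (mfderiv (𝓡 3) (𝓡 3) e.symm x) u v
      map_smul' := fun c v => map_smul (mfderiv (𝓡 3) (𝓡 3) e.symm x) c v
      invFun := fun v => (mfderiv (𝓡 3) (𝓡 3) e (e.symm x) v : E3)
      left_inv := mfderiv_symm_comp he hx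
      right_inv := mfderiv_comp_symm he hx }

theorem coordBasis_apply (he : e ∈ atlas E3 M) {x : E3} (hx : x ∈ e.target) (i : Fin 3) :
    coordBasis he hx i = coordVec e i x := by
  simp only [coordBasis, Module.Basis.map_apply, OrthonormalBasis.coe_toBasis,
    EuclideanSpace.basisFun_apply]
  rfl

theorem PseudoRiemannianMetric.localMetric (g : PseudoRiemannianMetric M) (he : e ∈ atlas E3 M) :
    LocalMetric e.target (g.comp e) where
  isOpen := e.open_target
  smooth := g.contDiffOn_comp he
  symm x _ i j := g.symm _ _ _
  det_ne_zero x hx h0 := by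
    -- A kernel vector of the component matrix would be a nonzero tangent vector orthogonal to
    -- everything.
    obtain ⟨v, hv, h1⟩ := Matrix.exists_vecMul_eq_zero_iff.mpr h0
    have h2 : ∑ i, v i • coordVec e i x = 0 := by
      refine g.nondegenerate _ _ fun w => ?_
      rw [← (coordBasis he hx).sum_repr w]
      simp only [map_sum, map_smul, sum_apply, smul_apply, smul_eq_mul, coordBasis_apply]
      refine Finset.sum_eq_zero fun j _ => ?_
      have h3 := congrFun h1 j
      simp only [Matrix.vecMul, dotProduct, PseudoRiemannianMetric.comp, Matrix.of_apply,
        Pi.zero_apply] at h3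
      rw [h3, mul_zero]
    have h3 := Fintype.linearIndependent_iff.mp (coordBasis he hx).linearIndependent v (by
      simpa only [coordBasis_apply] using h2)
    exact hv (funext h3)

theorem OrientingVolumeForm.localVolume {g : PseudoRiemannianMetric M}
    (vol : OrientingVolumeForm g) (he : e ∈ atlas E3 M) :
    LocalVolume e.target (g.comp e) (vol.comp e) where
  smooth := vol.smooth e he 0 1 2
  swap_left x _ i j k := by
    have := (vol.form (e.symm x)).map_swap ![coordVec e j x, coordVec e i x, coordVec e k x]
      (i := 0) (j := 1) (by decide)
    rw [OrientingVolumeForm.comp, OrientingVolumeForm.comp, ← this]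
    congr 1
    funext a
    fin_cases a <;> rfl
  swap_right x _ i j k := by
    have := (vol.form (e.symm x)).map_swap ![coordVec e i x, coordVec e k x, coordVec e j x]
      (i := 1) (j := 2) (by decide)
    rw [OrientingVolumeForm.comp, OrientingVolumeForm.comp, ← this]
    congr 1
    funext a
    fin_cases a <;> rfl
  sq x _ := by
    rw [OrientingVolumeForm.comp, vol.normalised]
    congr 2
    ext i j
    fin_cases i <;> fin_cases j <;> rfl

theorem SolvesTMG.localTMG {g : PseudoRiemannianMetric M} {vol : OrientingVolumeForm g} {m Λ : ℝ}
    (h : SolvesTMG g vol m Λ) (hm : m ≠ 0) (he : e ∈ atlas E3 M) :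
    LocalTMG e.target (g.comp e) (vol.comp e) m Λ :=
  ⟨g.localMetric he, vol.localVolume he, hm, fun x hx => (h e he x hx).1,
    fun x hx => (h e he x hx).2⟩

end Charts

/-! ### Naturality of the Levi-Civita connection under isometries -/

section Transition

variable {D D' : Set E3} {G G' : E3 → Matrix (Fin 3) (Fin 3) ℝ} {φ : E3 → E3} {x : E3}

/-- A smooth map is an isometry from the metric `G` on `D` to the metric `G'` on `D'`. -/
structure IsLocalIsometry (D D' : Set E3) (G G' : E3 → Matrix (Fin 3) (Fin 3) ℝ) (φ : E3 → E3) :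
    Prop where
  source : LocalMetric D G
  target : LocalMetric D' G'
  smooth : ContDiffOn ℝ ∞ φ D
  mapsTo : ∀ x ∈ D, φ x ∈ D'
  pullback : ∀ x ∈ D, ∀ i j, G x i j =
    ∑ c, ∑ d, G' (φ x) c d * pd i (fun y => φ y c) x * pd j (fun y => φ y d) x

/-- The complexified differential of a map. -/
def push (φ : E3 → E3) (x : E3) : (Fin 3 → ℂ) →ₗ[ℂ] Fin 3 → ℂ :=
  Matrix.mulVecLin (Matrix.of fun c i => ((pd i (fun y => φ y c) x : ℝ) : ℂ))

theorem push_apply (φ : E3 → E3) (x : E3) (u : Fin 3 → ℂ) (c : Fin 3) :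
    push φ x u c = ∑ i, u i * ((pd i (fun y => φ y c) x : ℝ) : ℂ) := by
  simp only [push, Matrix.mulVecLin_apply, Matrix.mulVec, dotProduct, Matrix.of_apply, mul_comm]

theorem push_single (φ : E3 → E3) (x : E3) (i c : Fin 3) :
    push φ x (Pi.single i 1) c = ((pd i (fun y => φ y c) x : ℝ) : ℂ) := by
  simp [push_apply, Pi.single_apply]

theorem pd_coord {i c : Fin 3} (hφ : DifferentiableAt ℝ φ x) :
    pd i (fun y => φ y c) x = fderiv ℝ φ x (EuclideanSpace.single i 1) c := by
  have h := (EuclideanSpace.proj c : E3 →L[ℝ] ℝ).hasFDerivAt.comp x hφ.hasFDerivAt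
  have h' : HasFDerivAt (fun y => φ y c) _ x := h
  rw [pd, h'.fderiv]
  rfl

theorem pd_comp {F : Type*} [NormedAddCommGroup F] [NormedSpace ℝ F] {f : E3 → F} {i : Fin 3}
    (hf : DifferentiableAt ℝ f (φ x)) (hφ : DifferentiableAt ℝ φ x) :
    pd i (fun y => f (φ y)) x = ∑ b, pd i (fun y => φ y b) x • pd b f (φ x) := by
  have h := (hf.hasFDerivAt.comp x hφ.hasFDerivAt).fderiv
  have h' : fderiv ℝ (fun y => f (φ y)) x = _ := h
  simp only [pd_coord hφ]
  rw [pd, h', ContinuousLinearMap.comp_apply, fderiv_apply_eq_sum_pd]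

/-- The covariant derivative, along the `i`-th coordinate field, of a vector field `Y` along the
map `φ`. -/
def covAlong (G' : E3 → Matrix (Fin 3) (Fin 3) ℝ) (φ : E3 → E3) (i : Fin 3) (Y : E3 → Fin 3 → ℂ)
    (x : E3) : Fin 3 → ℂ :=
  fun c => pd i (fun y => Y y c) x +
    ∑ a, ∑ b, (christoffel G' c a b (φ x) : ℂ) * ((pd i (fun y => φ y a) x : ℝ) : ℂ) * Y x b

namespace IsLocalIsometry

theorem diffAt (h : IsLocalIsometry D D' G G' φ) (hx : x ∈ D) : DifferentiableAt ℝ φ x :=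
  (h.smooth.contDiffAt (h.source.isOpen.mem_nhds hx)).differentiableAt (by norm_num)

theorem contDiffOn_coord (h : IsLocalIsometry D D' G G' φ) (c : Fin 3) :
    ContDiffOn ℝ ∞ (fun y => φ y c) D :=
  (EuclideanSpace.proj c : E3 →L[ℝ] ℝ).contDiff.comp_contDiffOn h.smooth

theorem complexBilin_push (h : IsLocalIsometry D D' G G' φ) (hx : x ∈ D) (u v : Fin 3 → ℂ) :
    complexBilin (G' (φ x)) (push φ x u) (push φ x v) = complexBilin (G x) u v := by
  simp only [complexBilin, push_apply, h.pullback x hx, Fin.sum_univ_three]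
  push_cast
  ring

theorem push_injective (h : IsLocalIsometry D D' G G' φ) (hx : x ∈ D) :
    Function.Injective (push φ x) := by
  intro u v huv
  refine eq_of_complexBilin_eq (h.source.det_ne_zero x hx) fun w => ?_
  rw [← h.complexBilin_push hx, ← h.complexBilin_push hx, huv]

theorem push_surjective (h : IsLocalIsometry D D' G G' φ) (hx : x ∈ D) :
    Function.Surjective (push φ x) :=
  LinearMap.surjective_of_injective (h.push_injective hx)

/-- Metric compatibility for fields along `φ`: the metric `G'` is parallel, and the chain rule
brings in the differential of `φ`. -/
theorem pd_complexBilin (h : IsLocalIsometry D D' G G' φ) (hx : x ∈ D) {Y Z : E3 → Fin 3 → ℂ}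
    (hY : DifferentiableAt ℝ Y x) (hZ : DifferentiableAt ℝ Z x) (i : Fin 3) :
    pd i (fun y => complexBilin (G' (φ y)) (Y y) (Z y)) x =
      complexBilin (G' (φ x)) (covAlong G' φ i Y x) (Z x) +
        complexBilin (G' (φ x)) (Y x) (covAlong G' φ i Z x) := by
  have hx' := h.mapsTo x hx
  have h1 : ∀ c, DifferentiableAt ℝ (fun y => Y y c) x := fun c => by fun_prop
  have h2 : ∀ c, DifferentiableAt ℝ (fun y => Z y c) x := fun c => by fun_prop
  have h0 : ∀ c a, DifferentiableAt ℝ (fun y => G' y c a) (φ x) := fun c a =>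
    (h.target.smooth c a).differentiableAt_of_isOpen h.target.isOpen hx'
  have h0' : ∀ c a, DifferentiableAt ℝ (fun y => G' (φ y) c a) x := fun c a =>
    (h0 c a).comp x (h.diffAt hx)
  have h3 : ∀ c a, DifferentiableAt ℝ (fun y => (G' (φ y) c a : ℂ)) x := fun c a =>
    Complex.ofRealCLM.differentiableAt.comp x (h0' c a)
  have hm : ∀ c a, ((pd i (fun y => G' (φ y) c a) x : ℝ) : ℂ) =
      ∑ b, ((pd i (fun y => φ y b) x : ℝ) : ℂ) * ∑ d, ((christoffel G' d b c (φ x) : ℂ) *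
        G' (φ x) d a + (christoffel G' d b a (φ x) : ℂ) * G' (φ x) c d) := fun c a => by
    rw [pd_comp (f := fun y => G' y c a) (h0 c a) (h.diffAt hx)]
    push_cast
    refine Finset.sum_congr rfl fun b _ => ?_
    have := h.target.covDeriv₂_metric hx' b c a
    rw [covDeriv₂, sub_eq_zero] at this
    rw [smul_eq_mul, this]
    push_cast
    rfl
  have h4 : pd i (fun y => complexBilin (G' (φ y)) (Y y) (Z y)) x = ∑ c, ∑ a,
      (((pd i (fun y => G' (φ y) c a) x : ℝ) : ℂ) * Y x c * Z x a +
        (G' (φ x) c a : ℂ) * pd i (fun y => Y y c) x * Z x a +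
        (G' (φ x) c a : ℂ) * Y x c * pd i (fun y => Z y a) x) := by
    simp only [complexBilin]
    rw [pd_sum (f := fun c y => ∑ a, (G' (φ y) c a : ℂ) * Y y c * Z y a) (fun c _ =>
      DifferentiableAt.fun_sum fun a _ => ((h3 c a).mul (h1 c)).mul (h2 a))]
    refine Finset.sum_congr rfl fun c _ => ?_
    rw [pd_sum (f := fun a y => (G' (φ y) c a : ℂ) * Y y c * Z y a) (fun a _ =>
      ((h3 c a).mul (h1 c)).mul (h2 a))]
    refine Finset.sum_congr rfl fun a _ => ?_
    rw [pd_mul ((h3 c a).fun_mul (h1 c)) (h2 a), pd_mul (h3 c a) (h1 c), pd_ofReal (h0' c a)]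
    ring
  rw [h4]
  simp only [hm]
  generalize (fun d b c => (christoffel G' d b c (φ x) : ℂ)) = Γ
  simp only [complexBilin, covAlong, Fin.sum_univ_three]
  ring

theorem diffAt_push (h : IsLocalIsometry D D' G G' φ) (hx : x ∈ D) {Y : E3 → Fin 3 → ℂ}
    (hY : DifferentiableAt ℝ Y x) : DifferentiableAt ℝ (fun y => push φ y (Y y)) x := by
  have h1 : ∀ c, DifferentiableAt ℝ (fun y => Y y c) x := fun c => by fun_prop
  refine differentiableAt_pi.mpr fun c => ?_
  simp only [push_apply]
  exact DifferentiableAt.fun_sum fun i _ => (h1 i).mul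
    (((h.contDiffOn_coord c).pd h.source.isOpen i).ofReal.differentiableAt_of_isOpen
      h.source.isOpen hx)

/-- The transformation law of the Christoffel symbols. -/
theorem covAlong_single (h : IsLocalIsometry D D' G G' φ) (hx : x ∈ D) (i j : Fin 3) :
    covAlong G' φ i (fun y => push φ y (Pi.single j 1)) x =
      push φ x (fun k => (christoffel G k i j x : ℂ)) := by
  have hG' := h.target.symm _ (h.mapsTo x hx)
  set J : Fin 3 → Fin 3 → ℂ := fun j => push φ x (Pi.single j 1) with hJ
  -- The defect of the transformation law. It is symmetric in `i, j` as both connections are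
  -- torsion-free, and pairing with `J l` makes it antisymmetric in `j, l` as both are metric. Both
  -- symmetries together force it to vanish, as in the uniqueness of the Levi-Civita connection.
  set B : Fin 3 → Fin 3 → Fin 3 → ℂ := fun i j =>
    covAlong G' φ i (fun y => push φ y (Pi.single j 1)) x -
      push φ x (fun k => (christoffel G k i j x : ℂ)) with hB
  have hsymm : ∀ i j, B i j = B j i := fun i j => by
    simp only [hB, h.source.christoffel_symm hx _ i j]
    congr 1
    funext c
    simp only [covAlong, push_single]
    have hp : ∀ i j, pd i (fun y => ((pd j (fun y => φ y c) y : ℝ) : ℂ)) x =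
        ((pd i (pd j fun y => φ y c) x : ℝ) : ℂ) := fun i j =>
      pd_ofReal (((h.contDiffOn_coord c).pd h.source.isOpen j).differentiableAt_of_isOpen
        h.source.isOpen hx) i
    rw [hp, hp, pd_comm (h.contDiffOn_coord c) h.source.isOpen hx i j]
    have e := h.target.christoffel_symm (h.mapsTo x hx)
    simp only [Fin.sum_univ_three, e c 1 0, e c 2 0, e c 2 1]
    ring
  have hanti : ∀ i j l, complexBilin (G' (φ x)) (B i j) (J l) +
      complexBilin (G' (φ x)) (B i l) (J j) = 0 := fun i j l => by
    have h1 := h.pd_complexBilin hx (Y := fun y => push φ y (Pi.single j 1))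
      (Z := fun y => push φ y (Pi.single l 1)) (h.diffAt_push hx (differentiableAt_const _))
      (h.diffAt_push hx (differentiableAt_const _)) i
    rw [pd_congr h.source.isOpen (fun y hy => h.complexBilin_push hy _ _) hx] at h1
    have h2 : ∀ y, complexBilin (G y) (Pi.single j 1) (Pi.single l 1) = (G y j l : ℂ) :=
      fun y => by simp [complexBilin, Pi.single_apply]
    simp only [h2] at h1
    rw [pd_ofReal ((h.source.smooth j l).differentiableAt_of_isOpen h.source.isOpen hx)] at h1
    have h3 := h.source.covDeriv₂_metric hx i j l
    rw [covDeriv₂, sub_eq_zero] at h3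
    rw [h3] at h1
    have h4 : ∀ j l, complexBilin (G' (φ x)) (push φ x (fun k => (christoffel G k i j x : ℂ)))
        (J l) = ∑ d, (christoffel G d i j x : ℂ) * G x d l := fun j l => by
      rw [hJ, h.complexBilin_push hx]
      simp [complexBilin, Pi.single_apply, mul_comm]
    simp only [hB, complexBilin_sub_left, h4]
    rw [complexBilin_comm hG' _ (covAlong _ _ _ _ _)] at h1
    push_cast at h1
    simp only [h.source.symm x hx j] at h1
    rw [Finset.sum_add_distrib] at h1
    linear_combination -h1
  have hzero : ∀ i j l, complexBilin (G' (φ x)) (B i j) (J l) = 0 := fun i j l => by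
    have a1 := hanti i j l
    have a2 := hanti l i j
    have a3 := hanti j l i
    rw [hsymm l i, hsymm l j] at a2
    rw [hsymm j i] at a3
    linear_combination (a1 - a2 + a3) / 2
  rw [← sub_eq_zero]
  refine eq_of_complexBilin_eq (h.target.det_ne_zero _ (h.mapsTo x hx)) fun w => ?_
  obtain ⟨w, rfl⟩ := h.push_surjective hx w
  have hw : w = ∑ l, w l • (Pi.single l 1 : Fin 3 → ℂ) := by
    funext c; simp [Pi.single_apply]
  rw [complexBilin_zero_right, complexBilin_comm hG', hw, map_sum]
  simp only [Fin.sum_univ_three, map_smul, complexBilin_add_right, complexBilin_smul_right]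
  have := hzero i j
  simp only [hB, hJ] at this
  rw [this, this, this]
  ring

/-- The covariant derivative is natural under isometries. -/
theorem covAlong_push (h : IsLocalIsometry D D' G G' φ) (hx : x ∈ D) {K : E3 → Fin 3 → ℂ}
    (hK : DifferentiableAt ℝ K x) (i : Fin 3) :
    covAlong G' φ i (fun y => push φ y (K y)) x = push φ x (covCoord G i K x) := by
  have h1 : ∀ j, DifferentiableAt ℝ (fun y => K y j) x := fun j => by fun_prop
  have h2 : ∀ j c, DifferentiableAt ℝ (fun y => ((pd j (fun y => φ y c) y : ℝ) : ℂ)) x := fun j c =>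
    ((h.contDiffOn_coord c).pd h.source.isOpen j).ofReal.differentiableAt_of_isOpen
      h.source.isOpen hx
  funext c
  have h3 := fun j => congrFun (h.covAlong_single hx i j) c
  simp only [covAlong, push_apply, Pi.single_apply, ite_mul, one_mul, zero_mul, Finset.sum_ite_eq',
    Finset.mem_univ, if_true] at h3
  simp only [covAlong, push_apply, covCoord]
  rw [pd_sum (f := fun j y => K y j * ((pd j (fun y => φ y c) y : ℝ) : ℂ))
    fun j _ => (h1 j).mul (h2 j c)]
  simp only [pd_mul (h1 _) (h2 _ c)]
  have h4 : ∀ j, K x j * pd i (fun y => ((pd j (fun y => φ y c) y : ℝ) : ℂ)) x =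
      K x j * (∑ k, (christoffel G k i j x : ℂ) * ((pd k (fun y => φ y c) x : ℝ) : ℂ) -
        ∑ a, ∑ b, (christoffel G' c a b (φ x) : ℂ) * ((pd i (fun y => φ y a) x : ℝ) : ℂ) *
          ((pd j (fun y => φ y b) x : ℝ) : ℂ)) := fun j => by
    rw [← h3 j]; ring
  simp only [h4]
  simp only [Fin.sum_univ_three]
  ring

/-- Co-geodetic null fields are mapped to each other by isometries. -/
theorem coGeodetic (h : IsLocalIsometry D D' G G' φ) (hx : x ∈ D) {K K' : E3 → Fin 3 → ℂ}
    (hK : DifferentiableAt ℝ K x) (hK' : DifferentiableAt ℝ K' (φ x)) {W : Set E3}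
    (hW : IsOpen W) (hxW : x ∈ W) (hp : ∀ y ∈ W, K' (φ y) = push φ y (K y))
    (hc : ∀ u w, complexBilin (G x) u (K x) = 0 → complexBilin (G x) w (K x) = 0 →
      complexBilin (G x) (covD G u K x) w = 0) (u w : Fin 3 → ℂ)
    (hu : complexBilin (G' (φ x)) u (K' (φ x)) = 0)
    (hw : complexBilin (G' (φ x)) w (K' (φ x)) = 0) :
    complexBilin (G' (φ x)) (covD G' u K' (φ x)) w = 0 := by
  obtain ⟨u, rfl⟩ := h.push_surjective hx u
  obtain ⟨w, rfl⟩ := h.push_surjective hx w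
  rw [hp x hxW, h.complexBilin_push hx] at hu hw
  have h1 : ∀ c, DifferentiableAt ℝ (fun y => K' y c) (φ x) := fun c => by fun_prop
  -- By the chain rule, differentiating `K'` along a pushed vector is differentiating `K' ∘ φ`, the
  -- pushed field, along `φ`.
  have h2 : covD G' (push φ x u) K' (φ x) = push φ x (covD G u K x) := by
    rw [covD_eq_sum u, map_sum]
    simp only [map_smul]
    simp only [← h.covAlong_push hx hK]
    funext c
    simp only [covD_eq_sum, covCoord, covAlong, Finset.sum_apply, Pi.smul_apply, smul_eq_mul,
      push_apply φ x u]
    rw [← hp x hxW]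
    simp only [← pd_congr hW (fun y hy => congrFun (hp y hy) c) hxW,
      pd_comp (h1 c) (h.diffAt hx), Complex.real_smul]
    simp only [Fin.sum_univ_three]
    ring
  rw [h2, h.complexBilin_push hx, hc u w hu hw]

end IsLocalIsometry

end Transition

theorem isOpen_chart_inter {M : Type*} [TopologicalSpace M] (e : OpenPartialHomeomorph M E3)
    {V : Set M} (hV : IsOpen V) : IsOpen (e.target ∩ e.symm ⁻¹' V) :=
  e.symm.continuousOn.isOpen_inter_preimage e.open_target hV

/-! ### Equivalent forms of the co-geodetic condition -/

section TotallyGeodetic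

variable {Ω : Set E3} {G : E3 → Matrix (Fin 3) (Fin 3) ℝ} {x : E3} {K : E3 → Fin 3 → ℂ}

theorem memPerp_span_singleton {B : Matrix (Fin 3) (Fin 3) ℝ} {k v : Fin 3 → ℂ} :
    MemPerp B (Submodule.span ℂ {k}) v ↔ complexBilin B v k = 0 := by
  refine ⟨fun h => h k (Submodule.mem_span_singleton_self k), fun h z hz => ?_⟩
  obtain ⟨c, rfl⟩ := Submodule.mem_span_singleton.mp hz
  rw [complexBilin_smul_right, h, mul_zero]

/-- For fields `Y` orthogonal to `K`, one has `g(∇_u Y, K) = -g(Y, ∇_u K)`. -/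
theorem LocalMetric.complexBilin_covD_perp (hG : LocalMetric Ω G) (hx : x ∈ Ω)
    {Y : E3 → Fin 3 → ℂ} (sK : ContDiffOn ℝ ∞ K Ω) (sY : ContDiffOn ℝ ∞ Y Ω)
    (h : ∀ y ∈ Ω, complexBilin (G y) (Y y) (K y) = 0) (u : Fin 3 → ℂ) :
    complexBilin (G x) (covD G u Y x) (K x) = -complexBilin (G x) (covD G u K x) (Y x) := by
  have h1 := hG.dirDeriv_metric hx (sY.diffAt_vec hG.isOpen hx) (sK.diffAt_vec hG.isOpen hx) u
  rw [dirDeriv_eq_zero hG.isOpen h hx, complexBilin_comm (hG.symm x hx) (Y x)] at h1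
  linear_combination -h1

/-- Vectors orthogonal to `K` extend to fields `a K + b n` with constant `a, b`, which stay
orthogonal; `complexBilin_covD_perp` then moves the derivative onto `K`. -/
theorem LocalMetric.coGeodeticOn_of_perp (hG : LocalMetric Ω G) (sK : ContDiffOn ℝ ∞ K Ω)
    (h0 : ∀ y ∈ Ω, K y ≠ 0) (hn : ∀ y ∈ Ω, complexBilin (G y) (K y) (K y) = 0)
    (h : ∀ W ⊆ Ω, IsOpen W → ∀ X Y : E3 → Fin 3 → ℂ, ContDiffOn ℝ ∞ X W → ContDiffOn ℝ ∞ Y W →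
      (∀ y ∈ W, complexBilin (G y) (X y) (K y) = 0 ∧ complexBilin (G y) (Y y) (K y) = 0) →
      ∀ y ∈ W, complexBilin (G y) (covDeriv G X Y y) (K y) = 0) :
    CoGeodeticOn Ω G K := by
  intro x hx u w hu hw
  obtain ⟨W, hW, hxW, hs, l, n, hF⟩ := hG.exists_frameField hx sK (h0 x hx) hn
  have hG' := hG.mono hW hs
  have hf := hF.adapted x hxW
  have hperp : ∀ a b : ℂ, ∀ y ∈ W, complexBilin (G y) (a • K y + b • n y) (K y) = 0 :=
    fun a b y hy => by
      rw [complexBilin_add_left, complexBilin_smul_left, complexBilin_smul_left,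
        (hF.adapted y hy).kk, complexBilin_comm (hG'.symm y hy), (hF.adapted y hy).kn]
      ring
  have hsm : ∀ a b : ℂ, ContDiffOn ℝ ∞ (fun y => a • K y + b • n y) W := fun a b =>
    ((contDiff_const_smul a).comp_contDiffOn (sK.mono hs)).add
      ((contDiff_const_smul b).comp_contDiffOn hF.smooth_n)
  have hexp : ∀ v, complexBilin (G x) v (K x) = 0 → v = complexBilin (G x) v (l x) • K x +
      (-(2 * complexBilin (G x) v (n x))) • n x := fun v hv => by
    have := hf.expand (hG.symm x hx) v
    rw [hv, zero_smul, add_zero] at this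
    rw [neg_smul, ← sub_eq_add_neg]
    exact this
  have key := h W hs hW _ _ (hsm (complexBilin (G x) u (l x)) (-(2 * complexBilin (G x) u (n x))))
    (hsm (complexBilin (G x) w (l x)) (-(2 * complexBilin (G x) w (n x))))
    (fun y hy => ⟨hperp _ _ y hy, hperp _ _ y hy⟩) x hxW
  rw [covDeriv_eq_covD, hG'.complexBilin_covD_perp hxW (sK.mono hs) (hsm _ _) (hperp _ _),
    ← hexp u hu, ← hexp w hw, neg_eq_zero] at key
  exact key

variable {M : Type*} [TopologicalSpace M] [ChartedSpace E3 M] [IsManifold (𝓡 3) ∞ M]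
  {g : PseudoRiemannianMetric M} {V : Set M}
  {N : ∀ p : M, Submodule ℂ (ℂ ⊗[ℝ] TangentSpace (𝓡 3) p)}

/-- In every chart, `N` is locally generated by co-geodetic null fields. -/
def IsLocallyCoGeodetic (g : PseudoRiemannianMetric M) (V : Set M)
    (N : ∀ p : M, Submodule ℂ (ℂ ⊗[ℝ] TangentSpace (𝓡 3) p)) : Prop :=
  ∀ e ∈ atlas E3 M, ∀ x ∈ e.target ∩ e.symm ⁻¹' V,
    ∃ W : Set E3, IsOpen W ∧ x ∈ W ∧ W ⊆ e.target ∩ e.symm ⁻¹' V ∧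
      ∃ K : E3 → Fin 3 → ℂ, ContDiffOn ℝ ∞ K W ∧ (∀ y ∈ W,
        K y ≠ 0 ∧ lineInChart N e y = Submodule.span ℂ {K y} ∧
        complexBilin (g.comp e y) (K y) (K y) = 0) ∧ CoGeodeticOn W (g.comp e) K

/-- Once the derivative is moved from `Y` onto a generator `K`, the condition is pointwise in the
sections, so arbitrary sections cause no difficulty. -/
theorem IsLocallyCoGeodetic.admits (h : IsLocallyCoGeodetic g V N) :
    AdmitsCoGeodeticNullStructure g V := by
  refine ⟨N, fun e he x hx => ?_, fun e he W hW hs X Y Z sX sY sZ hXYZ y hy => ?_⟩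
  · obtain ⟨W, hW, hxW, hs, K, sK, hK, -⟩ := h e he x hx
    exact ⟨W, hW, hxW, hs, K, sK, hK⟩
  · obtain ⟨W', hW', hyW', hs', K, sK, hK, hc⟩ := h e he y (hs hy)
    have hG := (g.localMetric he).mono (hW'.inter hW)
      ((Set.inter_subset_left.trans hs').trans Set.inter_subset_left)
    have hy' : y ∈ W' ∩ W := ⟨hyW', hy⟩
    have hperp : ∀ z ∈ W' ∩ W, complexBilin (g.comp e z) (X z) (K z) = 0 ∧
        complexBilin (g.comp e z) (Y z) (K z) = 0 := fun z hz => by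
      have := hXYZ z hz.2
      rw [(hK z hz.1).2.1, memPerp_span_singleton, memPerp_span_singleton] at this
      exact ⟨this.1, this.2.1⟩
    have hZ := (hXYZ y hy).2.2
    rw [(hK y hyW').2.1] at hZ
    obtain ⟨c, hc'⟩ := Submodule.mem_span_singleton.mp hZ
    rw [← hc', complexBilin_smul_right, covDeriv_eq_covD,
      hG.complexBilin_covD_perp hy' (sK.mono Set.inter_subset_left)
        (sY.mono Set.inter_subset_right) (fun z hz => (hperp z hz).2),
      hc y hyW' _ _ (hperp y hy').1 (hperp y hy').2, neg_zero, mul_zero]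

theorem IsNullStructureOn.isLocallyCoGeodetic (h : IsNullStructureOn g V N)
    (h' : PerpTotallyGeodeticOn g V N) : IsLocallyCoGeodetic g V N := by
  intro e he x hx
  obtain ⟨W, hW, hxW, hs, K, sK, hK⟩ := h e he x hx
  refine ⟨W, hW, hxW, hs, K, sK, hK, ?_⟩
  refine ((g.localMetric he).mono hW (hs.trans Set.inter_subset_left)).coGeodeticOn_of_perp sK
    (fun y hy => (hK y hy).1) (fun y hy => (hK y hy).2.2) fun W' hs' hW' X Y sX sY hXY y hy => ?_
  refine h' e he W' hW' (hs'.trans hs) X Y K sX sY (sK.mono hs') (fun z hz => ?_) y hy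
  rw [(hK z (hs' hz)).2.1, memPerp_span_singleton, memPerp_span_singleton]
  exact ⟨(hXY z hz).1, (hXY z hz).2, Submodule.mem_span_singleton_self _⟩

end TotallyGeodetic

/-! ### Chart transitions as isometries -/

section ChartTransition

theorem push_ofReal {φ : E3 → E3} {x : E3} (hφ : DifferentiableAt ℝ φ x) (v : E3) (c : Fin 3) :
    push φ x (fun i => (v i : ℂ)) c = (fderiv ℝ φ x v c : ℂ) := by
  simp only [push_apply, pd_coord hφ]
  rw [fderiv_apply_eq_sum_pd φ x v]
  simp [pd]

variable {M : Type*} [TopologicalSpace M] [ChartedSpace E3 M]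

/-- The differential of a chart. -/
def chartDiff (e : OpenPartialHomeomorph M E3) (p : M) (v : TangentSpace (𝓡 3) p) : E3 :=
  mfderiv (𝓡 3) (𝓡 3) e p v

theorem realCoords_apply (e : OpenPartialHomeomorph M E3) (p : M) (v : TangentSpace (𝓡 3) p)
    (a : Fin 3) : realCoords e p v a = ((chartDiff e p v a : ℝ) : ℂ) := rfl

variable [IsManifold (𝓡 3) ∞ M]
  {e e' : OpenPartialHomeomorph M E3} {p : M}

theorem contDiffOn_transition (he : e ∈ atlas E3 M) (he' : e' ∈ atlas E3 M) :
    ContDiffOn ℝ ∞ (e' ∘ e.symm) (e.target ∩ e.symm ⁻¹' e'.source) := by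
  rw [← contMDiffOn_iff_contDiffOn]
  have h1 : ContMDiffOn (𝓡 3) (𝓡 3) ∞ e.symm e.target :=
    contMDiffOn_symm_of_mem_maximalAtlas
      (StructureGroupoid.subset_maximalAtlas (contDiffGroupoid ∞ (𝓡 3)) he)
  have h2 : ContMDiffOn (𝓡 3) (𝓡 3) ∞ e' e'.source :=
    contMDiffOn_of_mem_maximalAtlas
      (StructureGroupoid.subset_maximalAtlas (contDiffGroupoid ∞ (𝓡 3)) he')
  exact h2.comp' h1

theorem chartDiff_coordVec (he : e ∈ atlas E3 M) {x : E3} (hx : x ∈ e.target) (i : Fin 3) :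
    chartDiff e (e.symm x) (coordVec e i x) = EuclideanSpace.single i 1 :=
  mfderiv_symm_comp he hx _

theorem differentiableAt_transition (he : e ∈ atlas E3 M) (he' : e' ∈ atlas E3 M)
    (hp : p ∈ e.source) (hp' : p ∈ e'.source) : DifferentiableAt ℝ (e' ∘ e.symm) (e p) := by
  have hx : e p ∈ e.target ∩ e.symm ⁻¹' e'.source := ⟨e.map_source hp, by
    rw [Set.mem_preimage, e.left_inv hp]; exact hp'⟩
  exact ((contDiffOn_transition he he').contDiffAt ((isOpen_chart_inter e e'.open_source).mem_nhds
    hx)).differentiableAt (by norm_num)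

theorem chartDiff_transition (he : e ∈ atlas E3 M) (he' : e' ∈ atlas E3 M) (hp : p ∈ e.source)
    (hp' : p ∈ e'.source) (v : TangentSpace (𝓡 3) p) :
    chartDiff e' p v = fderiv ℝ (e' ∘ e.symm) (e p) (chartDiff e p v) := by
  have h1 := differentiableAt_transition he he' hp hp'
  have h2 : e' =ᶠ[nhds p] (e' ∘ e.symm) ∘ e := by
    filter_upwards [e.open_source.mem_nhds hp] with q hq
    simp [e.left_inv hq]
  rw [chartDiff, h2.mfderiv_eq, mfderiv_comp p h1.mdifferentiableAt (mdifferentiableAt_atlas he hp),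
    mfderiv_eq_fderiv]
  rfl

/-- Both sides are complex-linear, so the chain rule on pure tensors suffices. -/
theorem complexCoords_transition (he : e ∈ atlas E3 M) (he' : e' ∈ atlas E3 M) (hp : p ∈ e.source)
    (hp' : p ∈ e'.source) :
    complexCoords e' p = (push (e' ∘ e.symm) (e p)).comp (complexCoords e p) := by
  refine TensorProduct.AlgebraTensorModule.ext fun c v => ?_
  funext a
  simp only [complexCoords, LinearMap.comp_apply, LinearMap.liftBaseChange_tmul, map_smul,
    Pi.smul_apply]
  congr 1
  rw [realCoords_apply, chartDiff_transition he he' hp hp']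
  exact (push_ofReal (differentiableAt_transition he he' hp hp') _ _).symm

theorem complexCoords_surjective (he : e ∈ atlas E3 M) (hp : p ∈ e.source) :
    Function.Surjective (complexCoords e p) := by
  obtain ⟨x, hx, rfl⟩ : ∃ x ∈ e.target, e.symm x = p := ⟨e p, e.map_source hp, e.left_inv hp⟩
  intro u
  refine ⟨∑ i, u i ⊗ₜ[ℝ] coordVec e i x, ?_⟩
  funext a
  simp only [complexCoords, map_sum, LinearMap.liftBaseChange_tmul, Finset.sum_apply,
    Pi.smul_apply, realCoords_apply, chartDiff_coordVec he hx]
  simp [apply_ite]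

theorem PseudoRiemannianMetric.inner_eq_comp (g : PseudoRiemannianMetric M) (he : e ∈ atlas E3 M)
    (hp : p ∈ e.source) (v w : TangentSpace (𝓡 3) p) :
    g.inner p v w = ∑ i, ∑ j, g.comp e (e p) i j * chartDiff e p v i * chartDiff e p w j := by
  obtain ⟨x, hx, rfl⟩ : ∃ x ∈ e.target, e.symm x = p := ⟨e p, e.map_source hp, e.left_inv hp⟩
  have h1 : ∀ v : TangentSpace (𝓡 3) (e.symm x),
      v = ∑ i, chartDiff e (e.symm x) v i • coordVec e i x := fun v => by
    have h2 : chartDiff e (e.symm x) v = ∑ i, chartDiff e (e.symm x) v i •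
        (EuclideanSpace.single i 1 : E3) := by
      ext j
      simp [Pi.single_apply]
    have h3 := mfderiv_comp_symm he hx v
    change mfderiv (𝓡 3) (𝓡 3) e.symm x (chartDiff e (e.symm x) v) = v at h3
    refine h3.symm.trans ?_
    conv_lhs => rw [h2]
    exact (map_sum (mfderiv (𝓡 3) (𝓡 3) e.symm x) _ _).trans
      (Finset.sum_congr rfl fun i _ => map_smul (mfderiv (𝓡 3) (𝓡 3) e.symm x) _ _)
  conv_lhs => rw [h1 v, h1 w]
  rw [e.right_inv hx]
  simp only [map_sum, map_smul, sum_apply, smul_apply, smul_eq_mul,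
    PseudoRiemannianMetric.comp, Matrix.of_apply]
  simp only [Fin.sum_univ_three]
  ring

/-- Chart transitions are isometries. -/
theorem PseudoRiemannianMetric.isLocalIsometry_transition (g : PseudoRiemannianMetric M)
    (he : e ∈ atlas E3 M) (he' : e' ∈ atlas E3 M) :
    IsLocalIsometry (e.target ∩ e.symm ⁻¹' e'.source) e'.target (g.comp e) (g.comp e')
      (e' ∘ e.symm) where
  source := (g.localMetric he).mono (isOpen_chart_inter e e'.open_source) Set.inter_subset_left
  target := g.localMetric he'
  smooth := contDiffOn_transition he he'
  mapsTo x hx := e'.map_source hx.2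
  pullback x hx i j := by
    have hd := differentiableAt_transition he he' (e.map_target hx.1) hx.2
    have h1 : ∀ i, chartDiff e' (e.symm x) (coordVec e i x) =
        fderiv ℝ (e' ∘ e.symm) x (EuclideanSpace.single i 1) := fun i => by
      rw [chartDiff_transition he he' (e.map_target hx.1) hx.2, chartDiff_coordVec he hx.1,
        e.right_inv hx.1]
    rw [e.right_inv hx.1] at hd
    rw [PseudoRiemannianMetric.comp, Matrix.of_apply, g.inner_eq_comp he' hx.2, h1, h1]
    simp only [pd_coord hd]
    rfl

end ChartTransition

/-! ### Extending a null structure from one chart to all charts -/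

section Extension

variable {M : Type*} [TopologicalSpace M] [ChartedSpace E3 M] [IsManifold (𝓡 3) ∞ M]
  {e e₀ : OpenPartialHomeomorph M E3} {g : PseudoRiemannianMetric M}

/-- A co-geodetic null field in one chart spans a co-geodetic null structure in all charts. -/
theorem isLocallyCoGeodetic_of_chart (he₀ : e₀ ∈ atlas E3 M) {W₀ : Set E3} (hW₀ : IsOpen W₀)
    {K₀ : E3 → Fin 3 → ℂ} (sK₀ : ContDiffOn ℝ ∞ K₀ W₀)
    (hK₀ : ∀ y ∈ W₀, K₀ y ≠ 0 ∧ complexBilin (g.comp e₀ y) (K₀ y) (K₀ y) = 0)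
    (hc₀ : CoGeodeticOn W₀ (g.comp e₀) K₀) :
    IsLocallyCoGeodetic g (e₀.source ∩ e₀ ⁻¹' W₀)
      (fun p => (Submodule.span ℂ {K₀ (e₀ p)}).comap (complexCoords e₀ p)) := by
  intro e he x hx
  have hV : IsOpen (e₀.source ∩ e₀ ⁻¹' W₀) := e₀.isOpen_inter_preimage hW₀
  have hφ := g.isLocalIsometry_transition he₀ he
  have hψ := g.isLocalIsometry_transition he he₀
  have hWψ : ∀ y ∈ e.target ∩ e.symm ⁻¹' (e₀.source ∩ e₀ ⁻¹' W₀),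
      y ∈ e.target ∩ e.symm ⁻¹' e₀.source := fun y hy => ⟨hy.1, hy.2.1⟩
  have hinv : ∀ y ∈ e.target ∩ e.symm ⁻¹' e₀.source,
      (e ∘ e₀.symm) ((e₀ ∘ e.symm) y) = y := fun y hy => by
    simp only [Function.comp_apply, e₀.left_inv hy.2, e.right_inv hy.1]
  have hinv' : ∀ z ∈ e₀.target ∩ e₀.symm ⁻¹' e.source,
      (e₀ ∘ e.symm) ((e ∘ e₀.symm) z) = z := fun z hz => by
    simp only [Function.comp_apply, e.left_inv hz.2, e₀.right_inv hz.1]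
  have hmem : ∀ y ∈ e.target ∩ e.symm ⁻¹' e₀.source,
      (e₀ ∘ e.symm) y ∈ e₀.target ∩ e₀.symm ⁻¹' e.source := fun y hy =>
    ⟨e₀.map_source hy.2, by
      simp only [Set.mem_preimage, Function.comp_apply, e₀.left_inv hy.2]
      exact e.map_target hy.1⟩
  set D := e₀.target ∩ e₀.symm ⁻¹' e.source with hD
  have hDo : IsOpen (W₀ ∩ D) := hW₀.inter (isOpen_chart_inter e₀ e.open_source)
  have hW := isOpen_chart_inter e hV
  set W := e.target ∩ e.symm ⁻¹' (e₀.source ∩ e₀ ⁻¹' W₀) with hWdef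
  have hmaps : Set.MapsTo (e₀ ∘ e.symm) W (W₀ ∩ D) := fun y hy => ⟨hy.2.2, hmem y (hWψ y hy)⟩
  -- Transport of `K₀` by the differential of the transition from `e₀` to `e`, based at the
  -- `e₀`-coordinates of the point.
  set K : E3 → Fin 3 → ℂ := fun y =>
    push (e ∘ e₀.symm) ((e₀ ∘ e.symm) y) (K₀ ((e₀ ∘ e.symm) y)) with hK
  have sP : ContDiffOn ℝ ∞ (fun z => push (e ∘ e₀.symm) z (K₀ z)) (W₀ ∩ D) := by
    refine contDiffOn_pi.mpr fun c => ?_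
    simp only [push_apply]
    exact ContDiffOn.sum fun i _ => (contDiffOn_pi.mp (sK₀.mono Set.inter_subset_left) i).mul
      (((hφ.contDiffOn_coord c).pd hφ.source.isOpen i).ofReal.mono Set.inter_subset_right)
  have sK : ContDiffOn ℝ ∞ K W := sP.comp (hψ.smooth.mono hWψ) hmaps
  refine ⟨W, hW, hx, subset_rfl, K, sK, fun y hy => ⟨fun h0 => ?_, ?_, ?_⟩, fun y hy => ?_⟩
  · refine (hK₀ _ (hmaps hy).1).1 (hφ.push_injective (hmaps hy).2 (h0.trans (map_zero _).symm))
  · have hp := e.map_target hy.1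
    rw [lineInChart, complexCoords_transition he₀ he hy.2.1 hp, Submodule.map_comp,
      Submodule.map_comap_eq_of_surjective (complexCoords_surjective he₀ hy.2.1),
      Submodule.map_span, Set.image_singleton]
    rfl
  · have := hφ.complexBilin_push (hmaps hy).2 (K₀ ((e₀ ∘ e.symm) y)) (K₀ ((e₀ ∘ e.symm) y))
    rw [hinv y (hWψ y hy), (hK₀ _ (hmaps hy).1).2] at this
    exact this
  · have hz := hmaps hy
    have key := hφ.coGeodetic hz.2 (K := K₀) (K' := K)
      (sK₀.diffAt_vec hW₀ hz.1) (by
        rw [hinv y (hWψ y hy)]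
        exact sK.diffAt_vec hW hy) hDo hz (fun z hz' => by rw [hK]; simp only [hinv' z hz'.2])
      (hc₀ _ hz.1)
    rw [hinv y (hWψ y hy)] at key
    exact key

end Extension

/-! ### The equivalence on the manifold -/

section MainTheorem

variable {M : Type*} [TopologicalSpace M] [ChartedSpace E3 M] [IsManifold (𝓡 3) ∞ M]
  {g : PseudoRiemannianMetric M} {vol : OrientingVolumeForm g} {m Λ : ℝ} {U V : Set M}
  {τ : PetrovType} {p : M}

/-- Five quartic coefficients and the trace condition determine all six components of a symmetric
tensor. -/
theorem IsTracefreePair.eq_zero_of_O {B Φ : Matrix (Fin 3) (Fin 3) ℝ} {k l n : Fin 3 → ℂ}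
    (h : IsTracefreePair B Φ) (hf : IsAdaptedFrame B k l n)
    (hq : QuarticHasType (ricciQuartic Φ k l n) .O) : Φ = 0 := by
  obtain ⟨h0, h1, h2, h3, h4⟩ := quartic_coeff_eq (b₀ := 0) (b₁ := 0) (b₂ := 0) (b₃ := 0) (b₄ := 0)
    fun s t => (ricciQuartic_eq h.symm' k l n s t).symm.trans ((hq s t).trans (by ring))
  have ht := h.trace k l n hf
  have hnn : complexBilin Φ n n = 0 := by linear_combination h2 / 3 - ht / 3
  have hkk : complexBilin Φ k k = 0 := by linear_combination 2 * h0
  have hkn : complexBilin Φ k n = 0 := by linear_combination h1 / 2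
  have hnl : complexBilin Φ n l = 0 := by linear_combination h3 / 2
  have hll : complexBilin Φ l l = 0 := by linear_combination 2 * h4
  have hkl : complexBilin Φ k l = 0 := ht.trans hnn
  have hz : ∀ u v, complexBilin Φ u v = 0 := fun u v => by
    rw [hf.expand h.symm u, hf.expand h.symm v]
    simp only [complexBilin_add_left, complexBilin_add_right, complexBilin_sub_left,
      complexBilin_sub_right, complexBilin_smul_left, complexBilin_smul_right,
      complexBilin_comm h.symm' l k, complexBilin_comm h.symm' n k,
      complexBilin_comm h.symm' l n, hnn, hkk, hkn, hnl, hll, hkl]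
    ring
  ext i j
  have := hz (Pi.single i 1) (Pi.single j 1)
  simpa [complexBilin, Pi.single_apply] using this

/-- The line `N p` is itself the multiple principal direction; no constancy of the Petrov type is
involved. -/
theorem IsLocallyCoGeodetic.algSpecialAt {N : ∀ p : M, Submodule ℂ (ℂ ⊗[ℝ] TangentSpace (𝓡 3) p)}
    (h : SolvesTMG g vol m Λ) (hm : m ≠ 0) (hN : IsLocallyCoGeodetic g V N) (hp : p ∈ V) :
    AlgSpecialAt g p := by
  refine ⟨N p, fun e he hpe => ?_⟩
  obtain ⟨x, hx, rfl⟩ : ∃ x ∈ e.target, e.symm x = p := ⟨e p, e.map_source hpe, e.left_inv hpe⟩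
  rw [e.right_inv hx]
  obtain ⟨W, hW, hxW, hs, K, sK, hK, hc⟩ := hN e he x ⟨hx, hp⟩
  have hT := (h.localTMG hm he).mono hW (hs.trans Set.inter_subset_left)
  obtain ⟨l, n, hf⟩ := hT.exists_specialFrame sK (fun y hy => (hK y hy).1)
    (fun y hy => (hK y hy).2.2) hc hxW
  have hL : (N (e.symm x)).map (complexCoords e (e.symm x)) = Submodule.span ℂ {K x} :=
    (hK x hxW).2.1
  rw [hL]
  exact hf.toIsAdaptedFrame.isMultiplePrincipal (hT.metric.isTracefreePair hxW).symm' hf.phi_kk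
    hf.phi_kn

theorem AdmitsCoGeodeticNullStructure.algSpecialAt (h : SolvesTMG g vol m Λ) (hm : m ≠ 0)
    (hV : AdmitsCoGeodeticNullStructure g V) (hp : p ∈ V) : AlgSpecialAt g p := by
  obtain ⟨N, h1, h2⟩ := hV
  exact (h1.isLocallyCoGeodetic h2).algSpecialAt h hm hp

theorem hasPetrovType_chart {e : OpenPartialHomeomorph M E3} (hτ : ∀ p ∈ U, HasPetrovTypeAt g p τ)
    (he : e ∈ atlas E3 M) {x : E3} (hx : x ∈ e.target ∩ e.symm ⁻¹' U) :
    HasPetrovType (g.comp e x) (phi (g.comp e) x) τ := by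
  have := hτ _ hx.2 e he (e.map_target hx.1)
  rw [e.right_inv hx.1] at this
  exact this

theorem IsMultiplePrincipalAt.exists_specialFrame {e : OpenPartialHomeomorph M E3}
    {L : Submodule ℂ (ℂ ⊗[ℝ] TangentSpace (𝓡 3) p)} (h : IsMultiplePrincipalAt g p L)
    (he : e ∈ atlas E3 M) (hp : p ∈ e.source) :
    ∃ k l n, IsSpecialFrame (g.comp e (e p)) (phi (g.comp e) (e p)) k l n ∧
      L.map (complexCoords e p) = Submodule.span ℂ {k} := by
  have hT := (g.localMetric he).isTracefreePair (e.map_source hp)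
  obtain ⟨k, l, n, hf, h0, h1, hL⟩ := (h e he hp).exists_isNullEigen hT.symm hT.symm'
  exact ⟨k, l, n, ⟨hf, h0, h1⟩, hL⟩

theorem type_ne_I (hτ : ∀ p ∈ U, HasPetrovTypeAt g p τ) (hp : p ∈ U) (h : AlgSpecialAt g p) :
    τ ≠ .I := by
  rintro rfl
  obtain ⟨L, hL⟩ := h
  have he := chart_mem_atlas E3 p
  have hpe := mem_chart_source E3 p
  obtain ⟨k, l, n, hf, -⟩ := hL.exists_specialFrame he hpe
  exact not_isSpecialFrame_of_I ((g.localMetric he).isTracefreePair ((chartAt E3 p).map_source hpe))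
    (hτ p hp _ he hpe k l n hf.toIsAdaptedFrame) hf

/-- A co-geodetic null field in a single chart suffices. In type O it comes from constant curvature,
otherwise from a smooth multiple principal direction. -/
theorem AlgSpecialAt.exists_coGeodetic (h : SolvesTMG g vol m Λ) (hm : m ≠ 0) (hU : IsOpen U)
    (hτ : ∀ p ∈ U, HasPetrovTypeAt g p τ) (hp : p ∈ U) (hs : AlgSpecialAt g p) :
    ∃ V : Set M, IsOpen V ∧ p ∈ V ∧ V ⊆ U ∧ AdmitsCoGeodeticNullStructure g V := by
  have hI := type_ne_I hτ hp hs
  obtain ⟨L, hL⟩ := hs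
  set e := chartAt E3 p
  have he : e ∈ atlas E3 M := chart_mem_atlas E3 p
  have hpe : p ∈ e.source := mem_chart_source E3 p
  obtain ⟨k, l, n, hf, -⟩ := hL.exists_specialFrame he hpe
  have hΩ := isOpen_chart_inter e hU
  have hx : e p ∈ e.target ∩ e.symm ⁻¹' U :=
    ⟨e.map_source hpe, by rw [Set.mem_preimage, e.left_inv hpe]; exact hp⟩
  have hT := (h.localTMG hm he).mono hΩ Set.inter_subset_left
  obtain ⟨W, hW, hxW, hWs, K, sK, hK, hc⟩ : ∃ W, IsOpen W ∧ e p ∈ W ∧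
      W ⊆ e.target ∩ e.symm ⁻¹' U ∧ ∃ K : E3 → Fin 3 → ℂ, ContDiffOn ℝ ∞ K W ∧
      (∀ y ∈ W, K y ≠ 0 ∧ complexBilin (g.comp e y) (K y) (K y) = 0) ∧
      CoGeodeticOn W (g.comp e) K := by
    by_cases hO : τ = .O
    · subst hO
      obtain ⟨W, hW, hxW, hWs, k', l', n', hF⟩ :=
        hT.metric.exists_frame_near hx hf.toIsAdaptedFrame
      have hT' := hT.mono hW hWs
      obtain ⟨W', hW', hxW', hWs', H⟩ := hT'.metric.exists_coGeodetic_of_einstein hxW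
        (fun y hy => ⟨_, _, _, hF.adapted y hy⟩) hT'.scalar fun y hy =>
          (hT'.metric.isTracefreePair hy).eq_zero_of_O (hF.adapted y hy)
            (hasPetrovType_chart hτ he (hWs hy) _ _ _ (hF.adapted y hy))
      exact ⟨W', hW', hxW', hWs'.trans hWs, H⟩
    · obtain ⟨W, hW, hxW, hWs, K, sK, hK⟩ := hT.metric.exists_smooth_nullEigen hx
        (fun y hy => hasPetrovType_chart hτ he hy) hI hO hf.toIsAdaptedFrame
      exact ⟨W, hW, hxW, hWs, K, sK, fun y hy => ⟨(hK y hy).1, (hK y hy).2.1⟩,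
        (hT.mono hW hWs).coGeodeticOn (fun y hy => hasPetrovType_chart hτ he (hWs hy)) hI hO sK hK⟩
  refine ⟨e.source ∩ e ⁻¹' W, e.isOpen_inter_preimage hW, ⟨hpe, hxW⟩, fun q hq => ?_,
    (isLocallyCoGeodetic_of_chart he hW sK hK hc).admits⟩
  have := (hWs hq.2).2
  rwa [Set.mem_preimage, e.left_inv hq.1] at this

/-- The principal lines are chosen pointwise, without continuity. Outside types D and O the line is
unique, so it is spanned by the local smooth field, and no gluing is needed. In type D the two lines
might be interchanged along a loop. -/
theorem admits_of_algSpecialAt (h : SolvesTMG g vol m Λ) (hm : m ≠ 0) (hU : IsOpen U)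
    (hτ : ∀ p ∈ U, HasPetrovTypeAt g p τ) (hD : τ ≠ .D) (hO : τ ≠ .O)
    (hs : ∀ p ∈ U, AlgSpecialAt g p) : AdmitsCoGeodeticNullStructure g U := by
  choose! L hL using hs
  refine IsLocallyCoGeodetic.admits (N := L) fun e he x hx => ?_
  have hI := type_ne_I hτ hx.2 ⟨_, hL _ hx.2⟩
  have hT := (h.localTMG hm he).mono (isOpen_chart_inter e hU) Set.inter_subset_left
  have hsp : ∀ y ∈ e.target ∩ e.symm ⁻¹' U, ∃ k l n,
      IsSpecialFrame (g.comp e y) (phi (g.comp e) y) k l n ∧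
        lineInChart L e y = Submodule.span ℂ {k} := fun y hy => by
    have := (hL _ hy.2).exists_specialFrame he (e.map_target hy.1)
    rw [e.right_inv hy.1] at this
    exact this
  obtain ⟨k, l, n, hf, -⟩ := hsp x hx
  obtain ⟨W, hW, hxW, hWs, K, sK, hK⟩ := hT.metric.exists_smooth_nullEigen hx
    (fun y hy => hasPetrovType_chart hτ he hy) hI hO hf.toIsAdaptedFrame
  refine ⟨W, hW, hxW, hWs, K, sK, fun y hy => ⟨(hK y hy).1, ?_, (hK y hy).2.1⟩,
    (hT.mono hW hWs).coGeodeticOn (fun y hy => hasPetrovType_chart hτ he (hWs hy)) hI hO sK hK⟩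
  obtain ⟨k, l, n, hf, hk⟩ := hsp y (hWs hy)
  have hp := hT.metric.isTracefreePair (hWs hy)
  rw [hk]
  exact (hf.isNullEigen hp).span_eq hp (hK y hy) (hasPetrovType_chart hτ he (hWs hy)) hI hO hD

end MainTheorem

end TMG

end

theorem mainTheorem1 {M : Type*} [TopologicalSpace M] [ChartedSpace TMG.E3 M]
    [IsManifold (𝓡 3) ∞ M] (g : TMG.PseudoRiemannianMetric M) (vol : TMG.OrientingVolumeForm g)
    (m Λ : ℝ) (hm : m ≠ 0) (hTMG : TMG.SolvesTMG g vol m Λ)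
    (U : Set M) (hU : IsOpen U) (τ : TMG.PetrovType)
    (hτ : ∀ p ∈ U, TMG.HasPetrovTypeAt g p τ) :
    (∀ p ∈ U, TMG.AlgSpecialAt g p ↔
      ∃ V : Set M, IsOpen V ∧ p ∈ V ∧ V ⊆ U ∧ TMG.AdmitsCoGeodeticNullStructure g V) ∧
    (τ ≠ .D → τ ≠ .O →
      ((∀ p ∈ U, TMG.AlgSpecialAt g p) ↔ TMG.AdmitsCoGeodeticNullStructure g U)) := by
  refine ⟨fun p hp => ⟨fun h => h.exists_coGeodetic hTMG hm hU hτ hp,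
    fun ⟨V, _, hpV, _, hV⟩ => hV.algSpecialAt hTMG hm hpV⟩,
    fun hD hO => ⟨TMG.admits_of_algSpecialAt hTMG hm hU hτ hD hO,
      fun h p hp => h.algSpecialAt hTMG hm hp⟩⟩
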